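/- A bipartite hypergraph $H=(A,B,E)$ is a finite hypergraph with disjoint vertex sets $A,B$ in which every hyperedge $e\in E$ satisfies $|e\cap A|=1$ and $|e\cap B|\ge 1$; it is $r$-bounded if $|e\cap B|\le r$ for all $e\in E$. Put $n=|A|+|B|$ and $p=\sum_{e\in E}|e|$. For $S\subseteq A$ let $E_S=\{e\in E: e\cap S\ne\emptyset\}$ and let $\tau(E_S)$ be the minimum size of a set $T\subseteq B$ that meets every $e\in E_S$. $H$ satisfies the $\varphi$-strong Haxell condition if $\tau(E_S)\ge\varphi|S|$ for every $S\subseteq A$. A perfect matching is a set $M\subseteq E$ of pairwise disjoint hyperedges that covers every vertex of $A$. **Theorem 1.4.** There are a deterministic word-RAM algorithm and absolute constants $C,c>0$ such that the following holds for every function $d:\mathbb N\to\mathbb R$, every integer $r\ge 1$ and every $r$-bounded bipartite hypergraph $H$ with $d(n)\ge 4$ that satisfies the $\varphi$-strong Haxell condition for some $\varphi\ge d(n)\,r^2$. Given $H$ as an explicit list of its hyperedges (in any order), the algorithm outputs a perfect matching of $H$ after at most $$C\cdot \max(p,1)^{\,1+\frac{1}{c\sqrt{\log_2 d(n)}}}$$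 steps, that is, in time $O\bigl(p^{1+1/\Omega(\sqrt{\log d(n)})}\bigr)$. Words have $w$ bits, for any $w\ge\kappa\log_2(n+p+2)$ with an absolute constant $\kappa$; memory is initially zero outside the input. -/

import Mathlib

/-- A bipartite hypergraph with vertex classes `A` and `B`: every hyperedge is a set of vertices
that contains exactly one vertex of `A` and at least one vertex of `B`. -/
structure BipartiteHypergraph (A B : Type*) where
  /-- the set of hyperedges -/
  E : Finset (Finset (A ⊕ B))
  card_A : ∀ e ∈ E, e.toLeft.card = 1
  card_B : ∀ e ∈ E, 1 ≤ e.toRight.card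

namespace BipartiteHypergraph

variable {A B : Type*}

/-- Every hyperedge has at most `r` vertices in `B`. -/
def IsBounded (H : BipartiteHypergraph A B) (r : ℕ) : Prop :=
  ∀ e ∈ H.E, e.toRight.card ≤ r

/-- The number of vertices `n = |A| + |B|`. -/
def numVertices [Fintype A] [Fintype B] (_H : BipartiteHypergraph A B) : ℕ :=
  Fintype.card A + Fintype.card B

/-- The total edge volume `p = ∑ e ∈ E, |e|`. -/
def volume (H : BipartiteHypergraph A B) : ℕ := ∑ e ∈ H.E, e.card

/-- `E_S`, the hyperedges that meet `S ⊆ A`. -/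
def edgesAt (H : BipartiteHypergraph A B) (S : Finset A) : Set (Finset (A ⊕ B)) :=
  {e | e ∈ H.E ∧ ∃ a ∈ S, Sum.inl a ∈ e}

/-- `T ⊆ B` meets every hyperedge of `F`. -/
def IsHittingSet (F : Set (Finset (A ⊕ B))) (T : Finset B) : Prop :=
  ∀ e ∈ F, ∃ b ∈ T, Sum.inr b ∈ e

/-- `τ(F)`, the least size of a set `T ⊆ B` that meets every hyperedge of `F`. -/
noncomputable def tau (F : Set (Finset (A ⊕ B))) : ℕ :=
  sInf {k | ∃ T : Finset B, IsHittingSet F T ∧ T.card = k}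

/-- For finite `B` the minimum in the definition of `τ(E_S)` is over a nonempty set. -/
theorem exists_hittingSet [Fintype B] (H : BipartiteHypergraph A B) (S : Finset A) :
    {k | ∃ T : Finset B, IsHittingSet (H.edgesAt S) T ∧ T.card = k}.Nonempty := by
  refine ⟨_, Finset.univ, fun e he => ?_, rfl⟩
  obtain ⟨b, hb⟩ := Finset.card_pos.mp (H.card_B e he.1)
  exact ⟨b, Finset.mem_univ b, Finset.mem_toRight.mp hb⟩

/-- The `φ`-strong Haxell condition: `τ(E_S) ≥ φ |S|` for every `S ⊆ A`. -/
def StrongHaxell (H : BipartiteHypergraph A B) (φ : ℝ) : Prop :=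
  ∀ S : Finset A, φ * (S.card : ℝ) ≤ (tau (H.edgesAt S) : ℝ)

/-- A perfect matching: a set of pairwise disjoint hyperedges that covers every vertex of `A`. -/
def IsPerfectMatching (H : BipartiteHypergraph A B) (M : Finset (Finset (A ⊕ B))) : Prop :=
  M ⊆ H.E ∧ (∀ e ∈ M, ∀ f ∈ M, e ≠ f → Disjoint e f) ∧ ∀ a : A, ∃ e ∈ M, Sum.inl a ∈ e

end BipartiteHypergraph

/-! A word RAM with words of `w` bits. A program uses finitely many registers and finitely many
arrays, whose entries and indices are words. All arithmetic is done modulo `2 ^ w`. The time of a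
run is the number of elementary operations (evaluations of a node of an expression, assignments,
array writes, tests) that it performs. -/
namespace WordRAM

/-- Contents of the registers and of the arrays. -/
structure State where
  reg : ℕ → ℕ
  arr : ℕ → ℕ → ℕ

inductive BinOp
  | add | sub | mul | div | mod | lt | eq

/-- Subtraction is truncated at `0`, division by `0` gives `0`, and a comparison returns
`1` for true and `0` for false. -/
def BinOp.eval : BinOp → ℕ → ℕ → ℕ
  | .add, x, y => x + y
  | .sub, x, y => x - y
  | .mul, x, y => x * y
  | .div, x, y => x / y
  | .mod, x, y => x % y
  | .lt, x, y => if x < y then 1 else 0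
  | .eq, x, y => if x = y then 1 else 0

/-- Expressions: constants, registers, array entries `a[i]`, and binary operations. -/
inductive Expr
  | const (c : ℕ)
  | reg (x : ℕ)
  | read (a : ℕ) (i : Expr)
  | bin (o : BinOp) (e₁ e₂ : Expr)

/-- The value of an expression, with words of `w` bits. -/
def Expr.eval (w : ℕ) (s : State) : Expr → ℕ
  | .const c => c % 2 ^ w
  | .reg x => s.reg x
  | .read a i => s.arr a (i.eval w s)
  | .bin o e₁ e₂ => o.eval (e₁.eval w s) (e₂.eval w s) % 2 ^ w

/-- The time for evaluating an expression: its number of nodes. -/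
def Expr.cost : Expr → ℕ
  | .const _ => 1
  | .reg _ => 1
  | .read _ i => i.cost + 1
  | .bin _ e₁ e₂ => e₁.cost + e₂.cost + 1

/-- Programs. A test counts as true if the value of the expression is not `0`. -/
inductive Program
  | skip
  | assign (x : ℕ) (e : Expr)
  | write (a : ℕ) (i e : Expr)
  | seq (P Q : Program)
  | cond (e : Expr) (P Q : Program)
  | loop (e : Expr) (P : Program)

/-- Write the value `v` into register `x`. -/
def State.setReg (s : State) (x v : ℕ) : State :=
  ⟨Function.update s.reg x v, s.arr⟩

/-- Write the value `v` into the entry `i` of array `a`. -/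
def State.setArr (s : State) (a i v : ℕ) : State :=
  ⟨s.reg, Function.update s.arr a (Function.update (s.arr a) i v)⟩

/-- `Exec w P s t s'`: with words of `w` bits, the program `P` started in state `s` halts after
`t` steps in state `s'`. -/
inductive Exec (w : ℕ) : Program → State → ℕ → State → Prop
  | skip (s : State) : Exec w .skip s 1 s
  | assign (x : ℕ) (e : Expr) (s : State) :
      Exec w (.assign x e) s (e.cost + 1) (s.setReg x (e.eval w s))
  | write (a : ℕ) (i e : Expr) (s : State) :
      Exec w (.write a i e) s (i.cost + e.cost + 1) (s.setArr a (i.eval w s) (e.eval w s))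
  | seq {P Q : Program} {s s₁ s₂ : State} {t₁ t₂ : ℕ} :
      Exec w P s t₁ s₁ → Exec w Q s₁ t₂ s₂ → Exec w (.seq P Q) s (t₁ + t₂) s₂
  | cond_true {e : Expr} {P Q : Program} {s s₁ : State} {t : ℕ} :
      e.eval w s ≠ 0 → Exec w P s t s₁ → Exec w (.cond e P Q) s (e.cost + 1 + t) s₁
  | cond_false {e : Expr} {P Q : Program} {s s₁ : State} {t : ℕ} :
      e.eval w s = 0 → Exec w Q s t s₁ → Exec w (.cond e P Q) s (e.cost + 1 + t) s₁
  | loop_done {e : Expr} {P : Program} {s : State} :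
      e.eval w s = 0 → Exec w (.loop e P) s (e.cost + 1) s
  | loop_step {e : Expr} {P : Program} {s s₁ s₂ : State} {t₁ t₂ : ℕ} :
      e.eval w s ≠ 0 → Exec w P s t₁ s₁ → Exec w (.loop e P) s₁ t₂ s₂ →
      Exec w (.loop e P) s (e.cost + 1 + t₁ + t₂) s₂

/-- The initial state: array `0` holds the input, all other memory is `0`. -/
def initState (input : List ℕ) : State :=
  ⟨fun _ => 0, fun a i => if a = 0 then input.getD i 0 else 0⟩

end WordRAM

/-- An explicit list of the hyperedges of a bipartite hypergraph with vertex classes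
`{0, …, nA - 1}` and `{0, …, nB - 1}`; an edge is given by its vertex in the first class and a
list of its vertices in the second class. -/
abbrev EdgeList (nA nB : ℕ) : Type := List (Fin nA × List (Fin nB))

namespace EdgeList

variable {nA nB : ℕ}

/-- The vertex set of a listed edge. -/
def toEdge (x : Fin nA × List (Fin nB)) : Finset (Fin nA ⊕ Fin nB) :=
  ({x.1} : Finset (Fin nA)).disjSum x.2.toFinset

/-- `L` lists every hyperedge of `H` exactly once, and every vertex of it exactly once. The order
of the edges and the order of the vertices within an edge are arbitrary. -/
def Presents (L : EdgeList nA nB) (H : BipartiteHypergraph (Fin nA) (Fin nB)) : Prop :=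
  (L.map toEdge).Nodup ∧ (L.map toEdge).toFinset = H.E ∧ ∀ x ∈ L, x.2.Nodup

/-- The input words: `|A|`, `|B|`, `|E|`, and then for each edge its vertex in `A`, the number of
its vertices in `B`, and these vertices. -/
def encode (L : EdgeList nA nB) : List ℕ :=
  nA :: nB :: L.length ::
    L.flatMap (fun x => (x.1 : ℕ) :: x.2.length :: x.2.map (fun b => (b : ℕ)))

/-- In state `s` the output array (array `1`) holds a list of the edges in `M`: first their
number, then their positions (counted from `0`) in the edge list `L` of the input, each once. -/
def Outputs (L : EdgeList nA nB) (s : WordRAM.State)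
    (M : Finset (Finset (Fin nA ⊕ Fin nB))) : Prop :=
  ∃ I : List (Fin L.length), I.Nodup ∧ s.arr 1 0 = I.length ∧
    (∀ j : Fin I.length, s.arr 1 (j + 1) = (I.get j : ℕ)) ∧
    M = (I.map (fun i => toEdge (L.get i))).toFinset

end EdgeList

/-!
The matching is built by an iterative version of Haxell's local search. Given a partial matching,
layer `0` consists of the unmatched vertices of `A`. Layer `i ≥ 1` is built from a maximal family of
pairwise disjoint candidate edges at the vertices of the lower layers, with at most `4 * D * r` of
them at each vertex, that avoid the earlier candidate edges and the matching edges of the lower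
layers. It consists of the vertices whose matching edges meet one of these candidate edges. If at
least one percent of the vertices of some layer have a candidate edge that meets no matching edge,
then they are rematched to such edges, and everything above this layer is thrown away; this frees
vertices of the layer below, and eventually unmatched vertices.

Suppose that no layer can be rematched in this way. By maximality the candidate edges and the
matching edges of the layers hit all edges at vertices with fewer than `4 * D * r` candidate edges,
so by the strong Haxell condition with `D ≤ d` there are about `D * r * |A'|` candidate edges, where
`A'` is the union of the layers they belong to. Nearly all of them are blocked by a matching edge,
and a matching edge blocks at most `r` of them, so the layers grow at least by the factor `D / 2`
(`EdgeTable.Inv.growth_last`). The value `d` is not known to the program. It uses a guess `D` that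
is large at first, and halves it whenever the layers fail to grow; this happens only while `D > d`.

The number of rounds is bounded by a potential, the sum of `H x` over the sizes `x` of the unions of
the first layers, with `H x = 10 * y * (n / x) ^ (80 / y)` and `y = √(log₂ d)`. Both building a
layer and rematching increase it by at least `1`: since the sizes grow by the factor `d / 4`, the
weights `H x` decay so fast along the layers that the gain from shrinking one union by half a
percent exceeds the weight of all higher layers (`IsLayerWeight.potential_collapse`,
`exists_isLayerWeight`). As the potential is at most `1 + 2 * H 1`, there are
`O(log p * y * n ^ (80 / y))` rounds. Each of them recomputes all auxiliary data in linear time, and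
`log p` and `y` are at most powers `p ^ (O(1) / y)`, because `d ≤ p`.

The program is analysed with unbounded words. It stores only numbers that exceed older ones by at
most the number of steps, so with words of `O(log (n + p))` bits its run is the same (`Run.exec`).
-/

open Function

namespace WordRAM

/-! ### Execution with unbounded words -/

/-- The value of an expression when words are arbitrary natural numbers. -/
def Expr.val (s : State) : Expr → ℕ
  | .const c => c
  | .reg x => s.reg x
  | .read a i => s.arr a (i.val s)
  | .bin o e₁ e₂ => o.eval (e₁.val s) (e₂.val s)

/-- The big-step semantics `Exec` with unbounded words in place of words of `w` bits. -/
inductive Run : Program → State → ℕ → State → Prop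
  | skip (s : State) : Run .skip s 1 s
  | assign (x : ℕ) (e : Expr) (s : State) :
      Run (.assign x e) s (e.cost + 1) (s.setReg x (e.val s))
  | write (a : ℕ) (i e : Expr) (s : State) :
      Run (.write a i e) s (i.cost + e.cost + 1) (s.setArr a (i.val s) (e.val s))
  | seq {P Q : Program} {s s₁ s₂ : State} {t₁ t₂ : ℕ} :
      Run P s t₁ s₁ → Run Q s₁ t₂ s₂ → Run (.seq P Q) s (t₁ + t₂) s₂
  | cond_true {e : Expr} {P Q : Program} {s s₁ : State} {t : ℕ} :
      e.val s ≠ 0 → Run P s t s₁ → Run (.cond e P Q) s (e.cost + 1 + t) s₁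
  | cond_false {e : Expr} {P Q : Program} {s s₁ : State} {t : ℕ} :
      e.val s = 0 → Run Q s t s₁ → Run (.cond e P Q) s (e.cost + 1 + t) s₁
  | loop_done {e : Expr} {P : Program} {s : State} :
      e.val s = 0 → Run (.loop e P) s (e.cost + 1) s
  | loop_step {e : Expr} {P : Program} {s s₁ s₂ : State} {t₁ t₂ : ℕ} :
      e.val s ≠ 0 → Run P s t₁ s₁ → Run (.loop e P) s₁ t₂ s₂ →
      Run (.loop e P) s (e.cost + 1 + t₁ + t₂) s₂

/-- All registers and all array entries are at most `V`. -/
def State.Bounded (s : State) (V : ℕ) : Prop :=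
  (∀ x, s.reg x ≤ V) ∧ ∀ a i, s.arr a i ≤ V

/-- All constants of the expression are at most `100`. -/
def Expr.small : Expr → Bool
  | .const c => decide (c ≤ 100)
  | .reg _ => true
  | .read _ i => i.small
  | .bin _ e₁ e₂ => e₁.small && e₂.small

/-- Expressions whose value exceeds the values in memory by at most their cost, by their shape:
the only growing operation is the addition of `1`. -/
def Expr.inc : Expr → Bool
  | .const c => decide (c ≤ 100)
  | .reg _ => true
  | .read _ _ => true
  | .bin .add e (.const 1) => e.inc
  | .bin .sub e _ => e.inc
  | .bin .div e _ => e.inc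
  | .bin .lt _ _ => true
  | .bin .eq _ _ => true
  | _ => false

/-- An expression that may occur in a tame program: small constants, at most `30` nodes. -/
def Expr.tame (e : Expr) : Bool := e.small && decide (e.cost ≤ 30)

/-- Programs that only store values of expressions in `Expr.inc`. In a run of such a program the
values in memory grow at most by the number of steps. -/
def Program.tame : Program → Bool
  | .skip => true
  | .assign _ e => e.inc && e.tame
  | .write _ i e => i.tame && e.inc && e.tame
  | .seq P Q => P.tame && Q.tame
  | .cond e P Q => e.tame && P.tame && Q.tame
  | .loop e P => e.tame && P.tame

theorem Expr.val_le_pow {s : State} {W : ℕ} (hs : s.Bounded W) (hW : 100 ≤ W) :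
    ∀ e : Expr, e.small = true → e.val s ≤ W ^ e.cost
  | .const c, h => by
      simp only [small, decide_eq_true_eq] at h
      simpa [val, cost] using h.trans hW
  | .reg x, _ => by simpa [val, cost] using hs.1 x
  | .read a i, _ => (hs.2 _ _).trans (Nat.le_self_pow (by simp [cost]) W)
  | .bin o e₁ e₂, h => by
      simp only [small, Bool.and_eq_true] at h
      have h1 := val_le_pow hs hW e₁ h.1
      have h2 := val_le_pow hs hW e₂ h.2
      have p1 : 1 ≤ W ^ e₁.cost := Nat.one_le_pow _ _ (by omega)
      have p2 : 1 ≤ W ^ e₂.cost := Nat.one_le_pow _ _ (by omega)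
      have hm : W ^ e₁.cost * W ^ e₂.cost * W = W ^ (e₁.cost + e₂.cost + 1) := by ring
      simp only [val, cost]
      rw [← hm]
      have hbig : W ^ e₁.cost + W ^ e₂.cost ≤ W ^ e₁.cost * W ^ e₂.cost * W := by
        nlinarith [Nat.mul_le_mul p1 p2, Nat.mul_le_mul_left (W ^ e₁.cost * W ^ e₂.cost) hW]
      have hprod : W ^ e₁.cost * W ^ e₂.cost ≤ W ^ e₁.cost * W ^ e₂.cost * W :=
        Nat.le_mul_of_pos_right _ (by omega)
      cases o <;> simp only [BinOp.eval]
      · omega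
      · omega
      · exact (Nat.mul_le_mul h1 h2).trans hprod
      · exact (Nat.div_le_self _ _).trans (by omega)
      · exact (Nat.mod_le _ _).trans (by omega)
      · split <;> omega
      · split <;> omega

theorem Expr.eval_eq_val {s : State} {w W : ℕ} (hs : s.Bounded W) (hW : 100 ≤ W) :
    ∀ e : Expr, e.small = true → W ^ e.cost < 2 ^ w → e.eval w s = e.val s
  | .const c, h, hw => by
      have := val_le_pow hs hW (.const c) h
      simp only [val] at this
      simpa [eval, val] using Nat.mod_eq_of_lt (this.trans_lt hw)
  | .reg x, _, _ => rfl
  | .read a i, h, hw => by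
      have : i.eval w s = i.val s := eval_eq_val hs hW i h
        ((Nat.pow_le_pow_right (by omega) (by simp [cost])).trans_lt hw)
      simp [eval, val, this]
  | .bin o e₁ e₂, h, hw => by
      have hv := val_le_pow hs hW (.bin o e₁ e₂) h
      have h' := h
      simp only [small, Bool.and_eq_true] at h'
      have i1 := eval_eq_val hs hW e₁ h'.1
        ((Nat.pow_le_pow_right (by omega) (by simp only [cost]; omega)).trans_lt hw)
      have i2 := eval_eq_val hs hW e₂ h'.2
        ((Nat.pow_le_pow_right (by omega) (by simp only [cost]; omega)).trans_lt hw)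
      simp only [eval, i1, i2]
      exact Nat.mod_eq_of_lt (hv.trans_lt hw)

theorem Expr.val_le_of_inc {s : State} {V : ℕ} (hs : s.Bounded V) (hV : 100 ≤ V) (e : Expr)
    (he : e.inc = true) : e.val s ≤ V + e.cost := by
  fun_induction Expr.inc e with
  | case1 c => simp only [decide_eq_true_eq] at he; simp only [val]; omega
  | case2 x => simpa [val] using (hs.1 x).trans (Nat.le_add_right _ _)
  | case3 a i => simpa [val] using (hs.2 a _).trans (Nat.le_add_right _ _)
  | case4 e ih => have := ih he; simp only [val, BinOp.eval, cost]; omega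
  | case5 e e' ih => have := ih he; simp only [val, BinOp.eval, cost]; omega
  | case6 e e' ih =>
      have := ih he
      have h := Nat.div_le_self (e.val s) (e'.val s)
      simp only [val, BinOp.eval, cost]; omega
  | case7 => simp only [val, BinOp.eval]; split <;> omega
  | case8 => simp only [val, BinOp.eval]; split <;> omega
  | case9 => simp at he

theorem State.Bounded.mono {s : State} {V V' : ℕ} (hs : s.Bounded V) (h : V ≤ V') :
    s.Bounded V' := ⟨fun x => (hs.1 x).trans h, fun a i => (hs.2 a i).trans h⟩

theorem State.Bounded.setReg {s : State} {V x v : ℕ} (hs : s.Bounded V) (hv : v ≤ V) :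
    (s.setReg x v).Bounded V := by
  refine ⟨fun y => ?_, hs.2⟩
  simp only [State.setReg, update_apply]
  split
  exacts [hv, hs.1 y]

theorem State.Bounded.setArr {s : State} {V a i v : ℕ} (hs : s.Bounded V) (hv : v ≤ V) :
    (s.setArr a i v).Bounded V := by
  refine ⟨hs.1, fun b j => ?_⟩
  simp only [State.setArr, update_apply]
  split
  · rw [update_apply]
    split
    exacts [hv, hs.2 a j]
  · exact hs.2 b j

/-- Transfer from unbounded words to words of `w` bits: in a tame program the values grow at most
by the number of steps, so no overflow occurs if `w` is a large multiple of the logarithm of the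
running time. -/
theorem Run.exec {P : Program} {s s' : State} {t : ℕ} (h : Run P s t s') {w W : ℕ}
    (hW : W ^ 30 < 2 ^ w) :
    ∀ V : ℕ, P.tame = true → s.Bounded V → 100 ≤ V → V + t ≤ W →
      Exec w P s t s' ∧ s'.Bounded (V + t) := by
  have key : ∀ (V : ℕ) (s : State) (e : Expr), e.tame = true → s.Bounded V → 100 ≤ V → V ≤ W →
      e.eval w s = e.val s := by
    intro V s e he hs hV hVW
    simp only [Expr.tame, Bool.and_eq_true, decide_eq_true_eq] at he
    exact Expr.eval_eq_val (hs.mono hVW) (hV.trans hVW) e he.1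
      ((Nat.pow_le_pow_right (by omega) he.2).trans_lt hW)
  induction h with
  | skip s => exact fun V _ hs _ _ => ⟨.skip s, hs.mono (by omega)⟩
  | assign x e s =>
      intro V hP hs hV hVW
      simp only [Program.tame, Bool.and_eq_true] at hP
      have hv := key V s e hP.2 hs hV (by omega)
      have hb := Expr.val_le_of_inc hs hV e hP.1
      refine ⟨?_, (hs.mono (by omega)).setReg (by omega)⟩
      rw [← hv]
      exact .assign x e s
  | write a i e s =>
      intro V hP hs hV hVW
      simp only [Program.tame, Bool.and_eq_true] at hP
      have hv := key V s e hP.2 hs hV (by omega)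
      have hi := key V s i hP.1.1 hs hV (by omega)
      have hb := Expr.val_le_of_inc hs hV e hP.1.2
      refine ⟨?_, (hs.mono (by omega)).setArr (by omega)⟩
      rw [← hv, ← hi]
      exact .write a i e s
  | @seq P Q s s₁ s₂ t₁ t₂ _ _ ih₁ ih₂ =>
      intro V hP hs hV hVW
      simp only [Program.tame, Bool.and_eq_true] at hP
      obtain ⟨e₁, b₁⟩ := ih₁ V hP.1 hs hV (by omega)
      obtain ⟨e₂, b₂⟩ := ih₂ (V + t₁) hP.2 b₁ (by omega) (by omega)
      exact ⟨.seq e₁ e₂, b₂.mono (by omega)⟩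
  | @cond_true e P Q s s₁ t he _ ih =>
      intro V hP hs hV hVW
      simp only [Program.tame, Bool.and_eq_true] at hP
      have hv := key V s e hP.1.1 hs hV (by omega)
      obtain ⟨e₁, b₁⟩ := ih V hP.1.2 hs hV (by omega)
      exact ⟨.cond_true (by rwa [hv]) e₁, b₁.mono (by omega)⟩
  | @cond_false e P Q s s₁ t he _ ih =>
      intro V hP hs hV hVW
      simp only [Program.tame, Bool.and_eq_true] at hP
      have hv := key V s e hP.1.1 hs hV (by omega)
      obtain ⟨e₁, b₁⟩ := ih V hP.2 hs hV (by omega)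
      exact ⟨.cond_false (by rwa [hv]) e₁, b₁.mono (by omega)⟩
  | @loop_done e P s he =>
      intro V hP hs hV hVW
      simp only [Program.tame, Bool.and_eq_true] at hP
      have hv := key V s e hP.1 hs hV (by omega)
      exact ⟨.loop_done (by rwa [hv]), hs.mono (by omega)⟩
  | @loop_step e P s s₁ s₂ t₁ t₂ he _ _ ih₁ ih₂ =>
      intro V hP hs hV hVW
      have hP' := hP
      simp only [Program.tame, Bool.and_eq_true] at hP
      have hv := key V s e hP.1 hs hV (by omega)
      obtain ⟨e₁, b₁⟩ := ih₁ V hP.2 hs hV (by omega)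
      obtain ⟨e₂, b₂⟩ := ih₂ (V + t₁) hP' b₁ (by omega) (by omega)
      exact ⟨.loop_step (by rwa [hv]) e₁ e₂, b₂.mono (by omega)⟩

/-! ### Total correctness with time bounds -/

/-- With unbounded words, `P` started in `s` halts after at most `T` steps in a state with `Q`. -/
def Reach (P : Program) (s : State) (T : ℕ) (Q : State → Prop) : Prop :=
  ∃ t s', Run P s t s' ∧ t ≤ T ∧ Q s'

theorem Reach.mono {P : Program} {s : State} {T T' : ℕ} {Q Q' : State → Prop}
    (h : Reach P s T Q) (hT : T ≤ T') (hQ : ∀ s', Q s' → Q' s') : Reach P s T' Q' := by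
  obtain ⟨t, s', hr, ht, hq⟩ := h
  exact ⟨t, s', hr, ht.trans hT, hQ _ hq⟩

theorem Reach.seq {P P' : Program} {s : State} {T T' : ℕ} {Q Q' : State → Prop}
    (h : Reach P s T Q) (h' : ∀ s', Q s' → Reach P' s' T' Q') :
    Reach (.seq P P') s (T + T') Q' := by
  obtain ⟨t, s₁, hr, ht, hq⟩ := h
  obtain ⟨t', s₂, hr', ht', hq'⟩ := h' s₁ hq
  exact ⟨_, s₂, .seq hr hr', by omega, hq'⟩

theorem Reach.assign {x : ℕ} {e : Expr} {s : State} {T : ℕ} {Q : State → Prop}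
    (hT : e.cost + 1 ≤ T) (h : Q (s.setReg x (e.val s))) : Reach (.assign x e) s T Q :=
  ⟨_, _, .assign x e s, hT, h⟩

theorem Reach.write {a : ℕ} {i e : Expr} {s : State} {T : ℕ} {Q : State → Prop}
    (hT : i.cost + e.cost + 1 ≤ T) (h : Q (s.setArr a (i.val s) (e.val s))) :
    Reach (.write a i e) s T Q :=
  ⟨_, _, .write a i e s, hT, h⟩

theorem Reach.skip {s : State} {T : ℕ} {Q : State → Prop} (hT : 1 ≤ T) (h : Q s) :
    Reach .skip s T Q :=
  ⟨_, _, .skip s, hT, h⟩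

theorem Reach.cond {e : Expr} {P P' : Program} {s : State} {T : ℕ} {Q : State → Prop}
    (h : e.val s ≠ 0 → Reach P s T Q) (h' : e.val s = 0 → Reach P' s T Q) :
    Reach (.cond e P P') s (e.cost + 1 + T) Q := by
  by_cases he : e.val s = 0
  · obtain ⟨t, s', hr, ht, hq⟩ := h' he
    exact ⟨_, s', .cond_false he hr, by omega, hq⟩
  · obtain ⟨t, s', hr, ht, hq⟩ := h he
    exact ⟨_, s', .cond_true he hr, by omega, hq⟩

/-- A loop whose body decreases a real potential by at least `1`. In `I v s` the number `v` is
the potential, which is allowed to depend on ghost data; it is nonnegative whenever the body is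
run, so that at most `n + 1` rounds are made if it is at most `n` at the start. -/
theorem Reach.of_loop {e : Expr} {P : Program} {T : ℕ} {I : ℝ → State → Prop}
    (hf : ∀ v s, I v s → 0 ≤ v)
    (h : ∀ v s, I v s → e.val s ≠ 0 → Reach P s T fun s' => ∃ v' ≤ v - 1, I v' s') :
    ∀ (n : ℕ) (v : ℝ) (s : State), I v s → v ≤ n →
      Reach (.loop e P) s ((n + 1) * (e.cost + 1 + T) + (e.cost + 1))
        fun s' => (∃ v', I v' s') ∧ e.val s' = 0 := by
  intro n
  induction n with
  | zero =>
      intro v s hI hn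
      by_cases he : e.val s = 0
      · exact ⟨_, s, .loop_done he, by omega, ⟨v, hI⟩, he⟩
      · obtain ⟨t, s', hr, ht, v', hv', hI'⟩ := h v s hI he
        have := hf v' s' hI'
        norm_num at hn
        linarith
  | succ n ih =>
      intro v s hI hn
      by_cases he : e.val s = 0
      · exact ⟨_, s, .loop_done he, by omega, ⟨v, hI⟩, he⟩
      · obtain ⟨t, s', hr, ht, v', hv', hI'⟩ := h v s hI he
        obtain ⟨t', s'', hr', ht', hq⟩ := ih v' s' hI' (by push_cast at hn; linarith)
        exact ⟨_, s'', .loop_step he hr hr', by nlinarith, hq⟩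

/-! ### Counting loops -/

infixl:65 " +ᵉ " => Expr.bin BinOp.add
infixl:65 " -ᵉ " => Expr.bin BinOp.sub
infixl:70 " *ᵉ " => Expr.bin BinOp.mul
infixl:70 " /ᵉ " => Expr.bin BinOp.div
infix:50 " <ᵉ " => Expr.bin BinOp.lt
infix:50 " =ᵉ " => Expr.bin BinOp.eq
infixr:30 " ;; " => Program.seq

/-- `for x := lo, …, hi - 1 do P`; the bound `hi` is evaluated before every round. -/
def forLoop (x : ℕ) (lo hi : Expr) (P : Program) : Program :=
  .assign x lo ;; .loop (.reg x <ᵉ hi) (P ;; .assign x (.reg x +ᵉ .const 1))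

/-- Rule for counting loops: `I i` holds before the round `i`, which takes `c i` steps. -/
theorem Reach.of_forLoop {x : ℕ} {lo hi : Expr} {P : Program} {s : State} {l n : ℕ} (c : ℕ → ℕ)
    (I : ℕ → State → Prop) (hlo : lo.val s = l) (h0 : I 0 (s.setReg x l))
    (hhi : ∀ i s', i ≤ n → I i s' → hi.val s' = l + n)
    (hx : ∀ i s', i ≤ n → I i s' → s'.reg x = l + i)
    (h : ∀ i s', i < n → I i s' →
      Reach P s' (c i) fun s'' => I (i + 1) (s''.setReg x (s''.reg x + 1))) :
    Reach (forLoop x lo hi P) s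
      (lo.cost + 1 + (∑ i ∈ Finset.range n, (c i + hi.cost + 7)) + (hi.cost + 3)) (I n) := by
  have main : ∀ k i s', i + k = n → I i s' →
      Reach (.loop (.reg x <ᵉ hi) (P ;; .assign x (.reg x +ᵉ .const 1))) s'
        ((∑ j ∈ Finset.Ico i n, (c j + hi.cost + 7)) + (hi.cost + 3)) (I n) := by
    intro k
    induction k with
    | zero =>
        intro i s' hi' hI
        obtain rfl : i = n := by omega
        refine ⟨_, s', .loop_done ?_, ?_, hI⟩
        · simp [Expr.val, BinOp.eval, hx i s' le_rfl hI, hhi i s' le_rfl hI]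
        · simp [Expr.cost]; omega
    | succ k ih =>
        intro i s' hi' hI
        obtain ⟨t, s₁, hr, ht, hI₁⟩ := h i s' (by omega) hI
        obtain ⟨t', s₂, hr', ht', hI₂⟩ := ih (i + 1) _ (by omega) hI₁
        refine ⟨_, s₂, .loop_step ?_ (.seq hr (.assign x _ s₁)) hr', ?_, hI₂⟩
        · simp [Expr.val, BinOp.eval, hx i s' (by omega) hI, hhi i s' (by omega) hI]
          omega
        · rw [Finset.sum_eq_sum_Ico_succ_bot (by omega)]
          simp only [Expr.cost]
          omega
  refine (Reach.seq (Reach.assign (Q := I 0) le_rfl (by rwa [hlo])) fun s' hs' =>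
    main n 0 s' (by omega) hs').mono ?_ fun _ h => h
  rw [Finset.range_eq_Ico]
  omega

end WordRAM

namespace WordRAM

/-! ### Loops that write into one array -/

/-- The registers that an expression reads. -/
def Expr.regs : Expr → List ℕ
  | .const _ => []
  | .reg x => [x]
  | .read _ i => i.regs
  | .bin _ e₁ e₂ => e₁.regs ++ e₂.regs

/-- The arrays that an expression reads. -/
def Expr.arrs : Expr → List ℕ
  | .const _ => []
  | .reg _ => []
  | .read a i => a :: i.arrs
  | .bin _ e₁ e₂ => e₁.arrs ++ e₂.arrs

theorem Expr.val_congr {s s' : State} : ∀ e : Expr, (∀ x ∈ e.regs, s.reg x = s'.reg x) →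
    (∀ a ∈ e.arrs, s.arr a = s'.arr a) → e.val s = e.val s'
  | .const _, _, _ => rfl
  | .reg x, h, _ => h x (by simp [regs])
  | .read a i, h, h' => by
      have := val_congr i h fun b hb => h' b (by simp [arrs, hb])
      simp [val, this, h' a (by simp [arrs])]
  | .bin o e₁ e₂, h, h' => by
      have h1 := val_congr e₁ (fun x hx => h x (by simp [regs, hx]))
        fun b hb => h' b (by simp [arrs, hb])
      have h2 := val_congr e₂ (fun x hx => h x (by simp [regs, hx]))
        fun b hb => h' b (by simp [arrs, hb])
      simp [val, h1, h2]

open scoped Classical in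
/-- The array `g` after the conditional writes `g (F i) := V i`, if `C i`, for
`i = l, …, l + n - 1` in this order. -/
noncomputable def scat (C : ℕ → Prop) (F V : ℕ → ℕ) (l : ℕ) (g : ℕ → ℕ) : ℕ → ℕ → ℕ
  | 0 => g
  | n + 1 => if C (l + n) then update (scat C F V l g n) (F (l + n)) (V (l + n))
      else scat C F V l g n

/-- An entry after the conditional writes is either untouched or comes from one of the writes. -/
theorem scat_cases (C : ℕ → Prop) (F V : ℕ → ℕ) (l : ℕ) (g : ℕ → ℕ) (n y : ℕ) :
    (scat C F V l g n y = g y ∧ ∀ i, l ≤ i → i < l + n → C i → F i ≠ y) ∨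
      ∃ i, l ≤ i ∧ i < l + n ∧ C i ∧ F i = y ∧ scat C F V l g n y = V i := by
  induction n with
  | zero => exact .inl ⟨rfl, fun i h h' => by omega⟩
  | succ n ih =>
      by_cases hC : C (l + n)
      · by_cases hF : F (l + n) = y
        · exact .inr ⟨l + n, by omega, by omega, hC, hF, by simp [scat, hC, ← hF]⟩
        · have : scat C F V l g (n + 1) y = scat C F V l g n y := by
            simp [scat, hC, Ne.symm hF]
          rw [this]
          rcases ih with ⟨h, h'⟩ | ⟨i, h1, h2, h3⟩
          · refine .inl ⟨h, fun i hi hi' hCi => ?_⟩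
            rcases Nat.lt_or_ge i (l + n) with h2 | h2
            · exact h' i hi h2 hCi
            · obtain rfl : i = l + n := by omega
              exact hF
          · exact .inr ⟨i, h1, by omega, h3⟩
      · have : scat C F V l g (n + 1) y = scat C F V l g n y := by simp [scat, hC]
        rw [this]
        rcases ih with ⟨h, h'⟩ | ⟨i, h1, h2, h3⟩
        · refine .inl ⟨h, fun i hi hi' hCi => ?_⟩
          rcases Nat.lt_or_ge i (l + n) with h2 | h2
          · exact h' i hi h2 hCi
          · obtain rfl : i = l + n := by omega
            exact (hC hCi).elim
        · exact .inr ⟨i, h1, by omega, h3⟩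

theorem scat_id_of_mem {C : ℕ → Prop} {V : ℕ → ℕ} {g : ℕ → ℕ} {n y : ℕ} (hy : y < n) (hC : C y) :
    scat C id V 0 g n y = V y := by
  rcases scat_cases C id V 0 g n y with ⟨-, h⟩ | ⟨i, -, -, -, rfl, h⟩
  · exact (h y (by omega) (by omega) hC rfl).elim
  · exact h

theorem scat_id_of_notMem {C : ℕ → Prop} {V : ℕ → ℕ} {g : ℕ → ℕ} {n y : ℕ} (hC : ¬ (y < n ∧ C y)) :
    scat C id V 0 g n y = g y := by
  rcases scat_cases C id V 0 g n y with ⟨h, -⟩ | ⟨i, -, h, h', rfl, -⟩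
  · exact h
  · exact (hC ⟨by simpa using h, h'⟩).elim

/-- `for x := lo, …, hi - 1 do if c then a[f] := v`. -/
def scatter (x : ℕ) (lo hi : Expr) (a : ℕ) (c f v : Expr) : Program :=
  forLoop x lo hi (.cond c (.write a f v) .skip)

/-- The bound and the condition do not depend on what a scattering loop writes, and all
expressions are short. -/
def scatterOK (x : ℕ) (lo hi : Expr) (a : ℕ) (c f v : Expr) : Bool :=
  !hi.regs.contains x && !hi.arrs.contains a && !c.arrs.contains a && !f.arrs.contains a &&
    decide (lo.cost + hi.cost + c.cost + f.cost + v.cost + 20 ≤ 100)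

/-- Common part of the rules for writing and counting loops: `G i` is the written array before the
round `l + i`. -/
theorem Reach.of_scatter_aux {x a : ℕ} {lo hi c f v : Expr} {s : State} {l n N : ℕ}
    {C : ℕ → Prop} {F : ℕ → ℕ} (G : ℕ → ℕ → ℕ)
    (ok : scatterOK x lo hi a c f v = true) (hlo : lo.val s = l) (hhi : hi.val s = l + n)
    (hn : n ≤ N) (hG : G 0 = s.arr a)
    (hC : ∀ i, l ≤ i → i < l + n → (c.val (s.setReg x i) ≠ 0 ↔ C i))
    (hF : ∀ i, l ≤ i → i < l + n → C i → f.val (s.setReg x i) = F i)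
    (hV : ∀ i, i < n → C (l + i) →
      update (G i) (F (l + i)) (v.val ⟨update s.reg x (l + i), update s.arr a (G i)⟩) = G (i + 1))
    (hG' : ∀ i, i < n → ¬ C (l + i) → G (i + 1) = G i) :
    Reach (scatter x lo hi a c f v) s (100 * (N + 1)) fun s' =>
      s'.reg = update s.reg x (l + n) ∧ s'.arr = update s.arr a (G n) := by
  simp only [scatterOK, Bool.and_eq_true, Bool.not_eq_true', decide_eq_true_eq,
    List.contains_eq_mem, decide_eq_false_iff_not] at ok
  obtain ⟨⟨⟨⟨ok1, ok2⟩, ok3⟩, ok4⟩, ok5⟩ := ok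
  have aux : ∀ (e : Expr) (i : ℕ) (g : ℕ → ℕ), a ∉ e.arrs →
      e.val ⟨update s.reg x i, update s.arr a g⟩ = e.val (s.setReg x i) := by
    intro e i g he
    refine Expr.val_congr e (fun y hy => rfl) fun b hb => ?_
    have : b ≠ a := fun h => he (h ▸ hb)
    simp [State.setReg, this]
  have h := Reach.of_forLoop (x := x) (lo := lo) (hi := hi) (P := .cond c (.write a f v) .skip)
    (s := s) (l := l) (n := n) (fun _ => c.cost + 1 + (f.cost + v.cost + 1))
    (fun i s' => s' = ⟨update s.reg x (l + i), update s.arr a (G i)⟩) hlo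
    (by simp [State.setReg, hG]) ?_ ?_ ?_
  · refine h.mono ?_ fun s' hs' => by subst hs'; exact ⟨rfl, rfl⟩
    rw [Finset.sum_const, Finset.card_range, smul_eq_mul]
    have : n * (c.cost + 1 + (f.cost + v.cost + 1) + hi.cost + 7) ≤ N * 100 :=
      Nat.mul_le_mul hn (by omega)
    omega
  · rintro i s' hi' rfl
    rw [aux _ _ _ ok2, ← hhi]
    refine Expr.val_congr _ (fun y hy => ?_) fun b _ => rfl
    have : y ≠ x := fun h => ok1 (h ▸ hy)
    simp [State.setReg, this]
  · rintro i s' hi' rfl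
    simp
  · rintro i s' hi' rfl
    refine Reach.cond (fun hc => ?_) fun hc => ?_
    · rw [aux _ _ _ ok3, hC _ (by omega) (by omega)] at hc
      refine Reach.write le_rfl ?_
      rw [aux _ _ _ ok4, hF _ (by omega) (by omega) hc]
      simp only [State.setReg, State.setArr, update_self, update_idem, hV i hi' hc]
      rfl
    · have hc : ¬ C (l + i) := fun h => by
        rw [← hC _ (by omega) (by omega)] at h
        rw [aux _ _ _ ok3] at hc
        exact h hc
      refine Reach.skip (by omega) ?_
      simp only [State.setReg, update_self, update_idem, hG' i hi' hc]
      rfl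

/-- Rule for a loop of writes whose values do not depend on the written array. -/
theorem Reach.of_scatter {x a : ℕ} {lo hi c f v : Expr} {s : State} {l n N : ℕ}
    (C : ℕ → Prop) (F V : ℕ → ℕ)
    (ok : (scatterOK x lo hi a c f v && !v.arrs.contains a) = true)
    (hlo : lo.val s = l) (hhi : hi.val s = l + n) (hn : n ≤ N)
    (hC : ∀ i, l ≤ i → i < l + n → (c.val (s.setReg x i) ≠ 0 ↔ C i))
    (hF : ∀ i, l ≤ i → i < l + n → C i → f.val (s.setReg x i) = F i)
    (hV : ∀ i, l ≤ i → i < l + n → C i → v.val (s.setReg x i) = V i) :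
    Reach (scatter x lo hi a c f v) s (100 * (N + 1)) fun s' =>
      s'.reg = update s.reg x (l + n) ∧
      s'.arr = update s.arr a (scat C F V l (s.arr a) n) := by
  simp only [Bool.and_eq_true] at ok
  refine Reach.of_scatter_aux (scat C F V l (s.arr a)) ok.1 hlo hhi hn rfl hC hF ?_ ?_
  · intro i hi hc
    have : v.val ⟨update s.reg x (l + i), update s.arr a (scat C F V l (s.arr a) i)⟩
        = V (l + i) := by
      rw [← hV _ (by omega) (by omega) hc]
      refine Expr.val_congr v (fun y hy => rfl) fun b hb => ?_
      have : b ≠ a := fun h => by simp [← h, hb] at ok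
      simp [State.setReg, this]
    rw [this]
    simp [scat, hc]
  · intro i hi hc
    simp [scat, hc]

open scoped Classical in
/-- Rule for a loop that counts how often an index is hit. -/
theorem Reach.of_count {x a : ℕ} {lo hi c f : Expr} {s : State} {l n N : ℕ}
    (C : ℕ → Prop) (F : ℕ → ℕ)
    (ok : scatterOK x lo hi a c f (.read a f +ᵉ .const 1) = true)
    (hlo : lo.val s = l) (hhi : hi.val s = l + n) (hn : n ≤ N)
    (hC : ∀ i, l ≤ i → i < l + n → (c.val (s.setReg x i) ≠ 0 ↔ C i))
    (hF : ∀ i, l ≤ i → i < l + n → C i → f.val (s.setReg x i) = F i) :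
    Reach (scatter x lo hi a c f (.read a f +ᵉ .const 1)) s (100 * (N + 1)) fun s' =>
      s'.reg = update s.reg x (l + n) ∧
      s'.arr = update s.arr a fun y =>
        s.arr a y + ((Finset.Ico l (l + n)).filter fun i => C i ∧ F i = y).card := by
  have succ : ∀ i, Finset.Ico l (l + (i + 1)) = insert (l + i) (Finset.Ico l (l + i)) := by
    intro i; ext; simp; omega
  refine Reach.of_scatter_aux (fun i y =>
    s.arr a y + ((Finset.Ico l (l + i)).filter fun i => C i ∧ F i = y).card) ok hlo hhi hn
    (by simp) hC hF ?_ ?_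
  · intro i hi hc
    have hf : ∀ g : ℕ → ℕ, f.val ⟨update s.reg x (l + i), update s.arr a g⟩ = F (l + i) := by
      intro g
      rw [← hF _ (by omega) (by omega) hc]
      refine Expr.val_congr f (fun y hy => rfl) fun b hb => ?_
      have : b ≠ a := fun h => by simp [scatterOK, ← h, hb] at ok
      simp [State.setReg, this]
    funext y
    rw [succ, Finset.filter_insert]
    by_cases hy : F (l + i) = y
    · subst hy
      rw [if_pos ⟨hc, rfl⟩, Finset.card_insert_of_notMem (by simp)]
      simp [Expr.val, BinOp.eval, hf, add_assoc]
    · rw [if_neg (fun h => hy h.2), update_of_ne (Ne.symm hy)]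
  · intro i hi hc
    funext y
    rw [succ, Finset.filter_insert, if_neg (fun h => hc h.1)]

end WordRAM

/-! ### The edge table and the layers -/

/-- The incidences of a bipartite hypergraph in arrays: edge `e < mE` has the vertex `ea e < nA`
in the first class, and the vertices `ib t`, `off e ≤ t < off (e + 1)`, in the second one;
`ie t` is the edge of the incidence `t < tot`. Edges have at most `r` vertices in the second
class. -/
structure EdgeTable where
  nA : ℕ
  mE : ℕ
  tot : ℕ
  r : ℕ
  ea : ℕ → ℕ
  off : ℕ → ℕ
  ib : ℕ → ℕ
  ie : ℕ → ℕ
  ea_lt : ∀ e < mE, ea e < nA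
  off_zero : off 0 = 0
  off_mE : off mE = tot
  off_lt : ∀ e < mE, off e < off (e + 1)
  off_le : ∀ e < mE, off (e + 1) ≤ tot
  off_sub : ∀ e < mE, off (e + 1) ≤ off e + r
  ie_lt : ∀ t < tot, ie t < mE
  ie_spec : ∀ t < tot, off (ie t) ≤ t ∧ t < off (ie t + 1)
  ie_eq : ∀ e < mE, ∀ t, off e ≤ t → t < off (e + 1) → ie t = e

namespace EdgeTable

variable (G : EdgeTable)

/-- The vertices of the edge `e` in the second class. -/
def Bs (e : ℕ) : Finset ℕ := (Finset.Ico (G.off e) (G.off (e + 1))).image G.ib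

theorem mem_Bs {e b : ℕ} : b ∈ G.Bs e ↔ ∃ t, G.off e ≤ t ∧ t < G.off (e + 1) ∧ G.ib t = b := by
  simp [Bs, and_assoc]

theorem mem_Bs_iff {e b : ℕ} (he : e < G.mE) :
    b ∈ G.Bs e ↔ ∃ t < G.tot, G.ie t = e ∧ G.ib t = b := by
  rw [mem_Bs]
  constructor
  · rintro ⟨t, h1, h2, h3⟩
    exact ⟨t, h2.trans_le (G.off_le e he), G.ie_eq e he t h1 h2, h3⟩
  · rintro ⟨t, h1, rfl, h3⟩
    exact ⟨t, (G.ie_spec t h1).1, (G.ie_spec t h1).2, h3⟩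

theorem ib_mem_Bs {t : ℕ} (ht : t < G.tot) : G.ib t ∈ G.Bs (G.ie t) :=
  (G.mem_Bs_iff (G.ie_lt t ht)).2 ⟨t, ht, rfl, rfl⟩

theorem card_Bs_le {e : ℕ} (he : e < G.mE) : (G.Bs e).card ≤ G.r := by
  refine Finset.card_image_le.trans ?_
  have := G.off_sub e he
  simp; omega

theorem Bs_nonempty {e : ℕ} (he : e < G.mE) : (G.Bs e).Nonempty :=
  ⟨G.ib (G.off e), G.mem_Bs.2 ⟨G.off e, le_rfl, G.off_lt e he, rfl⟩⟩

/-- The strong Haxell condition with factor `D * r ^ 2`. -/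
def Haxell (D : ℝ) : Prop :=
  ∀ U T : Finset ℕ, (∀ a ∈ U, a < G.nA) →
    (∀ e < G.mE, G.ea e ∈ U → ∃ b ∈ T, b ∈ G.Bs e) → D * G.r ^ 2 * U.card ≤ T.card

/-- Vertices that are labelled by a layer of index at most `i`; the label of a vertex in layer
`i` is `i + 1`, and the label `0` means that the vertex is in no layer. -/
def upTo (lab : ℕ → ℕ) (i : ℕ) : Finset ℕ :=
  (Finset.range G.nA).filter fun a => 1 ≤ lab a ∧ lab a ≤ i + 1

/-- The vertices in the layer `j`. -/
def layer (lab : ℕ → ℕ) (j : ℕ) : Finset ℕ :=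
  (Finset.range G.nA).filter fun a => lab a = j + 1

/-- The edges at `a` with candidate layer in `1, …, i`. -/
def candAt (xl : ℕ → ℕ) (i a : ℕ) : Finset ℕ :=
  (Finset.range G.mE).filter fun e => xl e ≠ 0 ∧ xl e ≤ i ∧ G.ea e = a

/-- All candidate edges. -/
def cand (xl : ℕ → ℕ) : Finset ℕ := (Finset.range G.mE).filter fun e => xl e ≠ 0

/-- The vertex `b` lies in a candidate edge of layer at most `i` or in the matching edge of a
vertex of a layer below `i`. -/
def Forb (mt xl lab : ℕ → ℕ) (i b : ℕ) : Prop :=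
  (∃ e < G.mE, xl e ≠ 0 ∧ xl e ≤ i ∧ b ∈ G.Bs e) ∨
    ∃ a < G.nA, 1 ≤ lab a ∧ lab a ≤ i ∧ ∃ f, mt a = f + 1 ∧ b ∈ G.Bs f

/-- The edge `e` is disjoint from all matching edges. -/
def Free (mt : ℕ → ℕ) (e : ℕ) : Prop :=
  ∀ a < G.nA, ∀ f, mt a = f + 1 → Disjoint (G.Bs e) (G.Bs f)

/-- The state of the augmentation procedure. The vertex `a` is matched by the edge `f` if
`mt a = f + 1`, and unmatched if `mt a = 0`. The layer `0` consists of the unmatched vertices.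
The candidate edges in layer `i ≥ 1` are those with `xl e = i`; they belong to vertices of lower
layers, and layer `i` consists of the matched vertices whose matching edge meets such a candidate
edge. The number of candidate edges at a vertex is at most `4 * D * r`, and every layer of
candidate edges is maximal. All layers except perhaps the last one, `m`, are large. -/
structure Inv (mt xl lab : ℕ → ℕ) (m D : ℕ) : Prop where
  mt_lt : ∀ a < G.nA, ∀ f, mt a = f + 1 → f < G.mE
  mt_ea : ∀ a < G.nA, ∀ f, mt a = f + 1 → G.ea f = a
  mt_disj : ∀ a < G.nA, ∀ a' < G.nA, a ≠ a' → ∀ f f', mt a = f + 1 → mt a' = f' + 1 →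
    Disjoint (G.Bs f) (G.Bs f')
  xl_disj : ∀ e < G.mE, ∀ e' < G.mE, e ≠ e' → xl e ≠ 0 → xl e' ≠ 0 →
    Disjoint (G.Bs e) (G.Bs e')
  xl_le : ∀ e < G.mE, xl e ≤ m
  lab_one : ∀ a < G.nA, (lab a = 1 ↔ mt a = 0)
  lab_touch : ∀ a < G.nA, ∀ f, mt a = f + 1 → ∀ e < G.mE, xl e ≠ 0 →
    ¬ Disjoint (G.Bs e) (G.Bs f) → lab a = xl e + 1
  lab_src : ∀ a < G.nA, 2 ≤ lab a → ∃ e < G.mE, xl e ≠ 0 ∧ ∃ f, mt a = f + 1 ∧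
    ¬ Disjoint (G.Bs e) (G.Bs f)
  xl_ea : ∀ e < G.mE, xl e ≠ 0 → 1 ≤ lab (G.ea e) ∧ lab (G.ea e) ≤ xl e
  cap : ∀ a, (G.candAt xl m a).card ≤ 4 * D * G.r
  maxl : ∀ i, 1 ≤ i → i ≤ m → ∀ e < G.mE, 1 ≤ lab (G.ea e) → lab (G.ea e) ≤ i →
    (G.candAt xl i (G.ea e)).card < 4 * D * G.r → ∃ b ∈ G.Bs e, G.Forb mt xl lab i b
  growth : ∀ i, i + 1 < m → D * (G.upTo lab i).card ≤ 2 * (G.upTo lab (i + 1)).card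

variable {G}

theorem upTo_congr {lab lab' : ℕ → ℕ} {i j : ℕ}
    (h : ∀ a < G.nA, (1 ≤ lab a ∧ lab a ≤ i + 1) ↔ (1 ≤ lab' a ∧ lab' a ≤ j + 1)) :
    G.upTo lab i = G.upTo lab' j := by
  ext a
  simp only [upTo, Finset.mem_filter, Finset.mem_range]
  exact ⟨fun h' => ⟨h'.1, (h a h'.1).1 h'.2⟩, fun h' => ⟨h'.1, (h a h'.1).2 h'.2⟩⟩

theorem candAt_congr {xl xl' : ℕ → ℕ} {i j a : ℕ}
    (h : ∀ e < G.mE, (xl e ≠ 0 ∧ xl e ≤ i) ↔ (xl' e ≠ 0 ∧ xl' e ≤ j)) :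
    G.candAt xl i a = G.candAt xl' j a := by
  ext e
  simp only [candAt, Finset.mem_filter, Finset.mem_range]
  exact ⟨fun ⟨h1, h2, h3, h4⟩ => ⟨h1, ((h e h1).1 ⟨h2, h3⟩).1, ((h e h1).1 ⟨h2, h3⟩).2, h4⟩,
    fun ⟨h1, h2, h3, h4⟩ => ⟨h1, ((h e h1).2 ⟨h2, h3⟩).1, ((h e h1).2 ⟨h2, h3⟩).2, h4⟩⟩

/-- The invariant only involves the entries of the arrays that belong to vertices and edges. -/
theorem Inv.congr {mt xl lab mt' xl' lab' : ℕ → ℕ} {m D : ℕ} (h : G.Inv mt xl lab m D)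
    (hm : ∀ a < G.nA, mt' a = mt a) (hx : ∀ e < G.mE, xl' e = xl e)
    (hl : ∀ a < G.nA, lab' a = lab a) : G.Inv mt' xl' lab' m D := by
  have hu : ∀ i, G.upTo lab' i = G.upTo lab i := fun i =>
    upTo_congr fun a ha => by rw [hl a ha]
  have hc : ∀ i a, G.candAt xl' i a = G.candAt xl i a := fun i a =>
    candAt_congr fun e he => by rw [hx e he]
  constructor
  · intro a ha f hf
    exact h.mt_lt a ha f (by rw [← hm a ha, hf])
  · intro a ha f hf
    exact h.mt_ea a ha f (by rw [← hm a ha, hf])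
  · intro a ha a' ha' hne f f' hf hf'
    exact h.mt_disj a ha a' ha' hne f f' (by rw [← hm a ha, hf]) (by rw [← hm a' ha', hf'])
  · intro e he e' he' hne hx1 hx2
    exact h.xl_disj e he e' he' hne (by rwa [← hx e he]) (by rwa [← hx e' he'])
  · intro e he
    rw [hx e he]; exact h.xl_le e he
  · intro a ha
    rw [hl a ha, hm a ha]; exact h.lab_one a ha
  · intro a ha f hf e he hxe hd
    rw [hl a ha, hx e he]
    exact h.lab_touch a ha f (by rw [← hm a ha, hf]) e he (by rwa [← hx e he]) hd
  · intro a ha h2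
    obtain ⟨e, he, h1, f, hf, hd⟩ := h.lab_src a ha (by rwa [← hl a ha])
    exact ⟨e, he, by rwa [hx e he], f, by rw [hm a ha, hf], hd⟩
  · intro e he hxe
    rw [hl _ (G.ea_lt e he), hx e he]
    exact h.xl_ea e he (by rwa [← hx e he])
  · intro a
    rw [hc]; exact h.cap a
  · intro i hi hi' e he h1 h2 h3
    rw [hl _ (G.ea_lt e he)] at h1 h2
    rw [hc] at h3
    obtain ⟨b, hb, hF⟩ := h.maxl i hi hi' e he h1 h2 h3
    refine ⟨b, hb, ?_⟩
    rcases hF with ⟨e', he', h4, h5, h6⟩ | ⟨a, ha, h4, h5, f, hf, h6⟩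
    · exact .inl ⟨e', he', by rwa [hx e' he'], by rwa [hx e' he'], h6⟩
    · exact .inr ⟨a, ha, by rwa [hl a ha], by rwa [hl a ha], f, by rw [hm a ha, hf], h6⟩
  · intro i hi
    rw [hu, hu]; exact h.growth i hi

theorem Inv.lab_le {mt xl lab : ℕ → ℕ} {m D : ℕ} (h : G.Inv mt xl lab m D) {a : ℕ}
    (ha : a < G.nA) : lab a ≤ m + 1 := by
  by_contra! hl
  obtain ⟨e, he, h1, f, hf, hd⟩ := h.lab_src a ha (by omega)
  have := h.lab_touch a ha f hf e he h1 hd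
  have := h.xl_le e he
  omega

/-- The vertices of layer `j` that have a candidate edge disjoint from the matching. -/
def movable (G : EdgeTable) (mt xl lab : ℕ → ℕ) (j : ℕ) : Set ℕ :=
  {a | a < G.nA ∧ lab a = j + 1 ∧ ∃ e < G.mE, xl e ≠ 0 ∧ G.ea e = a ∧ G.Free mt e}

open scoped Classical in
/-- If only few vertices in each layer are movable, then almost all candidate edges are blocked by
matching edges of the layers up to `m + 1`. Since the candidate edges are maximal, they form a
hitting set, so the strong Haxell condition makes them numerous, and the layers grow by the
factor `D / 2`. -/
theorem Inv.growth_last {mt xl lab : ℕ → ℕ} {m D : ℕ} (h : G.Inv mt xl lab (m + 1) D)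
    (hD : 4 ≤ D) (hH : G.Haxell D) (hr : 1 ≤ G.r) (Q : ℕ → Finset ℕ)
    (hQ : ∀ j ≤ m, ∀ a, a ∈ G.movable mt xl lab j → a ∈ Q j)
    (hQc : ∀ j ≤ m, 100 * (Q j).card ≤ (G.layer lab j).card) :
    D * (G.upTo lab m).card ≤ 2 * (G.upTo lab (m + 1)).card := by
  set k := 4 * D * G.r with hk
  set A := G.upTo lab m with hA
  set A' := G.upTo lab (m + 1) with hA'
  set X := G.cand xl with hX
  have hcand : ∀ a, X.filter (fun e => G.ea e = a) = G.candAt xl (m + 1) a := by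
    intro a
    ext e
    simp only [hX, cand, candAt, Finset.mem_filter, Finset.mem_range]
    exact ⟨fun ⟨⟨h1, h2⟩, h3⟩ => ⟨h1, h2, h.xl_le e h1, h3⟩,
      fun ⟨h1, h2, _, h3⟩ => ⟨⟨h1, h2⟩, h3⟩⟩
  have hXA : ∀ e ∈ X, G.ea e ∈ A := by
    intro e he
    simp only [hX, cand, Finset.mem_filter, Finset.mem_range] at he
    have h1 := h.xl_ea e he.1 he.2
    have h2 := h.xl_le e he.1
    simp only [hA, upTo, Finset.mem_filter, Finset.mem_range]
    exact ⟨G.ea_lt e he.1, h1.1, h1.2.trans h2⟩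
  -- few candidate edges are free
  have hfree : (X.filter fun e => G.Free mt e).card
      ≤ k * ((Finset.range (m + 1)).biUnion Q).card := by
    refine Finset.card_le_mul_card_image_of_maps_to (f := G.ea) (fun e he => ?_) k fun a ha => ?_
    · have he' := Finset.mem_filter.1 he
      have h1 := hXA e he'.1
      simp only [hA, upTo, Finset.mem_filter, Finset.mem_range] at h1
      simp only [hX, cand, Finset.mem_filter, Finset.mem_range] at he'
      refine Finset.mem_biUnion.2 ⟨lab (G.ea e) - 1, Finset.mem_range.2 (by omega),
        hQ _ (by omega) _ ⟨h1.1, by omega, e, he'.1.1, he'.1.2, rfl, he'.2⟩⟩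
    · refine le_trans (Finset.card_le_card ?_) (h.cap a)
      rw [← hcand]
      intro e he
      simp only [Finset.mem_filter] at he ⊢
      exact ⟨he.1.1, he.2⟩
  have hQA : 100 * ((Finset.range (m + 1)).biUnion Q).card ≤ A.card := by
    have h1 : A.card = ∑ j ∈ Finset.range (m + 1), (G.layer lab j).card := by
      rw [Finset.card_eq_sum_card_fiberwise (f := fun a => lab a - 1) (t := Finset.range (m + 1))]
      · refine Finset.sum_congr rfl fun j hj => congrArg _ ?_
        ext a
        simp only [hA, upTo, layer, Finset.mem_filter, Finset.mem_range] at hj ⊢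
        constructor
        · rintro ⟨⟨h1, h2, h3⟩, h4⟩
          exact ⟨h1, by omega⟩
        · rintro ⟨h1, h2⟩
          exact ⟨⟨h1, by omega, by omega⟩, by omega⟩
      · intro a ha
        simp only [hA, upTo, Finset.coe_filter, Set.mem_ofPred_eq, Finset.mem_range] at ha
        simp only [Finset.coe_range, Set.mem_Iio]
        omega
    rw [h1]
    refine (Nat.mul_le_mul_left _ Finset.card_biUnion_le).trans ?_
    rw [Finset.mul_sum]
    exact Finset.sum_le_sum fun j hj => hQc j (by have := Finset.mem_range.1 hj; omega)
  -- the blocked ones are at most `r` per blocking edge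
  have hblocked : (X.filter fun e => ¬ G.Free mt e).card ≤ A'.card * G.r := by
    have hex : ∀ e ∈ X.filter (fun e => ¬ G.Free mt e),
        ∃ b ∈ G.Bs e, b ∈ (A'.filter fun a => mt a ≠ 0).biUnion fun a => G.Bs (mt a - 1) := by
      intro e he
      simp only [hX, cand, Free, Finset.mem_filter, Finset.mem_range] at he
      obtain ⟨⟨he1, he2⟩, he3⟩ := he
      push Not at he3
      obtain ⟨a, ha, f, hf, hd⟩ := he3
      have hl := h.lab_touch a ha f hf e he1 he2 hd
      have hm := h.xl_le e he1
      obtain ⟨b, hb, hb'⟩ := Finset.not_disjoint_iff.1 hd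
      refine ⟨b, hb, Finset.mem_biUnion.2 ⟨a, ?_, by simpa [hf] using hb'⟩⟩
      simp only [hA', upTo, Finset.mem_filter, Finset.mem_range]
      exact ⟨⟨ha, by omega, by omega⟩, by omega⟩
    choose! β hβ1 hβ2 using hex
    refine (Finset.card_le_card_of_injOn β (fun e he => hβ2 e he) ?_).trans
      ((Finset.card_biUnion_le_card_mul _ _ G.r ?_).trans
        (Nat.mul_le_mul_right _ (Finset.card_filter_le _ _)))
    · intro e he e' he' hee
      by_contra hne
      have h1 := hβ1 e he
      have h2 := hβ1 e' he'
      simp only [hX, cand, Finset.coe_filter, Set.mem_ofPred_eq, Finset.mem_filter,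
        Finset.mem_range] at he he'
      exact Finset.disjoint_left.1 (h.xl_disj e he.1.1 e' he'.1.1 hne he.1.2 he'.1.2) h1
        (hee ▸ h2)
    · intro a ha
      simp only [hA', upTo, Finset.mem_filter, Finset.mem_range] at ha
      exact G.card_Bs_le (h.mt_lt a ha.1.1 _ (by omega))
  -- the candidate edges and the matching edges of the layers hit all edges at unsaturated vertices
  set U := A.filter fun a => (G.candAt xl (m + 1) a).card < k with hU
  have hhit : (D : ℝ) * G.r ^ 2 * U.card ≤ ((X.card * G.r + A.card * G.r : ℕ) : ℝ) := by
    refine (hH U (X.biUnion G.Bs ∪ (A.filter fun a => mt a ≠ 0).biUnion fun a => G.Bs (mt a - 1))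
      (fun a ha => ?_) fun e he heU => ?_).trans (Nat.cast_le.2 ?_)
    · simp only [hU, hA, upTo, Finset.mem_filter, Finset.mem_range] at ha
      exact ha.1.1
    · simp only [hU, hA, upTo, Finset.mem_filter, Finset.mem_range] at heU
      obtain ⟨b, hb, hF⟩ := h.maxl (m + 1) (by omega) le_rfl e he heU.1.2.1 heU.1.2.2 heU.2
      refine ⟨b, ?_, hb⟩
      rcases hF with ⟨e', he', h4, h5, h6⟩ | ⟨a, ha, h4, h5, f, hf, h6⟩
      · refine Finset.mem_union_left _ (Finset.mem_biUnion.2 ⟨e', ?_, h6⟩)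
        simp only [hX, cand, Finset.mem_filter, Finset.mem_range]
        exact ⟨he', h4⟩
      · refine Finset.mem_union_right _ (Finset.mem_biUnion.2 ⟨a, ?_, by simpa [hf] using h6⟩)
        simp only [hA, upTo, Finset.mem_filter, Finset.mem_range]
        exact ⟨⟨ha, h4, h5⟩, by omega⟩
    · refine (Finset.card_union_le _ _).trans (Nat.add_le_add ?_ ?_)
      · refine Finset.card_biUnion_le_card_mul _ _ G.r fun e he => ?_
        simp only [hX, cand, Finset.mem_filter, Finset.mem_range] at he
        exact G.card_Bs_le he.1
      · refine (Finset.card_biUnion_le_card_mul _ _ G.r fun a ha => ?_).trans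
          (Nat.mul_le_mul_right _ (Finset.card_filter_le _ _))
        simp only [hA, upTo, Finset.mem_filter, Finset.mem_range] at ha
        exact G.card_Bs_le (h.mt_lt a ha.1.1 _ (by omega))
  -- all other vertices of the layers have `k` candidate edges
  have hsat : k * A.card ≤ X.card + k * U.card := by
    have h1 : X.card = ∑ a ∈ A, (G.candAt xl (m + 1) a).card := by
      rw [Finset.card_eq_sum_card_fiberwise (f := G.ea) (t := A) hXA]
      exact Finset.sum_congr rfl fun a _ => congrArg _ (hcand a)
    have h2 : k * A.card = ∑ a ∈ A, k := by simp [mul_comm]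
    have h3 : k * U.card = ∑ a ∈ A, if (G.candAt xl (m + 1) a).card < k then k else 0 := by
      rw [← Finset.sum_filter, Finset.sum_const, smul_eq_mul, mul_comm]
    rw [h1, h2, h3, ← Finset.sum_add_distrib]
    refine Finset.sum_le_sum fun a _ => ?_
    split <;> omega
  have hXsplit := Finset.card_filter_add_card_filter_not (s := X) (p := fun e => G.Free mt e)
  have hDr : (4 : ℝ) ≤ D := by exact_mod_cast hD
  have hrr : (1 : ℝ) ≤ G.r := by exact_mod_cast hr
  have e1 : (X.card : ℝ) ≤ k * (A.card / 100) + A'.card * G.r := by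
    have q1 : (X.card : ℝ) ≤ k * ((Finset.range (m + 1)).biUnion Q).card + A'.card * G.r := by
      exact_mod_cast (show X.card ≤ _ by omega)
    have q2 : (((Finset.range (m + 1)).biUnion Q).card : ℝ) ≤ A.card / 100 := by
      have : (100 : ℝ) * ((Finset.range (m + 1)).biUnion Q).card ≤ A.card := by
        exact_mod_cast hQA
      linarith
    have := mul_le_mul_of_nonneg_left q2 (Nat.cast_nonneg (α := ℝ) k)
    linarith
  have e2 : (k : ℝ) * A.card ≤ X.card + k * U.card := by exact_mod_cast hsat
  have ek : (k : ℝ) = 4 * D * G.r := by rw [hk]; push_cast; ring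
  rw [ek] at e1 e2
  push_cast at hhit
  have a0 : (0 : ℝ) ≤ A.card := Nat.cast_nonneg _
  -- `X ≤ 4Dr|A| / 100 + r|A'|` and `4Dr|A| ≤ X + 4(X + |A|)`, where `X` is the number of
  -- candidate edges, leave room for the factor `D / 2`, since `D ≥ 4`
  have final : (D : ℝ) * A.card ≤ 2 * A'.card := by
    have r0 : (0 : ℝ) < G.r := by linarith
    -- divide the hitting-set inequality by `r`
    have f1 : (D : ℝ) * G.r * U.card ≤ X.card + A.card := by
      refine le_of_mul_le_mul_left ?_ r0
      nlinarith
    have f2 : (D : ℝ) * G.r * A.card ≤ 5 / 4 * X.card + A.card := by nlinarith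
    have f3 : (D : ℝ) * G.r * A.card * (95 / 100) ≤ 5 / 4 * (A'.card * G.r) + A.card * G.r := by
      nlinarith [mul_le_mul_of_nonneg_left hrr a0]
    have f4 : (D : ℝ) * A.card * (95 / 100) ≤ 5 / 4 * A'.card + A.card := by
      refine le_of_mul_le_mul_left ?_ r0
      nlinarith
    nlinarith [mul_le_mul_of_nonneg_right hDr a0]
  exact_mod_cast final

end EdgeTable

namespace EdgeTable

/-! ### Changes of the layers -/

variable {G : EdgeTable}

/-- Vertices of layer `j` for which `q` names a free candidate edge are rematched to it, and the
candidate edges of the layers above `j` are given up. -/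
theorem Inv.collapse {mt xl lab : ℕ → ℕ} {m D j : ℕ} (h : G.Inv mt xl lab m D) (hj : j < m)
    (q : ℕ → ℕ) (hq : ∀ a < G.nA, ∀ e, q a = e + 1 →
      e < G.mE ∧ G.ea e = a ∧ xl e ≠ 0 ∧ G.Free mt e) :
    G.Inv (fun a => if lab a = j + 1 ∧ q a ≠ 0 then q a else mt a)
      (fun e => if xl e ≤ j then xl e else 0)
      (fun a => if lab a ≤ j ∨ (lab a = j + 1 ∧ q a = 0) then lab a else 0) j D := by
  constructor
  · intro a ha f hf
    split_ifs at hf with hc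
    · exact (hq a ha f hf).1
    · exact h.mt_lt a ha f hf
  · intro a ha f hf
    split_ifs at hf with hc
    · exact (hq a ha f hf).2.1
    · exact h.mt_ea a ha f hf
  · intro a ha a' ha' hne f f' hf hf'
    split_ifs at hf hf' with hc hc' hc'
    · obtain ⟨h1, h2, h3, h4⟩ := hq a ha f hf
      obtain ⟨h1', h2', h3', h4'⟩ := hq a' ha' f' hf'
      exact h.xl_disj f h1 f' h1' (fun h => hne (by rw [← h2, ← h2', h])) h3 h3'
    · exact (hq a ha f hf).2.2.2 a' ha' f' hf'
    · exact ((hq a' ha' f' hf').2.2.2 a ha f hf).symm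
    · exact h.mt_disj a ha a' ha' hne f f' hf hf'
  · intro e he e' he' hne h1 h2
    split_ifs at h1 h2 <;> first | exact h.xl_disj e he e' he' hne h1 h2 | simp_all
  · intro e he
    split_ifs <;> omega
  · intro a ha
    have := h.lab_one a ha
    split_ifs <;> constructor <;> intro h' <;> first | exact h'.elim | omega
  · intro a ha f hf e he hx hd
    split_ifs at hx with hxe
    · split_ifs at hf with hc
      -- the new matching edge `f` is a candidate edge of a layer above `j`, hence disjoint from `e`
      · obtain ⟨h1, h2, h3, h4⟩ := hq a ha f hf
        have := (h.xl_ea f h1 h3).2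
        rw [h2] at this
        exact (hd (h.xl_disj e he f h1 (fun h => by subst h; omega) hx h3)).elim
      · have := h.lab_touch a ha f hf e he hx hd
        rw [if_pos (by omega), if_pos hxe, this]
    · simp at hx
  · intro a ha h2
    split_ifs at h2 with hc
    · obtain ⟨e, he, h1, f, hf, hd⟩ := h.lab_src a ha h2
      have := h.lab_touch a ha f hf e he h1 hd
      refine ⟨e, he, ?_, f, ?_, hd⟩
      · rw [if_pos (by omega)]; exact h1
      · rw [if_neg (by omega)]; exact hf
    · simp at h2
  · intro e he hx
    split_ifs at hx with hxe
    · have := h.xl_ea e he hx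
      rw [if_pos (by omega), if_pos hxe]
      exact this
    · simp at hx
  · intro a
    refine le_trans (Finset.card_le_card fun e he => ?_) (h.cap a)
    simp only [candAt, Finset.mem_filter, Finset.mem_range] at he ⊢
    obtain ⟨h1, h2, h3, h4⟩ := he
    split_ifs at h2 with hxe
    · exact ⟨h1, h2, h.xl_le e h1, h4⟩
    · simp at h2
  · intro i hi hij e he h1 h2 h3
    have hcand : ∀ a, G.candAt (fun e => if xl e ≤ j then xl e else 0) i a = G.candAt xl i a :=
      fun a => candAt_congr fun e he => by split_ifs <;> omega
    rw [hcand] at h3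
    split_ifs at h1 h2 with hc
    · obtain ⟨b, hb, hF⟩ := h.maxl i hi (by omega) e he h1 h2 h3
      refine ⟨b, hb, ?_⟩
      rcases hF with ⟨e', he', h4, h5, h6⟩ | ⟨a, ha, h4, h5, f, hf, h6⟩
      · exact .inl ⟨e', he', by dsimp only; rw [if_pos (by omega)]; exact h4,
          by dsimp only; rw [if_pos (by omega)]; exact h5, h6⟩
      · exact .inr ⟨a, ha, by dsimp only; rw [if_pos (by omega)]; exact h4,
          by dsimp only; rw [if_pos (by omega)]; exact h5, f,
          by dsimp only; rw [if_neg (by omega)]; exact hf, h6⟩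
    · simp at h1
  · intro i hi
    have hu : ∀ i', i' < j → G.upTo (fun a => if lab a ≤ j ∨ (lab a = j + 1 ∧ q a = 0) then lab a
        else 0) i' = G.upTo lab i' :=
      fun i' hi' => upTo_congr fun a _ => by split_ifs <;> omega
    rw [hu i (by omega), hu (i + 1) hi]
    exact h.growth i (by omega)

theorem upTo_collapse_of_lt {lab q : ℕ → ℕ} {i j : ℕ} (hi : i < j) :
    G.upTo (fun a => if lab a ≤ j ∨ (lab a = j + 1 ∧ q a = 0) then lab a else 0) i
      = G.upTo lab i :=
  upTo_congr fun a _ => by split_ifs <;> omega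

theorem card_upTo_collapse (lab q : ℕ → ℕ) (j : ℕ) :
    (G.upTo (fun a => if lab a ≤ j ∨ (lab a = j + 1 ∧ q a = 0) then lab a else 0) j).card
      + ((G.layer lab j).filter fun a => q a ≠ 0).card = (G.upTo lab j).card := by
  rw [← Finset.card_union_of_disjoint]
  · congr 1
    ext a
    simp only [upTo, layer, Finset.mem_union, Finset.mem_filter, Finset.mem_range]
    split_ifs <;> constructor <;> intro h' <;> omega
  · rw [Finset.disjoint_left]
    intro a h1 h2
    simp only [upTo, layer, Finset.mem_filter, Finset.mem_range] at h1 h2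
    split_ifs at h1 <;> omega

/-- The new last layer of candidate edges is a maximal set of edges at the labelled vertices,
subject to the bound on the number of candidate edges at a vertex, that are disjoint from each
other, from the old candidate edges and from the matching edges of the labelled vertices. -/
theorem Inv.build {mt xl lab : ℕ → ℕ} {m D : ℕ} (h : G.Inv mt xl lab m D)
    (hg : ∀ i, i + 1 = m → D * (G.upTo lab i).card ≤ 2 * (G.upTo lab m).card)
    {xl' lab' : ℕ → ℕ}
    (hx : ∀ e < G.mE, xl' e = xl e ∨ (xl e = 0 ∧ xl' e = m + 1 ∧ 1 ≤ lab (G.ea e) ∧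
      ∀ b ∈ G.Bs e, ¬ G.Forb mt xl lab (m + 1) b))
    (hd : ∀ e < G.mE, ∀ e' < G.mE, e ≠ e' → xl' e = m + 1 → xl' e' = m + 1 →
      Disjoint (G.Bs e) (G.Bs e'))
    (hcap : ∀ a, (G.candAt xl' (m + 1) a).card ≤ 4 * D * G.r)
    (hmax : ∀ e < G.mE, 1 ≤ lab (G.ea e) → (G.candAt xl' (m + 1) (G.ea e)).card < 4 * D * G.r →
      ∃ b ∈ G.Bs e, G.Forb mt xl lab (m + 1) b ∨ ∃ e' < G.mE, xl' e' = m + 1 ∧ b ∈ G.Bs e')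
    (hl1 : ∀ a < G.nA, 1 ≤ lab a → lab' a = lab a)
    (hl2 : ∀ a < G.nA, lab a = 0 → lab' a = 0 ∨ (lab' a = m + 2 ∧ ∃ f, mt a = f + 1 ∧
      ∃ e < G.mE, xl' e = m + 1 ∧ ¬ Disjoint (G.Bs e) (G.Bs f)))
    (hl3 : ∀ a < G.nA, lab a = 0 → ∀ f, mt a = f + 1 → ∀ e < G.mE, xl' e = m + 1 →
      ¬ Disjoint (G.Bs e) (G.Bs f) → lab' a = m + 2) :
    G.Inv mt xl' lab' (m + 1) D ∧ ∀ i ≤ m, G.upTo lab' i = G.upTo lab i := by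
  have hxle : ∀ e < G.mE, xl e ≤ m := h.xl_le
  have hlab : ∀ a < G.nA, lab a ≤ m + 1 := fun a ha => h.lab_le ha
  have hl : ∀ a < G.nA, ∀ i ≤ m + 1, (1 ≤ lab' a ∧ lab' a ≤ i) ↔ (1 ≤ lab a ∧ lab a ≤ i) := by
    intro a ha i hi
    rcases Nat.eq_zero_or_pos (lab a) with h0 | h0
    · have := hl2 a ha h0
      omega
    · rw [hl1 a ha h0]
  -- a new edge is disjoint from old candidate edges
  have hnewold : ∀ e < G.mE, ∀ e' < G.mE, xl e = 0 → xl' e = m + 1 → xl e' ≠ 0 →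
      Disjoint (G.Bs e) (G.Bs e') := by
    intro e he e' he' h1 h2 h3
    rcases hx e he with h4 | ⟨-, -, -, h4⟩
    · omega
    · refine Finset.disjoint_left.2 fun b hb hb' => h4 b hb (.inl ⟨e', he', h3, ?_, hb'⟩)
      have := hxle e' he'
      omega
  have hup : ∀ i ≤ m, G.upTo lab' i = G.upTo lab i := fun i hi =>
    upTo_congr fun a ha => hl a ha (i + 1) (by omega)
  refine ⟨?_, hup⟩
  constructor
  · exact h.mt_lt
  · exact h.mt_ea
  · exact h.mt_disj
  · intro e he e' he' hne h1 h2
    have q1 := hx e he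
    have q2 := hx e' he'
    have q3 := hxle e he
    have q4 := hxle e' he'
    by_cases c1 : xl e = 0 <;> by_cases c2 : xl e' = 0
    · exact hd e he e' he' hne (by omega) (by omega)
    · exact hnewold e he e' he' c1 (by omega) c2
    · exact (hnewold e' he' e he c2 (by omega) c1).symm
    · exact h.xl_disj e he e' he' hne c1 c2
  · intro e he
    have q1 := hx e he
    have q3 := hxle e he
    omega
  · intro a ha
    rw [← h.lab_one a ha]
    have := hl a ha 1 (by omega)
    omega
  · intro a ha f hf e he hxe hdis
    have q1 := hx e he
    by_cases c1 : xl e = 0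
    · have hnew : xl' e = m + 1 := by omega
      rcases Nat.eq_zero_or_pos (lab a) with h0 | h0
      · rw [hl3 a ha h0 f hf e he hnew hdis, hnew]
      · obtain ⟨b, hb, hb'⟩ := Finset.not_disjoint_iff.1 hdis
        rcases q1 with q1 | ⟨-, -, -, q1⟩
        · omega
        · exact (q1 b hb (.inr ⟨a, ha, h0, hlab a ha, f, hf, hb'⟩)).elim
    · have := h.lab_touch a ha f hf e he c1 hdis
      rw [hl1 a ha (by omega)]
      omega
  · intro a ha h2
    rcases Nat.eq_zero_or_pos (lab a) with h0 | h0
    · rcases hl2 a ha h0 with h3 | ⟨-, f, hf, e, he, hxe, hdis⟩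
      · omega
      · exact ⟨e, he, by omega, f, hf, hdis⟩
    · rw [hl1 a ha h0] at h2
      obtain ⟨e, he, h1, f, hf, hdis⟩ := h.lab_src a ha h2
      have q1 := hx e he
      exact ⟨e, he, by omega, f, hf, hdis⟩
  · intro e he hxe
    have hea := G.ea_lt e he
    rcases hx e he with q1 | ⟨-, q1, q2, -⟩
    · rw [q1] at hxe ⊢
      have := h.xl_ea e he hxe
      rw [hl1 _ hea this.1]
      exact this
    · rw [hl1 _ hea q2, q1]
      exact ⟨q2, hlab _ hea⟩
  · exact hcap
  · intro i hi him e he h1 h2 h3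
    have hea := G.ea_lt e he
    have hle := (hl _ hea i him).1 ⟨h1, h2⟩
    rcases Nat.lt_or_ge m i with hmi | hmi
    · obtain rfl : i = m + 1 := by omega
      obtain ⟨b, hb, hF⟩ := hmax e he hle.1 h3
      refine ⟨b, hb, ?_⟩
      rcases hF with (⟨e', he', h4, h5, h6⟩ | ⟨a, ha, h4, h5, f, hf, h6⟩) | ⟨e', he', h4, h5⟩
      · have q1 := hx e' he'
        exact .inl ⟨e', he', by omega, by omega, h6⟩
      · have := (hl a ha (m + 1) le_rfl).2 ⟨h4, h5⟩
        exact .inr ⟨a, ha, this.1, this.2, f, hf, h6⟩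
      · exact .inl ⟨e', he', by omega, by omega, h5⟩
    · have hc : G.candAt xl' i (G.ea e) = G.candAt xl i (G.ea e) := candAt_congr fun e' he' => by
        have q1 := hx e' he'
        have := hxle e' he'
        omega
      rw [hc] at h3
      obtain ⟨b, hb, hF⟩ := h.maxl i hi hmi e he hle.1 hle.2 h3
      refine ⟨b, hb, ?_⟩
      rcases hF with ⟨e', he', h4, h5, h6⟩ | ⟨a, ha, h4, h5, f, hf, h6⟩
      · have q1 := hx e' he'
        exact .inl ⟨e', he', by omega, by omega, h6⟩
      · have := (hl a ha i him).2 ⟨h4, h5⟩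
        exact .inr ⟨a, ha, this.1, this.2, f, hf, h6⟩
  · intro i hi
    rw [hup i (by omega), hup (i + 1) (by omega)]
    rcases Nat.lt_or_ge (i + 1) m with h1 | h1
    · exact h.growth i h1
    · obtain rfl : i + 1 = m := by omega
      exact hg i rfl

/-- All layers above the unmatched vertices may be given up at any time. -/
theorem Inv.reset {mt xl lab : ℕ → ℕ} {m D : ℕ} (h : G.Inv mt xl lab m D) (D' : ℕ) :
    G.Inv mt (fun _ => 0) (fun a => if mt a = 0 then 1 else 0) 0 D' := by
  constructor
  · exact h.mt_lt
  · exact h.mt_ea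
  · exact h.mt_disj
  · simp
  · simp
  · intro a _; split_ifs with hc <;> simp [hc]
  · simp
  · intro a _ h2; split_ifs at h2 <;> omega
  · simp
  · simp [candAt]
  · intro i hi hi0; omega
  · intro i hi; omega

/-- The empty matching without candidate edges: all vertices form layer `0`. -/
theorem inv_init (G : EdgeTable) (D : ℕ) :
    G.Inv (fun _ => 0) (fun _ => 0) (fun _ => 1) 0 D := by
  constructor <;> simp [candAt]
  intros; omega

end EdgeTable

/-! ### The potential -/

/-- Properties of a weight `H` of layer sizes that make the potential below increase in every
round: it decays geometrically along the layers, whose sizes grow by a factor `D / 2` with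
`δ ≤ D`, and a decrease of the layer size by half a percent increases the weight by more than the
weight of all higher layers. -/
structure IsLayerWeight (H : ℝ → ℝ) (n δ q : ℝ) : Prop where
  nonneg : ∀ x, 0 < x → 0 ≤ H x
  anti : ∀ x y, 0 < x → x ≤ y → H y ≤ H x
  one_le : ∀ x, 0 < x → x ≤ n → 1 ≤ H x
  q_nonneg : 0 ≤ q
  q_le : q ≤ 1 / 2
  decay : ∀ D x y, δ ≤ D → 0 < x → 0.995 * (D / 2) * x ≤ y → H y ≤ q * H x
  gain : ∀ x, 0 < x → x ≤ n → H x + 2 + 2 * q * H x ≤ H (0.995 * x)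

/-- The size of the union of all layers, replaced by `0.995 * (D / 2)` times the size of the union
of all but the last one if it is smaller than that. While the last layer is still being changed it
need not have grown by the factor `D / 2`, and without the lower bound its weight would not be
controlled by the weight of the layers below. With the factor `0.995` the bound does not interfere
with a collapse, which shrinks a union that has grown by `D / 2` to `0.995` of its size. -/
noncomputable def clampedSize (a : ℕ → ℕ) (m D : ℕ) : ℝ :=
  if m = 0 then a 0 else max (a m) (0.995 * ((D : ℝ) / 2) * a (m - 1))

/-- The potential of layers, where `a i` is the size of the union of the layers `0, …, i`: the total
weight of these unions for `i ≤ m`. -/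
noncomputable def layerPotential (H : ℝ → ℝ) (a : ℕ → ℕ) (m D : ℕ) : ℝ :=
  ∑ i ∈ Finset.range m, H (a i) + max 1 (H (clampedSize a m D))

namespace IsLayerWeight

variable {H : ℝ → ℝ} {n δ q : ℝ}

theorem mono {n' : ℝ} (h : IsLayerWeight H n δ q) (hn : n' ≤ n) : IsLayerWeight H n' δ q :=
  ⟨h.nonneg, h.anti, fun x h1 h2 => h.one_le x h1 (h2.trans hn), h.q_nonneg, h.q_le, h.decay,
    fun x h1 h2 => h.gain x h1 (h2.trans hn)⟩

/-- By geometric decay, the part of the potential above layer `j` is small compared to the weight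
at `j`. -/
theorem tail_le (hw : IsLayerWeight H n δ q) {a : ℕ → ℕ} {m D : ℕ} (hD : δ ≤ D)
    (hpos : ∀ i, 1 ≤ a i) (hg : ∀ i, i + 1 < m → D * a i ≤ 2 * a (i + 1)) :
    ∀ k j, j + k + 1 = m →
      ∑ i ∈ Finset.Ico (j + 1) m, H (a i) + max 1 (H (clampedSize a m D))
        ≤ 1 + 2 * q * H (a j) := by
  have hp : ∀ i, (0 : ℝ) < a i := fun i => by exact_mod_cast hpos i
  intro k
  induction k with
  | zero =>
      rintro j rfl
      have h1 : H (clampedSize a (j + 1) D) ≤ q * H (a j) := by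
        refine hw.decay D _ _ hD (hp j) ?_
        simp only [clampedSize, Nat.add_one_ne_zero, if_false, Nat.add_sub_cancel]
        exact le_max_right _ _
      have h2 : 0 ≤ q * H (a j) := mul_nonneg hw.q_nonneg (hw.nonneg _ (hp j))
      have h3 : max 1 (H (clampedSize a (j + 1) D)) ≤ 1 + q * H (a j) :=
        max_le (by linarith) (by linarith)
      simp only [add_zero, Finset.Ico_self, Finset.sum_empty]
      linarith
  | succ k ih =>
      intro j hj
      have h1 := ih (j + 1) (by omega)
      have h2 : H (a (j + 1)) ≤ q * H (a j) := by
        refine hw.decay D _ _ hD (hp j) ?_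
        have : (D : ℝ) * a j ≤ 2 * a (j + 1) := by exact_mod_cast hg j (by omega)
        have h0 : (0 : ℝ) ≤ D * a j := by positivity
        linarith
      rw [Finset.sum_eq_sum_Ico_succ_bot (by omega)]
      have h3 := hw.nonneg _ (hp (j + 1))
      have h4 := mul_le_mul_of_nonneg_right hw.q_le h3
      linarith

theorem one_le_potential (hw : IsLayerWeight H n δ q) {a : ℕ → ℕ} (m D : ℕ)
    (hpos : ∀ i, 1 ≤ a i) : 1 ≤ layerPotential H a m D := by
  have h1 : 0 ≤ ∑ i ∈ Finset.range m, H (a i) :=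
    Finset.sum_nonneg fun i _ => hw.nonneg _ (by exact_mod_cast hpos i)
  have h2 := le_max_left 1 (H (clampedSize a m D))
  simp only [layerPotential]
  linarith

theorem potential_le (hw : IsLayerWeight H n δ q) {a : ℕ → ℕ} {m D : ℕ} (hD : δ ≤ D)
    (hpos : ∀ i, 1 ≤ a i) (hg : ∀ i, i + 1 < m → D * a i ≤ 2 * a (i + 1)) :
    layerPotential H a m D ≤ 1 + 2 * H 1 := by
  have h0 : (0 : ℝ) < a 0 := by exact_mod_cast hpos 0
  have h1 : H (a 0) ≤ H 1 := hw.anti _ _ one_pos (by exact_mod_cast hpos 0)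
  have h2 := hw.nonneg _ h0
  rcases Nat.eq_zero_or_pos m with rfl | hm
  · simp only [layerPotential, clampedSize, Finset.range_zero, Finset.sum_empty, if_true, zero_add]
    exact max_le (by linarith) (by linarith)
  · have h3 := hw.tail_le hD hpos hg (m - 1) 0 (by omega)
    have h4 := mul_le_mul_of_nonneg_right hw.q_le h2
    simp only [layerPotential]
    rw [Finset.range_eq_Ico, Finset.sum_eq_sum_Ico_succ_bot hm]
    linarith

/-- Building a layer increases the potential, since the weight of the new last layer counts at
least `1`. -/
theorem potential_build (hw : IsLayerWeight H n δ q) {a a' : ℕ → ℕ} {m D : ℕ}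
    (hpos : ∀ i, 1 ≤ a i) (hn : ∀ i, (a i : ℝ) ≤ n)
    (hg : ∀ i, i + 1 = m → D * a i ≤ 2 * a m) (ha : ∀ i ≤ m, a' i = a i) :
    layerPotential H a m D + 1 ≤ layerPotential H a' (m + 1) D := by
  have hp : ∀ i, (0 : ℝ) < a i := fun i => by exact_mod_cast hpos i
  have hc : clampedSize a m D = a m := by
    rcases Nat.eq_zero_or_pos m with rfl | hm
    · simp [clampedSize]
    · simp only [clampedSize, hm.ne', if_false]
      refine max_eq_left ?_
      have : (D : ℝ) * a (m - 1) ≤ 2 * a m := by exact_mod_cast hg (m - 1) (by omega)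
      have h0 : (0 : ℝ) ≤ D * a (m - 1) := by positivity
      linarith
  have h1 : ∑ i ∈ Finset.range (m + 1), H (a' i) = ∑ i ∈ Finset.range m, H (a i) + H (a m) := by
    rw [← Finset.sum_range_succ]
    exact Finset.sum_congr rfl fun i hi => by
      rw [ha i (by have := Finset.mem_range.1 hi; omega)]
  have h2 := le_max_left 1 (H (clampedSize a' (m + 1) D))
  simp only [layerPotential, hc, h1, max_eq_right (hw.one_le _ (hp m) (hn m))]
  linarith

/-- Collapsing to layer `j` increases the potential: the weight gained at `j` exceeds the weight of
the layers that are given up. -/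
theorem potential_collapse (hw : IsLayerWeight H n δ q) {a a' : ℕ → ℕ} {m j D : ℕ} (hD : δ ≤ D)
    (hpos : ∀ i, 1 ≤ a i) (hn : ∀ i, (a i : ℝ) ≤ n)
    (hg : ∀ i, i + 1 < m → D * a i ≤ 2 * a (i + 1)) (hj : j < m) (ha : ∀ i < j, a' i = a i)
    (hpos' : 1 ≤ a' j) (haj : (a' j : ℝ) ≤ 0.995 * a j) :
    layerPotential H a m D + 1 ≤ layerPotential H a' j D := by
  have hp : ∀ i, (0 : ℝ) < a i := fun i => by exact_mod_cast hpos i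
  have h1 := hw.tail_le hD hpos hg (m - j - 1) j (by omega)
  have h2 : ∑ i ∈ Finset.range m, H (a i)
      = ∑ i ∈ Finset.range j, H (a i) + (H (a j) + ∑ i ∈ Finset.Ico (j + 1) m, H (a i)) := by
    rw [← Finset.sum_eq_sum_Ico_succ_bot hj (fun i => H (a i)),
      Finset.sum_range_add_sum_Ico _ hj.le]
  have h3 : ∑ i ∈ Finset.range j, H (a' i) = ∑ i ∈ Finset.range j, H (a i) :=
    Finset.sum_congr rfl fun i hi => by rw [ha i (Finset.mem_range.1 hi)]
  have hp' : (0 : ℝ) < a' j := by exact_mod_cast hpos'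
  have h4 : H (0.995 * a j) ≤ H (clampedSize a' j D) := by
    rcases Nat.eq_zero_or_pos j with rfl | hj0
    · simp only [clampedSize, if_true]
      exact hw.anti _ _ hp' haj
    · simp only [clampedSize, hj0.ne', if_false]
      refine hw.anti _ _ (lt_max_of_lt_left hp') (max_le haj ?_)
      rw [ha (j - 1) (by omega)]
      have : (D : ℝ) * a (j - 1) ≤ 2 * a j := by
        have := hg (j - 1) (by omega)
        rw [Nat.sub_add_cancel hj0] at this
        exact_mod_cast this
      linarith
  have h5 := hw.gain _ (hp j) (hn j)
  have h6 := le_max_right 1 (H (clampedSize a' j D))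
  simp only [layerPotential, h2, h3]
  linarith

end IsLayerWeight

/-- The weight is `10 * y * (n / x) ^ (80 / y)` with `y = √(log₂ d)`. If the sizes of
the unions of the first layers grow by the factor `0.995 * D / 2`, then their weights decrease at
least by the factor `q = 2 ^ (-10 * y)`. If `x` shrinks by half a percent, then the weight increases
at least by the factor `1 + 0.4 / y`, which outweighs `q`. -/
theorem exists_isLayerWeight {n d : ℝ} (hn : 1 ≤ n) (hd : 4 ≤ d) :
    ∃ H q, IsLayerWeight H n (max 4 (d / 2)) q ∧
      H 1 = 10 * √(Real.logb 2 d) * n ^ (80 / √(Real.logb 2 d)) := by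
  set y := √(Real.logb 2 d) with hy
  have hlog : (1 : ℝ) ≤ Real.logb 2 d := by
    rw [Real.le_logb_iff_rpow_le (by norm_num) (by linarith)]
    norm_num; linarith
  have hy1 : 1 ≤ y := Real.one_le_sqrt.2 hlog
  have hyy : y * y = Real.logb 2 d := Real.mul_self_sqrt (by linarith)
  set γ := 80 / y with hγ
  have hγ0 : 0 < γ := by positivity
  set q := (2 : ℝ) ^ (-(10 * y)) with hq
  have hq1 : q * (10 * y) ≤ 1 := by
    have h1 : 10 * y ≤ (2 : ℝ) ^ (10 * y) := by
      have h2 := Real.add_one_le_exp (10 * y * Real.log 2)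
      have h3 := Real.log_two_gt_d9
      rw [Real.rpow_def_of_pos two_pos, show Real.log 2 * (10 * y) = 5 * y * Real.log 2
        + 5 * y * Real.log 2 by ring, Real.exp_add]
      have h4 := Real.add_one_le_exp (5 * y * Real.log 2)
      have h5 : 1 + 3.4 * y ≤ Real.exp (5 * y * Real.log 2) := by nlinarith
      nlinarith [mul_le_mul h5 h5 (by positivity) (Real.exp_pos _).le]
    rw [hq, Real.rpow_neg two_pos.le, inv_mul_le_iff₀ (by positivity)]
    linarith
  have hq0 : 0 ≤ q := by positivity
  have hbase : ∀ x, 0 < x → x ≤ n → 1 ≤ (n / x) ^ γ := fun x hx hxn =>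
    Real.one_le_rpow (by rwa [one_le_div hx]) hγ0.le
  refine ⟨fun x => 10 * y * (n / x) ^ γ, q, ⟨?_, ?_, ?_, hq0, ?_, ?_, ?_⟩, by simp⟩
  · intro x hx
    positivity
  · intro x z hx hxz
    have : (0 : ℝ) < z := hx.trans_le hxz
    gcongr
  · intro x hx hxn
    have := hbase x hx hxn
    nlinarith
  · nlinarith
  · intro D x z hD hx hxz
    have hD4 : 4 ≤ D := (le_max_left _ _).trans hD
    have hDd : d / 2 ≤ D := (le_max_right _ _).trans hD
    set B := 0.995 * (D / 2) with hB
    have hB2 : 1.99 ≤ B := by rw [hB]; linarith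
    have hBpos : 0 < B := by linarith
    have hz : 0 < z := (mul_pos hBpos hx).trans_le hxz
    have h1 : (n / z) ^ γ ≤ (n / (B * x)) ^ γ := by gcongr
    have h2 : (n / (B * x)) ^ γ = (n / x) ^ γ * (B ^ γ)⁻¹ := by
      rw [← Real.inv_rpow hBpos.le, ← Real.mul_rpow (by positivity) (by positivity)]
      congr 1
      field_simp
    -- the layers grow at least by the factor `d ^ (1 / 8)`
    have h3 : d ≤ B ^ (8 : ℕ) := by
      have h4 : (1.99 : ℝ) ^ 7 ≤ B ^ 7 := by gcongr
      have h5 : B ^ (8 : ℕ) = B * B ^ 7 := by ring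
      rw [h5]
      have h6 : d * 0.24 ≤ B := by rw [hB]; linarith
      nlinarith
    have h4 : (2 : ℝ) ^ (10 * y) ≤ B ^ γ := by
      have h5 : (2 : ℝ) ^ (10 * y) = d ^ (γ / 8) := by
        rw [show 10 * y = Real.logb 2 d * (γ / 8) by rw [← hyy, hγ]; field_simp; norm_num,
          Real.rpow_mul two_pos.le, Real.rpow_logb two_pos (by norm_num) (by linarith)]
      rw [h5]
      calc d ^ (γ / 8) ≤ (B ^ (8 : ℕ)) ^ (γ / 8) := by gcongr
        _ = B ^ γ := by
          rw [← Real.rpow_natCast, ← Real.rpow_mul hBpos.le]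
          congr 1
          push_cast
          ring
    have h5 : (B ^ γ)⁻¹ ≤ q := by
      rw [hq, Real.rpow_neg two_pos.le]
      gcongr
    rw [h2] at h1
    have h6 : 0 ≤ (n / x) ^ γ := by positivity
    calc 10 * y * (n / z) ^ γ ≤ 10 * y * ((n / x) ^ γ * q) := by gcongr; exact h1.trans (by gcongr)
      _ = q * (10 * y * (n / x) ^ γ) := by ring
  · intro x hx hxn
    have h1 := hbase x hx hxn
    have h2 : (n / (0.995 * x)) ^ γ = (n / x) ^ γ * (0.995 ^ γ)⁻¹ := by
      rw [← Real.inv_rpow (by norm_num), ← Real.mul_rpow (by positivity) (by positivity)]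
      congr 1
      field_simp
    have h3 : 1 + 0.4 / y ≤ ((0.995 : ℝ) ^ γ)⁻¹ := by
      rw [← Real.rpow_neg (by norm_num), Real.rpow_def_of_pos (by norm_num)]
      have h4 := Real.add_one_le_exp (Real.log 0.995 * -γ)
      have h5 := Real.log_le_sub_one_of_pos (show (0 : ℝ) < 0.995 by norm_num)
      have h6 : 0.4 / y = 0.005 * γ := by rw [hγ]; field_simp; norm_num
      rw [h6]
      nlinarith
    have h4 : 2 * q ≤ 0.2 / y := by
      rw [le_div_iff₀ (by positivity)]
      linarith
    rw [h2]
    set Z := (n / x) ^ γ with hZ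
    have h5 : 10 * y * (0.2 / y) = 2 := by field_simp; norm_num
    have h6 : 0.4 / y = 0.2 / y + 0.2 / y := by ring
    have h7 : 10 * y * (Z * (1 + 0.4 / y)) ≤ 10 * y * (Z * (0.995 ^ γ)⁻¹) := by gcongr
    have h8 : 2 * q * (10 * y * Z) ≤ 0.2 / y * (10 * y * Z) := by gcongr
    have h9 : 10 * y * (Z * (1 + 0.4 / y)) = 10 * y * Z + 2 * Z + 0.2 / y * (10 * y * Z) := by
      rw [h6]
      linear_combination Z * h5
    linarith

namespace WordRAM

/-! ### The data computed in every round -/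

-- Registers: the numbers of vertices of the first class, edges and incidences, the bound on the
-- size of edges, the index of the last layer, the guess `E` with `D = E + 4`, and two loop
-- registers.
notation "rNA" => (0 : ℕ)
notation "rME" => (1 : ℕ)
notation "rTot" => (2 : ℕ)
notation "rR" => (3 : ℕ)
notation "rM" => (4 : ℕ)
notation "rE" => (5 : ℕ)
notation "rI" => (6 : ℕ)
notation "rT" => (7 : ℕ)

-- Arrays: input and output; the edge table (`aEA`, `aOff`, `aIB`, `aIE`); the matching `aMT` and
-- the layers `aXL` of candidate edges, with the encoding of `EdgeTable.Inv`. The other arrays hold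
-- data that is recomputed in every round.
notation "aIn" => (0 : ℕ)
notation "aOut" => (1 : ℕ)
notation "aEA" => (2 : ℕ)
notation "aOff" => (3 : ℕ)
notation "aIB" => (4 : ℕ)
notation "aIE" => (5 : ℕ)
notation "aMT" => (6 : ℕ)
notation "aXL" => (7 : ℕ)
notation "aOB" => (8 : ℕ)
notation "aLab" => (9 : ℕ)
notation "aCnt" => (10 : ℕ)
notation "aQ" => (11 : ℕ)
notation "aBL" => (12 : ℕ)
notation "aFB" => (13 : ℕ)
notation "aS" => (14 : ℕ)
notation "aQC" => (15 : ℕ)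
notation "aSel" => (16 : ℕ)
notation "aAT" => (17 : ℕ)
notation "aAP" => (18 : ℕ)
notation "aUN" => (19 : ℕ)
notation "aFlg" => (20 : ℕ)

/-- `for i := 0, …, hi - 1 do if c then a[f] := v`, where the loop register is `rI`. -/
def pass (hi : Expr) (a : ℕ) (c f v : Expr) : Program := scatter rI (.const 0) hi a c f v

/-- `for i := 0, …, hi - 1 do if c then a[f] := a[f] + 1`. -/
def countPass (hi : Expr) (a : ℕ) (c f : Expr) : Program :=
  pass hi a c f (.read a f +ᵉ .const 1)

/-- The loop register. -/
abbrev ix : Expr := .reg rI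

/-- The edge of the incidence with the index in the loop register. -/
abbrev ixEdge : Expr := .read aIE ix

/-- The vertex in the second class of the incidence with the index in the loop register. -/
abbrev ixB : Expr := .read aIB ix

/-- The vertex in the first class of the incidence with the index in the loop register. -/
abbrev ixA : Expr := .read aEA ixEdge

/-- `s'` agrees with `s` except for the loop registers and the arrays in `as`. -/
def Same (as : List ℕ) (s s' : State) : Prop :=
  (∀ x, x ≠ rI → x ≠ rT → s'.reg x = s.reg x) ∧ ∀ a, a ∉ as → s'.arr a = s.arr a

theorem Same.refl (as : List ℕ) (s : State) : Same as s s := ⟨fun _ _ _ => rfl, fun _ _ => rfl⟩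

theorem Same.trans {as bs : List ℕ} {s s' s'' : State} (h : Same as s s') (h' : Same bs s' s'') :
    Same (as ++ bs) s s'' :=
  ⟨fun x h1 h2 => (h'.1 x h1 h2).trans (h.1 x h1 h2), fun a ha => by
    simp only [List.mem_append, not_or] at ha
    exact (h'.2 a ha.2).trans (h.2 a ha.1)⟩

theorem Same.mono {as bs : List ℕ} {s s' : State} (h : Same as s s') (hab : ∀ a ∈ as, a ∈ bs) :
    Same bs s s' :=
  ⟨h.1, fun a ha => h.2 a fun h' => ha (hab a h')⟩

theorem same_of_update {s s' : State} {a x n : ℕ} {g : ℕ → ℕ} (hx : x = rI ∨ x = rT)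
    (h : s'.reg = update s.reg x n ∧ s'.arr = update s.arr a g) : Same [a] s s' := by
  refine ⟨fun y h1 h2 => ?_, fun b hb => ?_⟩
  · rw [h.1, update_of_ne]
    rcases hx with rfl | rfl <;> assumption
  · rw [h.2, update_of_ne]
    simpa using hb

/-- A pass over `i < n`, for a statement about the resulting array only. -/
theorem Reach.of_pass {a : ℕ} {hi c f v : Expr} {s : State} {n N : ℕ}
    (C : ℕ → Prop) (F V : ℕ → ℕ)
    (ok : (scatterOK rI (.const 0) hi a c f v && !v.arrs.contains a) = true)
    (hhi : hi.val s = n) (hn : n ≤ N)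
    (hC : ∀ i, i < n → (c.val (s.setReg rI i) ≠ 0 ↔ C i))
    (hF : ∀ i, i < n → C i → f.val (s.setReg rI i) = F i)
    (hV : ∀ i, i < n → C i → v.val (s.setReg rI i) = V i) :
    Reach (pass hi a c f v) s (100 * (N + 1)) fun s' =>
      Same [a] s s' ∧ s'.arr a = scat C F V 0 (s.arr a) n := by
  refine (Reach.of_scatter (l := 0) (n := n) C F V ok rfl (by simpa using hhi) hn
    (fun i _ h => hC i (by omega)) (fun i _ h => hF i (by omega))
    fun i _ h => hV i (by omega)).mono le_rfl fun s' hs' => ⟨same_of_update (.inl rfl) hs', ?_⟩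
  rw [hs'.2, update_self]

open scoped Classical in
theorem Reach.of_countPass {a : ℕ} {hi c f : Expr} {s : State} {n N : ℕ}
    (C : ℕ → Prop) (F : ℕ → ℕ)
    (ok : scatterOK rI (.const 0) hi a c f (.read a f +ᵉ .const 1) = true)
    (hhi : hi.val s = n) (hn : n ≤ N)
    (hC : ∀ i, i < n → (c.val (s.setReg rI i) ≠ 0 ↔ C i))
    (hF : ∀ i, i < n → C i → f.val (s.setReg rI i) = F i) :
    Reach (countPass hi a c f) s (100 * (N + 1)) fun s' => Same [a] s s' ∧
      ∀ y, s'.arr a y = s.arr a y + ((Finset.range n).filter fun i => C i ∧ F i = y).card := by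
  refine (Reach.of_count (l := 0) (n := n) C F ok rfl (by simpa using hhi) hn
    (fun i _ h => hC i (by omega)) (fun i _ h => hF i (by omega))).mono le_rfl
    fun s' hs' => ⟨same_of_update (.inl rfl) hs', fun y => ?_⟩
  rw [hs'.2, update_self, Finset.range_eq_Ico, zero_add]

/-- The registers and arrays that hold the edge table `G` and the state of the procedure. -/
structure Holds (G : EdgeTable) (mt xl : ℕ → ℕ) (m E : ℕ) (s : State) : Prop where
  nA : s.reg rNA = G.nA
  mE : s.reg rME = G.mE
  tot : s.reg rTot = G.tot
  r : s.reg rR = G.r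
  m : s.reg rM = m
  E : s.reg rE = E
  ea : s.arr aEA = G.ea
  off : s.arr aOff = G.off
  ib : s.arr aIB = G.ib
  ie : s.arr aIE = G.ie
  mt : s.arr aMT = mt
  xl : s.arr aXL = xl

theorem Holds.same {G : EdgeTable} {mt xl : ℕ → ℕ} {m E : ℕ} {s s' : State} {as : List ℕ}
    (h : Holds G mt xl m E s) (hs : Same as s s') (has : as.all (fun a => decide (8 ≤ a)) = true) :
    Holds G mt xl m E s' := by
  have h8 : ∀ a, a < 8 → s'.arr a = s.arr a := fun a ha => hs.2 a fun hmem => by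
    have := List.all_eq_true.1 has a hmem
    simp only [decide_eq_true_eq] at this
    omega
  constructor
  · rw [hs.1 _ (by decide) (by decide), h.nA]
  · rw [hs.1 _ (by decide) (by decide), h.mE]
  · rw [hs.1 _ (by decide) (by decide), h.tot]
  · rw [hs.1 _ (by decide) (by decide), h.r]
  · rw [hs.1 _ (by decide) (by decide), h.m]
  · rw [hs.1 _ (by decide) (by decide), h.E]
  · rw [h8 _ (by decide), h.ea]
  · rw [h8 _ (by decide), h.off]
  · rw [h8 _ (by decide), h.ib]
  · rw [h8 _ (by decide), h.ie]
  · rw [h8 _ (by decide), h.mt]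
  · rw [h8 _ (by decide), h.xl]

/-- Compute the owner `a + 1` of a vertex in the matching edge of `a`. -/
def ownerProg : Program :=
  pass (.reg rTot) aOB (.const 1) ixB (.const 0) ;;
  pass (.reg rTot) aOB (.read aMT ixA =ᵉ (ixEdge +ᵉ .const 1)) ixB (ixA +ᵉ .const 1)

/-- Compute which edges are blocked by a matching edge. -/
def blockProg : Program :=
  pass (.reg rME) aBL (.const 1) ix (.const 0) ;;
  pass (.reg rTot) aBL (.read aOB ixB) ixEdge (.const 1)

/-- Compute the labels. -/
def labelProg : Program :=
  pass (.reg rNA) aLab (.const 1) ix (.read aMT ix =ᵉ .const 0) ;;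
  pass (.reg rTot) aLab (.read aOB ixB *ᵉ .read aXL ixEdge) (.read aOB ixB -ᵉ .const 1)
    (.read aXL ixEdge +ᵉ .const 1)

/-- Mark the vertices in candidate edges and in matching edges of labelled vertices. -/
def forbidProg : Program :=
  pass (.reg rTot) aFB (.const 1) ixB (.const 0) ;;
  pass (.reg rTot) aFB (.read aXL ixEdge) ixB (.const 1) ;;
  pass (.reg rTot) aFB ((.read aMT ixA =ᵉ (ixEdge +ᵉ .const 1)) *ᵉ .read aLab ixA) ixB (.const 1)

/-- Count the candidate edges at each vertex. -/
def countProg : Program :=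
  pass (.reg rNA) aCnt (.const 1) ix (.const 0) ;;
  countPass (.reg rME) aCnt (.read aXL ix) (.read aEA ix)

/-- Find a free candidate edge for each movable vertex. -/
def moveProg : Program :=
  pass (.reg rNA) aQ (.const 1) ix (.const 0) ;;
  pass (.reg rME) aQ (.read aXL ix *ᵉ (.read aBL ix =ᵉ .const 0)) (.read aEA ix) (ix +ᵉ .const 1)

/-- Select a layer in which at least one percent of the vertices are movable. -/
def selectProg : Program :=
  pass (.reg rM) aS (.const 1) ix (.const 0) ;;
  countPass (.reg rNA) aS (.read aLab ix) (.read aLab ix -ᵉ .const 1) ;;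
  pass (.reg rM) aQC (.const 1) ix (.const 0) ;;
  countPass (.reg rNA) aQC (.read aLab ix *ᵉ .read aQ ix) (.read aLab ix -ᵉ .const 1) ;;
  .write aSel (.const 0) (.const 0) ;;
  pass (.reg rM) aSel (.read aS ix <ᵉ (.const 100 *ᵉ .read aQC ix +ᵉ .const 1)) (.const 0)
    (ix +ᵉ .const 1)

/-- Count the vertices in all layers, and those in all layers but the last one. -/
def sumProg : Program :=
  .write aAT (.const 0) (.const 0) ;;
  countPass (.reg rNA) aAT (.read aLab ix) (.const 0) ;;
  .write aAP (.const 0) (.const 0) ;;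
  countPass (.reg rNA) aAP (.read aLab ix *ᵉ (.read aLab ix <ᵉ (.reg rM +ᵉ .const 1))) (.const 0)

section derive

variable {G : EdgeTable} {mt xl lab : ℕ → ℕ} {m D E N : ℕ} {s : State}

/-- The array `g` holds the owners of the vertices in matching edges. -/
def IsOwner (G : EdgeTable) (mt g : ℕ → ℕ) : Prop :=
  ∀ t < G.tot, ∀ a, g (G.ib t) = a + 1 ↔ a < G.nA ∧ ∃ f, mt a = f + 1 ∧ G.ib t ∈ G.Bs f

theorem reach_ownerProg (h : Holds G mt xl m E s) (inv : G.Inv mt xl lab m D) (hN : G.tot ≤ N) :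
    Reach ownerProg s (200 * (N + 1)) fun s' => Same [aOB] s s' ∧ IsOwner G mt (s'.arr aOB) := by
  refine (Reach.seq (Reach.of_pass (N := N) (n := G.tot) (fun _ => True) G.ib (fun _ => 0)
    (by decide) (by simp [Expr.val, h.tot]) hN (by simp [Expr.val])
    (by simp [Expr.val, State.setReg, h.ib]) (by simp [Expr.val])) fun s₁ hs₁ => ?_).mono
    (T := 100 * (N + 1) + 100 * (N + 1)) (by omega) fun _ h => h
  obtain ⟨hs₁, ho₁⟩ := hs₁
  have h₁ := h.same hs₁ (by decide)
  refine (Reach.of_pass (N := N) (n := G.tot)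
    (fun t => mt (G.ea (G.ie t)) = G.ie t + 1) G.ib (fun t => G.ea (G.ie t) + 1)
    (by decide) (by simp [Expr.val, h₁.tot]) hN
    (by simp [Expr.val, BinOp.eval, State.setReg, h₁.ie, h₁.ea, h₁.mt])
    (by simp [Expr.val, State.setReg, h₁.ib])
    (by simp [Expr.val, BinOp.eval, State.setReg, h₁.ie, h₁.ea])).mono le_rfl fun s₂ hs₂ => ?_
  obtain ⟨hs₂, ho₂⟩ := hs₂
  refine ⟨(hs₁.trans hs₂).mono (by simp), fun t ht a => ?_⟩
  have h0 : s₁.arr aOB (G.ib t) = 0 := by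
    rw [ho₁]
    rcases scat_cases (fun _ => True) G.ib (fun _ => 0) 0 (s.arr aOB) G.tot (G.ib t) with
      ⟨-, h'⟩ | ⟨i, -, -, -, -, h'⟩
    · exact (h' t (by omega) (by omega) trivial rfl).elim
    · exact h'
  rw [ho₂]
  rcases scat_cases (fun t => mt (G.ea (G.ie t)) = G.ie t + 1) G.ib
    (fun t => G.ea (G.ie t) + 1) 0 (s₁.arr aOB) G.tot (G.ib t)
    with ⟨h1, h2⟩ | ⟨i, -, hi, h1, h2, h3⟩
  · rw [h1, h0]
    constructor
    · intro h3; omega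
    · rintro ⟨ha, f, hf, hb⟩
      obtain ⟨t', ht', hie, hib⟩ := (G.mem_Bs_iff (inv.mt_lt a ha f hf)).1 hb
      refine (h2 t' (by omega) (by omega) ?_ hib).elim
      rw [hie, inv.mt_ea a ha f hf, hf]
  · rw [h3]
    rw [zero_add] at hi
    have hb : G.ib t ∈ G.Bs (G.ie i) := h2 ▸ G.ib_mem_Bs hi
    have hea := G.ea_lt _ (G.ie_lt i hi)
    constructor
    · intro h4
      obtain rfl : G.ea (G.ie i) = a := by omega
      exact ⟨hea, _, h1, hb⟩
    · rintro ⟨ha, f, hf, hb'⟩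
      by_contra hne
      exact Finset.disjoint_left.1
        (inv.mt_disj _ hea a ha (fun h => hne (by rw [h])) _ f h1 hf) hb hb'

theorem IsOwner.ne_zero_iff {g : ℕ → ℕ} (h : IsOwner G mt g) {t : ℕ} (ht : t < G.tot) :
    g (G.ib t) ≠ 0 ↔ ∃ a < G.nA, ∃ f, mt a = f + 1 ∧ G.ib t ∈ G.Bs f := by
  constructor
  · intro h0
    exact ⟨g (G.ib t) - 1, (h t ht _).1 (by omega)⟩
  · rintro ⟨a, ha⟩
    rw [(h t ht a).2 ha]
    omega

theorem reach_blockProg (h : Holds G mt xl m E s) (ho : IsOwner G mt (s.arr aOB))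
    (hN : G.tot ≤ N) (hN' : G.mE ≤ N) :
    Reach blockProg s (200 * (N + 1)) fun s' => Same [aBL] s s' ∧
      ∀ e < G.mE, s'.arr aBL e = 0 ↔ G.Free mt e := by
  refine (Reach.seq (Reach.of_pass (N := N) (n := G.mE) (fun _ => True) id (fun _ => 0)
    (by decide) (by simp [Expr.val, h.mE]) hN' (by simp [Expr.val])
    (by simp [Expr.val, State.setReg]) (by simp [Expr.val])) fun s₁ hs₁ => ?_).mono
    (T := 100 * (N + 1) + 100 * (N + 1)) (by omega) fun _ h => h
  obtain ⟨hs₁, hb₁⟩ := hs₁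
  have h₁ := h.same hs₁ (by decide)
  rw [← hs₁.2 aOB (by decide)] at ho
  refine (Reach.of_pass (N := N) (n := G.tot)
    (fun t => s₁.arr aOB (G.ib t) ≠ 0) G.ie (fun t => 1)
    (by decide) (by simp [Expr.val, h₁.tot]) hN
    (by simp [Expr.val, State.setReg, h₁.ib])
    (by simp [Expr.val, State.setReg, h₁.ie])
    (by simp [Expr.val])).mono le_rfl fun s₂ hs₂ => ?_
  obtain ⟨hs₂, hb₂⟩ := hs₂
  refine ⟨(hs₁.trans hs₂).mono (by simp), fun e he => ?_⟩
  rw [hb₂]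
  rcases scat_cases (fun t => s₁.arr aOB (G.ib t) ≠ 0) G.ie (fun _ => 1) 0 (s₁.arr aBL) G.tot e
    with ⟨h1, h2⟩ | ⟨i, -, hi, h1, rfl, h3⟩
  · rw [h1, hb₁, scat_id_of_mem he trivial]
    simp only [true_iff]
    intro a ha f hf
    refine Finset.disjoint_left.2 fun b hb hb' => ?_
    obtain ⟨t, ht, hie, rfl⟩ := (G.mem_Bs_iff he).1 hb
    exact h2 t (by omega) (by omega) ((ho.ne_zero_iff ht).2 ⟨a, ha, f, hf, hb'⟩) hie
  · rw [h3]
    simp only [one_ne_zero, false_iff]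
    rw [zero_add] at hi
    obtain ⟨a, ha, f, hf, hb⟩ := (ho.ne_zero_iff hi).1 h1
    exact fun hfree => Finset.disjoint_left.1 (hfree a ha f hf) (G.ib_mem_Bs hi) hb

theorem reach_labelProg (h : Holds G mt xl m E s) (inv : G.Inv mt xl lab m D)
    (ho : IsOwner G mt (s.arr aOB)) (hN : G.tot ≤ N) (hN' : G.nA ≤ N) :
    Reach labelProg s (200 * (N + 1)) fun s' => Same [aLab] s s' ∧
      ∀ a < G.nA, s'.arr aLab a = lab a := by
  refine (Reach.seq (Reach.of_pass (N := N) (n := G.nA) (fun _ => True) id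
    (fun a => if mt a = 0 then 1 else 0)
    (by decide) (by simp [Expr.val, h.nA]) hN' (by simp [Expr.val])
    (by simp [Expr.val, State.setReg]) (by simp [Expr.val, BinOp.eval, State.setReg, h.mt]))
    fun s₁ hs₁ => ?_).mono
    (T := 100 * (N + 1) + 100 * (N + 1)) (by omega) fun _ h => h
  obtain ⟨hs₁, hl₁⟩ := hs₁
  have h₁ := h.same hs₁ (by decide)
  rw [← hs₁.2 aOB (by decide)] at ho
  refine (Reach.of_pass (N := N) (n := G.tot)
    (fun t => s₁.arr aOB (G.ib t) ≠ 0 ∧ xl (G.ie t) ≠ 0) (fun t => s₁.arr aOB (G.ib t) - 1)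
    (fun t => xl (G.ie t) + 1)
    (by decide) (by simp [Expr.val, h₁.tot]) hN
    (by simp [Expr.val, BinOp.eval, State.setReg, h₁.ib, h₁.ie, h₁.xl])
    (by simp [Expr.val, BinOp.eval, State.setReg, h₁.ib])
    (by simp [Expr.val, BinOp.eval, State.setReg, h₁.ie, h₁.xl])).mono le_rfl fun s₂ hs₂ => ?_
  obtain ⟨hs₂, hl₂⟩ := hs₂
  refine ⟨(hs₁.trans hs₂).mono (by simp), fun a ha => ?_⟩
  rw [hl₂]
  rcases scat_cases (fun t => s₁.arr aOB (G.ib t) ≠ 0 ∧ xl (G.ie t) ≠ 0)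
    (fun t => s₁.arr aOB (G.ib t) - 1) (fun t => xl (G.ie t) + 1) 0 (s₁.arr aLab) G.tot a
    with ⟨h1, h2⟩ | ⟨i, -, hi, ⟨h1, h1'⟩, h2, h3⟩
  · rw [h1, hl₁, scat_id_of_mem ha trivial]
    have hl1 := inv.lab_one a ha
    split_ifs with hc
    · exact (hl1.2 hc).symm
    · by_contra hne
      obtain ⟨e, he, hxe, f, hf, hd⟩ := inv.lab_src a ha (by omega)
      obtain ⟨b, hb, hb'⟩ := Finset.not_disjoint_iff.1 hd
      obtain ⟨t, ht, rfl, rfl⟩ := (G.mem_Bs_iff he).1 hb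
      have := (ho t ht a).2 ⟨ha, f, hf, hb'⟩
      refine h2 t (by omega) (by omega) ⟨by omega, hxe⟩ (by omega)
  · rw [h3]
    rw [zero_add] at hi
    obtain ⟨-, f, hf, hb⟩ := (ho i hi a).1 (by omega)
    exact (inv.lab_touch a ha f hf _ (G.ie_lt i hi) h1'
      (Finset.not_disjoint_iff.2 ⟨_, G.ib_mem_Bs hi, hb⟩)).symm

theorem reach_forbidProg (h : Holds G mt xl m E s) (inv : G.Inv mt xl lab m D)
    (hl : ∀ a < G.nA, s.arr aLab a = lab a) (hN : G.tot ≤ N) :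
    Reach forbidProg s (300 * (N + 1)) fun s' => Same [aFB] s s' ∧
      ∀ t < G.tot, s'.arr aFB (G.ib t) ≠ 0 ↔ G.Forb mt xl lab (m + 1) (G.ib t) := by
  refine (Reach.seq (Reach.of_pass (N := N) (n := G.tot) (fun _ => True) G.ib (fun _ => 0)
    (by decide) (by simp [Expr.val, h.tot]) hN (by simp [Expr.val])
    (by simp [Expr.val, State.setReg, h.ib]) (by simp [Expr.val])) fun s₁ hs₁ => ?_).mono
    (T := 100 * (N + 1) + (100 * (N + 1) + 100 * (N + 1))) (by omega) fun _ h => h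
  obtain ⟨hs₁, hf₁⟩ := hs₁
  have h₁ := h.same hs₁ (by decide)
  refine Reach.seq (Reach.of_pass (N := N) (n := G.tot)
    (fun t => xl (G.ie t) ≠ 0) G.ib (fun t => 1)
    (by decide) (by simp [Expr.val, h₁.tot]) hN
    (by simp [Expr.val, State.setReg, h₁.ie, h₁.xl])
    (by simp [Expr.val, State.setReg, h₁.ib])
    (by simp [Expr.val])) fun s₂ hs₂ => ?_
  obtain ⟨hs₂, hf₂⟩ := hs₂
  have h₂ := h₁.same hs₂ (by decide)
  have hl₂ : ∀ t < G.tot, s₂.arr aLab (G.ea (G.ie t)) = lab (G.ea (G.ie t)) := fun t ht => by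
    rw [hs₂.2 aLab (by decide), hs₁.2 aLab (by decide)]
    exact hl _ (G.ea_lt _ (G.ie_lt t ht))
  refine (Reach.of_pass (N := N) (n := G.tot)
    (fun t => mt (G.ea (G.ie t)) = G.ie t + 1 ∧ lab (G.ea (G.ie t)) ≠ 0) G.ib (fun t => 1)
    (by decide) (by simp [Expr.val, h₂.tot]) hN
    (fun t ht => by
      simp [Expr.val, BinOp.eval, State.setReg, h₂.ie, h₂.ea, h₂.mt, hl₂ t ht])
    (by simp [Expr.val, State.setReg, h₂.ib])
    (by simp [Expr.val])).mono le_rfl fun s₃ hs₃ => ?_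
  obtain ⟨hs₃, hf₃⟩ := hs₃
  refine ⟨((hs₁.trans hs₂).trans hs₃).mono (by simp), fun t ht => ?_⟩
  have hx : ∀ e < G.mE, xl e ≤ m + 1 := fun e he => (inv.xl_le e he).trans (by omega)
  rw [hf₃]
  rcases scat_cases (fun t => mt (G.ea (G.ie t)) = G.ie t + 1 ∧ lab (G.ea (G.ie t)) ≠ 0) G.ib
    (fun t => 1) 0 (s₂.arr aFB) G.tot (G.ib t) with ⟨h1, h2⟩ | ⟨i, -, hi, ⟨h1, h1'⟩, h2, h3⟩
  · rw [h1, hf₂]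
    rcases scat_cases (fun t => xl (G.ie t) ≠ 0) G.ib
      (fun t => 1) 0 (s₁.arr aFB) G.tot (G.ib t) with ⟨h3, h4⟩ | ⟨i, -, hi, h3, h4, h5⟩
    · rw [h3, hf₁]
      have h0 : scat (fun _ => True) G.ib (fun _ => 0) 0 (s.arr aFB) G.tot (G.ib t) = 0 := by
        rcases scat_cases (fun _ => True) G.ib (fun _ => 0) 0 (s.arr aFB) G.tot (G.ib t) with
          ⟨-, h'⟩ | ⟨i, -, -, -, -, h'⟩
        · exact (h' t (by omega) (by omega) trivial rfl).elim
        · exact h'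
      rw [h0]
      simp only [ne_eq, not_true_eq_false, false_iff]
      rintro (⟨e, he, hxe, -, hb⟩ | ⟨a, ha, hla, -, f, hf, hb⟩)
      · obtain ⟨t', ht', rfl, hib⟩ := (G.mem_Bs_iff he).1 hb
        exact h4 t' (by omega) (by omega) hxe hib
      · obtain ⟨t', ht', rfl, hib⟩ := (G.mem_Bs_iff (inv.mt_lt a ha f hf)).1 hb
        refine h2 t' (by omega) (by omega) ⟨?_, ?_⟩ hib
        · rw [inv.mt_ea a ha _ hf, hf]
        · rw [inv.mt_ea a ha _ hf]; omega
    · rw [h5]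
      rw [zero_add] at hi
      simp only [ne_eq, one_ne_zero, not_false_eq_true, true_iff]
      exact .inl ⟨_, G.ie_lt i hi, h3, hx _ (G.ie_lt i hi), h4 ▸ G.ib_mem_Bs hi⟩
  · rw [h3]
    rw [zero_add] at hi
    simp only [ne_eq, one_ne_zero, not_false_eq_true, true_iff]
    have hea := G.ea_lt _ (G.ie_lt i hi)
    exact .inr ⟨_, hea, by omega, inv.lab_le hea, _, h1, h2 ▸ G.ib_mem_Bs hi⟩

theorem reach_countProg (h : Holds G mt xl m E s) (inv : G.Inv mt xl lab m D)
    (hN : G.mE ≤ N) (hN' : G.nA ≤ N) :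
    Reach countProg s (200 * (N + 1)) fun s' => Same [aCnt] s s' ∧
      ∀ a < G.nA, s'.arr aCnt a = (G.candAt xl (m + 1) a).card := by
  refine (Reach.seq (Reach.of_pass (N := N) (n := G.nA) (fun _ => True) id (fun _ => 0)
    (by decide) (by simp [Expr.val, h.nA]) hN' (by simp [Expr.val])
    (by simp [Expr.val, State.setReg]) (by simp [Expr.val])) fun s₁ hs₁ => ?_).mono
    (T := 100 * (N + 1) + 100 * (N + 1)) (by omega) fun _ h => h
  obtain ⟨hs₁, hc₁⟩ := hs₁
  have h₁ := h.same hs₁ (by decide)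
  refine (Reach.of_countPass (N := N) (n := G.mE) (fun e => xl e ≠ 0) G.ea
    (by decide) (by simp [Expr.val, h₁.mE]) hN
    (by simp [Expr.val, State.setReg, h₁.xl])
    (by simp [Expr.val, State.setReg, h₁.ea])).mono le_rfl fun s₂ hs₂ => ?_
  obtain ⟨hs₂, hc₂⟩ := hs₂
  refine ⟨(hs₁.trans hs₂).mono (by simp), fun a ha => ?_⟩
  rw [hc₂, hc₁, scat_id_of_mem ha trivial, zero_add]
  congr 1
  ext e
  simp only [EdgeTable.candAt, Finset.mem_filter, Finset.mem_range]
  exact ⟨fun ⟨h1, h2, h3⟩ => ⟨h1, h2, (inv.xl_le e h1).trans (by omega), h3⟩,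
    fun ⟨h1, h2, _, h3⟩ => ⟨h1, h2, h3⟩⟩

/-- The array `q` holds a free candidate edge of each movable vertex. -/
def IsMove (G : EdgeTable) (mt xl q : ℕ → ℕ) : Prop :=
  (∀ a < G.nA, ∀ e, q a = e + 1 → e < G.mE ∧ G.ea e = a ∧ xl e ≠ 0 ∧ G.Free mt e) ∧
    ∀ e < G.mE, xl e ≠ 0 → G.Free mt e → q (G.ea e) ≠ 0

theorem reach_moveProg (h : Holds G mt xl m E s)
    (hb : ∀ e < G.mE, s.arr aBL e = 0 ↔ G.Free mt e) (hN : G.mE ≤ N) (hN' : G.nA ≤ N) :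
    Reach moveProg s (200 * (N + 1)) fun s' => Same [aQ] s s' ∧ IsMove G mt xl (s'.arr aQ) := by
  refine (Reach.seq (Reach.of_pass (N := N) (n := G.nA) (fun _ => True) id (fun _ => 0)
    (by decide) (by simp [Expr.val, h.nA]) hN' (by simp [Expr.val])
    (by simp [Expr.val, State.setReg]) (by simp [Expr.val])) fun s₁ hs₁ => ?_).mono
    (T := 100 * (N + 1) + 100 * (N + 1)) (by omega) fun _ h => h
  obtain ⟨hs₁, hq₁⟩ := hs₁
  have h₁ := h.same hs₁ (by decide)
  rw [← hs₁.2 aBL (by decide)] at hb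
  refine (Reach.of_pass (N := N) (n := G.mE)
    (fun e => xl e ≠ 0 ∧ G.Free mt e) G.ea (fun e => e + 1)
    (by decide) (by simp [Expr.val, h₁.mE]) hN
    (fun e he => by
      simp only [Expr.val, BinOp.eval, State.setReg, update_self, h₁.xl, ← hb e he]
      split_ifs with h0 <;> simp [h0])
    (by simp [Expr.val, State.setReg, h₁.ea])
    (by simp [Expr.val, BinOp.eval, State.setReg])).mono le_rfl fun s₂ hs₂ => ?_
  obtain ⟨hs₂, hq₂⟩ := hs₂
  refine ⟨(hs₁.trans hs₂).mono (by simp), fun a ha e hqe => ?_, fun e he hxe hfe => ?_⟩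
  · rw [hq₂] at hqe
    rcases scat_cases (fun e => xl e ≠ 0 ∧ G.Free mt e) G.ea (fun e => e + 1) 0 (s₁.arr aQ) G.mE a
      with ⟨h1, -⟩ | ⟨i, -, hi, h1, h2, h3⟩
    · rw [h1, hq₁, scat_id_of_mem ha trivial] at hqe
      omega
    · obtain rfl : i = e := by omega
      exact ⟨by omega, h2, h1⟩
  · rw [hq₂]
    rcases scat_cases (fun e => xl e ≠ 0 ∧ G.Free mt e) G.ea (fun e => e + 1) 0 (s₁.arr aQ) G.mE
      (G.ea e) with ⟨-, h1⟩ | ⟨i, -, hi, h1, h2, h3⟩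
    · exact (h1 e (by omega) (by omega) ⟨hxe, hfe⟩ rfl).elim
    · omega

theorem reach_selectProg {q : ℕ → ℕ} (h : Holds G mt xl m E s)
    (hl : ∀ a < G.nA, s.arr aLab a = lab a) (hq : s.arr aQ = q) (hN : G.nA ≤ N) (hN' : m ≤ N) :
    Reach selectProg s (600 * (N + 1)) fun s' => Same [aS, aQC, aSel] s s' ∧
      (s'.arr aSel 0 = 0 → ∀ j < m,
        100 * ((G.layer lab j).filter fun a => q a ≠ 0).card ≤ (G.layer lab j).card) ∧
      ∀ j, s'.arr aSel 0 = j + 1 → j < m ∧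
        (G.layer lab j).card ≤ 100 * ((G.layer lab j).filter fun a => q a ≠ 0).card := by
  refine (Reach.seq (Reach.of_pass (N := N) (n := m) (fun _ => True) id (fun _ => 0)
    (by decide) (by simp [Expr.val, h.m]) hN' (by simp [Expr.val])
    (by simp [Expr.val, State.setReg]) (by simp [Expr.val])) fun s₁ hs₁ => ?_).mono
    (T := 100 * (N + 1) + (100 * (N + 1) + (100 * (N + 1) + (100 * (N + 1) + (3 + 100 * (N + 1))))))
    (by omega) fun _ h => h
  obtain ⟨hs₁, hS₁⟩ := hs₁
  have h₁ := h.same hs₁ (by decide)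
  have hl₁ : ∀ a < G.nA, s₁.arr aLab a = lab a := by rwa [hs₁.2 _ (by decide)]
  refine Reach.seq (Reach.of_countPass (N := N) (n := G.nA) (fun a => lab a ≠ 0)
    (fun a => lab a - 1) (by decide) (by simp [Expr.val, h₁.nA]) hN
    (fun a ha => by simp [Expr.val, State.setReg, hl₁ a ha])
    (fun a ha => by simp [Expr.val, BinOp.eval, State.setReg, hl₁ a ha])) fun s₂ hs₂ => ?_
  obtain ⟨hs₂, hS₂⟩ := hs₂
  have h₂ := h₁.same hs₂ (by decide)
  refine Reach.seq (Reach.of_pass (N := N) (n := m) (fun _ => True) id (fun _ => 0)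
    (by decide) (by simp [Expr.val, h₂.m]) hN' (by simp [Expr.val])
    (by simp [Expr.val, State.setReg]) (by simp [Expr.val])) fun s₃ hs₃ => ?_
  obtain ⟨hs₃, hC₃⟩ := hs₃
  have h₃ := h₂.same hs₃ (by decide)
  have hs03 := (hs₁.trans hs₂).trans hs₃
  have hl₃ : ∀ a < G.nA, s₃.arr aLab a = lab a := by rwa [hs03.2 _ (by decide)]
  have hq₃ : s₃.arr aQ = q := by rwa [hs03.2 _ (by decide)]
  refine Reach.seq (Reach.of_countPass (N := N) (n := G.nA) (fun a => lab a ≠ 0 ∧ q a ≠ 0)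
    (fun a => lab a - 1) (by decide) (by simp [Expr.val, h₃.nA]) hN
    (fun a ha => by simp [Expr.val, BinOp.eval, State.setReg, hl₃ a ha, hq₃])
    (fun a ha => by simp [Expr.val, BinOp.eval, State.setReg, hl₃ a ha])) fun s₄ hs₄ => ?_
  obtain ⟨hs₄, hC₄⟩ := hs₄
  have h₄ := h₃.same hs₄ (by decide)
  refine Reach.seq (Reach.write (Q := fun s' => s' = s₄.setArr aSel 0 0) (by simp [Expr.cost])
    (by simp [Expr.val])) ?_
  rintro s₅ rfl
  have hs₅ : Same [aSel] s₄ (s₄.setArr aSel 0 0) :=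
    ⟨fun _ _ _ => rfl, fun a ha => by simp at ha; simp [State.setArr, update_of_ne ha]⟩
  have h₅ := h₄.same hs₅ (by decide)
  have hS : ∀ j < m, s₄.arr aS j = (G.layer lab j).card := by
    intro j hj
    rw [hs₄.2 _ (by decide), hs₃.2 _ (by decide), hS₂, hS₁, scat_id_of_mem hj trivial, zero_add]
    congr 1
    ext a
    simp only [EdgeTable.layer, Finset.mem_filter, Finset.mem_range]
    constructor <;> intro h' <;> omega
  have hC : ∀ j < m, s₄.arr aQC j = ((G.layer lab j).filter fun a => q a ≠ 0).card := by
    intro j hj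
    rw [hC₄, hC₃, scat_id_of_mem hj trivial, zero_add]
    congr 1
    ext a
    simp only [EdgeTable.layer, Finset.mem_filter, Finset.mem_range]
    constructor <;> intro h' <;> omega
  refine (Reach.of_pass (N := N) (n := m)
    (fun j => (G.layer lab j).card ≤ 100 * ((G.layer lab j).filter fun a => q a ≠ 0).card)
    (fun _ => 0) (fun j => j + 1)
    (by decide) (by simp [Expr.val, h₅.m]) hN'
    (fun j hj => by
      simp [Expr.val, BinOp.eval, State.setReg, State.setArr, hS j hj, hC j hj])
    (by simp [Expr.val])
    (by simp [Expr.val, BinOp.eval, State.setReg])).mono le_rfl fun s₆ hs₆ => ?_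
  obtain ⟨hs₆, hF⟩ := hs₆
  refine ⟨(((hs03.trans hs₄).trans hs₅).trans hs₆).mono (by simp), fun h0 j hj => ?_,
    fun j hj => ?_⟩
  · rw [hF] at h0
    rcases scat_cases (fun j => (G.layer lab j).card
      ≤ 100 * ((G.layer lab j).filter fun a => q a ≠ 0).card) (fun _ => 0) (fun j => j + 1) 0
      ((s₄.setArr aSel 0 0).arr aSel) m 0 with ⟨-, h1⟩ | ⟨i, -, hi, h1, h2, h3⟩
    · exact (not_le.1 fun hle => h1 j (by omega) (by omega) hle rfl).le
    · omega
  · rw [hF] at hj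
    rcases scat_cases (fun j => (G.layer lab j).card
      ≤ 100 * ((G.layer lab j).filter fun a => q a ≠ 0).card) (fun _ => 0) (fun j => j + 1) 0
      ((s₄.setArr aSel 0 0).arr aSel) m 0 with ⟨h1, -⟩ | ⟨i, -, hi, h1, h2, h3⟩
    · rw [h1] at hj
      simp [State.setArr] at hj
    · obtain rfl : i = j := by omega
      exact ⟨by omega, h1⟩

theorem reach_sumProg (h : Holds G mt xl m E s) (inv : G.Inv mt xl lab m D)
    (hl : ∀ a < G.nA, s.arr aLab a = lab a) (hN : G.nA ≤ N) :
    Reach sumProg s (300 * (N + 1)) fun s' => Same [aAT, aAP] s s' ∧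
      s'.arr aAT 0 = (G.upTo lab m).card ∧
      s'.arr aAP 0 = if m = 0 then 0 else (G.upTo lab (m - 1)).card := by
  refine (Reach.seq (Reach.write (Q := fun s' => s' = s.setArr aAT 0 0) (T := 3)
    (by simp [Expr.cost]) (by simp [Expr.val])) ?_).mono
    (T := 3 + (100 * (N + 1) + (3 + 100 * (N + 1)))) (by omega) fun _ h => h
  rintro s₁ rfl
  have hs₁ : Same [aAT] s (s.setArr aAT 0 0) :=
    ⟨fun _ _ _ => rfl, fun a ha => by simp at ha; simp [State.setArr, update_of_ne ha]⟩
  have h₁ := h.same hs₁ (by decide)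
  have hl₁ : ∀ a < G.nA, (s.setArr aAT 0 0).arr aLab a = lab a := by rwa [hs₁.2 _ (by decide)]
  refine Reach.seq (Reach.of_countPass (N := N) (n := G.nA) (fun a => lab a ≠ 0)
    (fun a => 0) (by decide) (by simp [Expr.val, h₁.nA]) hN
    (fun a ha => by
      have := hl₁ a ha
      simp only [Expr.val, State.setReg, update_self]; rw [this])
    (by simp [Expr.val])) fun s₂ hs₂ => ?_
  obtain ⟨hs₂, hT₂⟩ := hs₂
  have h₂ := h₁.same hs₂ (by decide)
  refine Reach.seq (Reach.write (Q := fun s' => s' = s₂.setArr aAP 0 0) (T := 3)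
    (by simp [Expr.cost]) (by simp [Expr.val])) ?_
  rintro s₃ rfl
  have hs₃ : Same [aAP] s₂ (s₂.setArr aAP 0 0) :=
    ⟨fun _ _ _ => rfl, fun a ha => by simp at ha; simp [State.setArr, update_of_ne ha]⟩
  have h₃ := h₂.same hs₃ (by decide)
  have hl₃ : ∀ a < G.nA, (s₂.setArr aAP 0 0).arr aLab a = lab a := by
    rwa [hs₃.2 _ (by decide), hs₂.2 _ (by decide)]
  refine (Reach.of_countPass (N := N) (n := G.nA) (fun a => lab a ≠ 0 ∧ lab a < m + 1)
    (fun a => 0) (by decide) (by simp [Expr.val, h₃.nA]) hN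
    (fun a ha => by
      have := hl₃ a ha
      have hm := h₃.m
      simp only [Expr.val, BinOp.eval, State.setReg, update_self]
      rw [this, update_of_ne (by decide), hm]
      simp [and_comm])
    (by simp [Expr.val])).mono le_rfl fun s₄ hs₄ => ?_
  obtain ⟨hs₄, hP₄⟩ := hs₄
  refine ⟨(((hs₁.trans hs₂).trans hs₃).trans hs₄).mono (by simp), ?_, ?_⟩
  · rw [hs₄.2 _ (by decide), hs₃.2 _ (by decide), hT₂]
    simp only [State.setArr, update_self, zero_add]
    congr 1
    ext a
    simp only [EdgeTable.upTo, Finset.mem_filter, Finset.mem_range]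
    constructor
    · rintro ⟨h1, h2, -⟩
      exact ⟨h1, by omega, inv.lab_le h1⟩
    · rintro ⟨h1, h2, -⟩
      exact ⟨h1, by omega, trivial⟩
  · rw [hP₄]
    simp only [State.setArr, update_self, zero_add]
    split_ifs with hm
    · rw [Finset.card_eq_zero, Finset.filter_eq_empty_iff]
      intro a _
      omega
    · congr 1
      ext a
      simp only [EdgeTable.upTo, Finset.mem_filter, Finset.mem_range, and_true]
      constructor <;> intro h' <;> omega

end derive

end WordRAM

namespace EdgeTable

/-! ### The three kinds of rounds -/

variable {G : EdgeTable} {mt xl lab xl' : ℕ → ℕ} {m k i : ℕ}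

/-- The vertex `b` may not be used by further candidate edges, if `xl'` extends the candidate edges
`xl` by edges of layer `m + 1`. -/
def Used (G : EdgeTable) (mt xl lab : ℕ → ℕ) (m : ℕ) (xl' : ℕ → ℕ) (b : ℕ) : Prop :=
  G.Forb mt xl lab (m + 1) b ∨ ∃ e < G.mE, xl' e = m + 1 ∧ b ∈ G.Bs e

/-- The greedy construction of a new layer of candidate edges after the edges below `i` have been
considered. -/
structure Greedy (G : EdgeTable) (mt xl lab : ℕ → ℕ) (m k i : ℕ) (xl' : ℕ → ℕ) : Prop where
  old_or_new : ∀ e < G.mE, xl' e = xl e ∨ (e < i ∧ xl e = 0 ∧ xl' e = m + 1 ∧ 1 ≤ lab (G.ea e) ∧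
    ∀ b ∈ G.Bs e, ¬ G.Forb mt xl lab (m + 1) b)
  disj : ∀ e < G.mE, ∀ e' < G.mE, e ≠ e' → xl' e = m + 1 → xl' e' = m + 1 →
    Disjoint (G.Bs e) (G.Bs e')
  cap : ∀ a, (G.candAt xl' (m + 1) a).card ≤ k
  maximal : ∀ e < G.mE, e < i → 1 ≤ lab (G.ea e) → (G.candAt xl' (m + 1) (G.ea e)).card < k →
    ∃ b ∈ G.Bs e, G.Used mt xl lab m xl' b

theorem Inv.greedy_zero {D : ℕ} (h : G.Inv mt xl lab m D) :
    G.Greedy mt xl lab m (4 * D * G.r) 0 xl := by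
  refine ⟨fun e _ => .inl rfl, fun e he _ _ _ h1 => ?_, fun a => ?_, fun e _ he => by omega⟩
  · have := h.xl_le e he
    omega
  · rw [candAt_congr (xl' := xl) (j := m) fun e he => by have := h.xl_le e he; omega]
    exact h.cap a

theorem Greedy.skip (h : G.Greedy mt xl lab m k i xl')
    (hi : lab (G.ea i) = 0 ∨ k ≤ (G.candAt xl' (m + 1) (G.ea i)).card ∨
      ∃ b ∈ G.Bs i, G.Used mt xl lab m xl' b) :
    G.Greedy mt xl lab m k (i + 1) xl' := by
  refine ⟨fun e he => ?_, h.disj, h.cap, fun e he hei h1 h2 => ?_⟩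
  · rcases h.old_or_new e he with h1 | ⟨h1, h2⟩
    · exact .inl h1
    · exact .inr ⟨by omega, h2⟩
  · rcases Nat.lt_or_ge e i with h3 | h3
    · exact h.maximal e he h3 h1 h2
    · obtain rfl : e = i := by omega
      rcases hi with hi | hi | hi
      · omega
      · omega
      · exact hi

/-- An edge without used vertices is not a candidate edge; this needs that edges have vertices in
the second class. -/
theorem Greedy.eq_zero (h : G.Greedy mt xl lab m k i xl') (hm : ∀ e < G.mE, xl e ≤ m)
    (hi : i < G.mE) (hu : ∀ b ∈ G.Bs i, ¬ G.Used mt xl lab m xl' b) : xl i = 0 ∧ xl' i = 0 := by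
  have h0 : xl i = 0 := by
    by_contra h0
    obtain ⟨b, hb⟩ := G.Bs_nonempty hi
    exact hu b hb (.inl (.inl ⟨i, hi, h0, (hm i hi).trans (by omega), hb⟩))
  refine ⟨h0, ?_⟩
  rcases h.old_or_new i hi with h1 | ⟨h1, -⟩
  · rw [h1, h0]
  · omega

theorem used_update (hi : i < G.mE) (h0 : xl' i = 0) (b : ℕ) :
    G.Used mt xl lab m (update xl' i (m + 1)) b ↔ G.Used mt xl lab m xl' b ∨ b ∈ G.Bs i := by
  constructor
  · rintro (h | ⟨e, he, h1, h2⟩)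
    · exact .inl (.inl h)
    · rcases eq_or_ne e i with rfl | hne
      · exact .inr h2
      · rw [update_of_ne hne] at h1
        exact .inl (.inr ⟨e, he, h1, h2⟩)
  · rintro ((h | ⟨e, he, h1, h2⟩) | h)
    · exact .inl h
    · have hne : e ≠ i := fun h => by subst h; omega
      exact .inr ⟨e, he, by rw [update_of_ne hne, h1], h2⟩
    · exact .inr ⟨i, hi, by simp, h⟩

theorem card_candAt_update (hi : i < G.mE) (h0 : xl' i = 0) (a : ℕ) :
    (G.candAt (update xl' i (m + 1)) (m + 1) a).card
      = (G.candAt xl' (m + 1) a).card + if G.ea i = a then 1 else 0 := by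
  split_ifs with ha
  · rw [← Finset.card_insert_of_notMem (a := i) (by simp [candAt, h0])]
    congr 1
    ext e
    simp only [candAt, Finset.mem_filter, Finset.mem_range, Finset.mem_insert, update_apply]
    rcases eq_or_ne e i with rfl | hne
    · simp [hi, ha]
    · simp [hne]
  · rw [add_zero]
    congr 1
    ext e
    simp only [candAt, Finset.mem_filter, Finset.mem_range, update_apply]
    rcases eq_or_ne e i with rfl | hne
    · simp [h0, ha]
    · simp [hne]

theorem Greedy.add (h : G.Greedy mt xl lab m k i xl') (hm : ∀ e < G.mE, xl e ≤ m)
    (hi : i < G.mE) (hl : 1 ≤ lab (G.ea i)) (hk : (G.candAt xl' (m + 1) (G.ea i)).card < k)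
    (hu : ∀ b ∈ G.Bs i, ¬ G.Used mt xl lab m xl' b) :
    G.Greedy mt xl lab m k (i + 1) (update xl' i (m + 1)) := by
  obtain ⟨h0, h0'⟩ := h.eq_zero hm hi hu
  have hdis : ∀ e < G.mE, xl' e = m + 1 → Disjoint (G.Bs i) (G.Bs e) := fun e he h1 =>
    Finset.disjoint_left.2 fun b hb hb' => hu b hb (.inr ⟨e, he, h1, hb'⟩)
  refine ⟨fun e he => ?_, fun e he e' he' hne h1 h2 => ?_, fun a => ?_, fun e he hei h1 h2 => ?_⟩
  · rcases eq_or_ne e i with rfl | hne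
    · exact .inr ⟨by omega, h0, by simp, hl, fun b hb hF => hu b hb (.inl hF)⟩
    · rw [update_of_ne hne]
      rcases h.old_or_new e he with h1 | ⟨h1, h2⟩
      · exact .inl h1
      · exact .inr ⟨by omega, h2⟩
  · rcases eq_or_ne e i with hei | hei <;> rcases eq_or_ne e' i with hei' | hei'
    · exact (hne (hei.trans hei'.symm)).elim
    · rw [update_of_ne hei'] at h2
      exact hei ▸ hdis e' he' h2
    · rw [update_of_ne hei] at h1
      exact hei' ▸ (hdis e he h1).symm
    · rw [update_of_ne hei] at h1
      rw [update_of_ne hei'] at h2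
      exact h.disj e he e' he' hne h1 h2
  · rw [card_candAt_update hi h0']
    split_ifs with ha
    · subst ha; omega
    · exact h.cap a
  · rw [card_candAt_update hi h0'] at h2
    rcases Nat.lt_or_ge e i with h3 | h3
    · obtain ⟨b, hb, hub⟩ := h.maximal e he h3 h1 (by omega)
      exact ⟨b, hb, (used_update hi h0' b).2 (.inl hub)⟩
    · obtain rfl : e = i := by omega
      obtain ⟨b, hb⟩ := G.Bs_nonempty he
      exact ⟨b, hb, (used_update hi h0' b).2 (.inr hb)⟩

/-- When all edges have been considered, the new candidate edges form a new layer; its labels are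
determined by the candidate edges. -/
theorem Greedy.inv {D : ℕ} (hg : G.Greedy mt xl lab m (4 * D * G.r) G.mE xl')
    (h : G.Inv mt xl lab m D)
    (hgr : ∀ i, i + 1 = m → D * (G.upTo lab i).card ≤ 2 * (G.upTo lab m).card) :
    ∃ lab', G.Inv mt xl' lab' (m + 1) D ∧ ∀ i ≤ m, G.upTo lab' i = G.upTo lab i := by
  classical
  refine ⟨fun a => if 1 ≤ lab a then lab a else if ∃ f, mt a = f + 1 ∧
      ∃ e < G.mE, xl' e = m + 1 ∧ ¬ Disjoint (G.Bs e) (G.Bs f) then m + 2 else 0,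
    h.build hgr (fun e he => ?_) hg.disj hg.cap (fun e he h1 h2 => hg.maximal e he he h1 h2)
      (fun a _ h1 => if_pos h1) (fun a _ h0 => ?_) fun a _ h0 f hf e he h1 h2 => ?_⟩
  · rcases hg.old_or_new e he with h1 | ⟨-, h1⟩
    · exact .inl h1
    · exact .inr h1
  · rw [if_neg (by omega)]
    split_ifs with hc
    · exact .inr ⟨rfl, hc⟩
    · exact .inl rfl
  · rw [if_neg (by omega), if_pos ⟨f, hf, e, he, h1, h2⟩]

theorem sum_len (G : EdgeTable) : ∑ e ∈ Finset.range G.mE, (G.off (e + 1) - G.off e) = G.tot := by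
  have : ∀ n ≤ G.mE, ∑ e ∈ Finset.range n, (G.off (e + 1) - G.off e) = G.off n := by
    intro n
    induction n with
    | zero => simp [G.off_zero]
    | succ n ih =>
        intro hn
        rw [Finset.sum_range_succ, ih (by omega)]
        have := G.off_lt n (by omega)
        omega
  rw [this _ le_rfl, G.off_mE]

end EdgeTable

namespace WordRAM

notation "aTmp" => (21 : ℕ)

/-- Add the edge in the register `rI` to the candidate edges of layer `rM`, if its vertex in the
first class is labelled and has not too many candidate edges, and none of its other vertices is
marked. -/
def buildBody : Program :=
  .cond (.read aLab (.read aEA ix))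
    (.cond (.read aCnt (.read aEA ix) <ᵉ (.const 4 *ᵉ (.reg rE +ᵉ .const 4) *ᵉ .reg rR))
      (.write aFlg (.const 0) (.const 0) ;;
        scatter rT (.read aOff ix) (.read aOff (ix +ᵉ .const 1)) aFlg
          (.read aFB (.read aIB (.reg rT))) (.const 0) (.const 1) ;;
        .cond (.read aFlg (.const 0)) .skip
          (.write aXL ix (.reg rM) ;;
            .write aCnt (.read aEA ix) (.read aCnt (.read aEA ix) +ᵉ .const 1) ;;
            scatter rT (.read aOff ix) (.read aOff (ix +ᵉ .const 1)) aFB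
              (.const 1) (.read aIB (.reg rT)) (.const 1)))
      .skip)
    .skip

/-- Build a new layer of candidate edges. -/
def buildProg : Program :=
  .assign rM (.reg rM +ᵉ .const 1) ;; forLoop rI (.const 0) (.reg rME) buildBody

/-- Rematch the movable vertices of the selected layer, and give up the layers above it. -/
def collapseProg : Program :=
  pass (.reg rNA) aMT ((.read aLab ix =ᵉ .read aSel (.const 0)) *ᵉ .read aQ ix) ix (.read aQ ix) ;;
  pass (.reg rME) aTmp (.const 1) ix (.read aXL ix) ;;
  pass (.reg rME) aXL ((.read aSel (.const 0) -ᵉ .const 1) <ᵉ .read aTmp ix) ix (.const 0) ;;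
  .assign rM (.read aSel (.const 0) -ᵉ .const 1)

/-- Give up all layers, and halve the guess for the expansion. -/
def resetProg : Program :=
  pass (.reg rME) aXL (.const 1) ix (.const 0) ;;
  .assign rM (.const 0) ;;
  .assign rE (.reg rE /ᵉ .const 2)

section

variable {G : EdgeTable} {mt xl lab : ℕ → ℕ} {m D E N : ℕ} {s : State}

theorem same_setArr (s : State) (a i v : ℕ) : Same [a] s (s.setArr a i v) :=
  ⟨fun _ _ _ => rfl, fun b hb => by simp at hb; simp [State.setArr, update_of_ne hb]⟩

theorem reach_collapseProg {q : ℕ → ℕ} {j : ℕ} (h : Holds G mt xl m E s)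
    (hl : ∀ a < G.nA, s.arr aLab a = lab a) (hq : s.arr aQ = q) (hj : s.arr aSel 0 = j + 1)
    (hN : G.nA ≤ N) (hN' : G.mE ≤ N) :
    Reach collapseProg s (310 * (N + 1)) fun s' => ∃ mt' xl', Holds G mt' xl' j E s' ∧
      (∀ a < G.nA, mt' a = if lab a = j + 1 ∧ q a ≠ 0 then q a else mt a) ∧
      ∀ e < G.mE, xl' e = if xl e ≤ j then xl e else 0 := by
  refine (Reach.seq (Reach.of_pass (N := N) (n := G.nA) (fun a => lab a = j + 1 ∧ q a ≠ 0) id q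
    (by decide) (by simp [Expr.val, h.nA]) hN
    (fun a ha => by simp [Expr.val, BinOp.eval, State.setReg, hl a ha, hj, hq])
    (by simp [Expr.val, State.setReg]) (by simp [Expr.val, State.setReg, hq]))
    fun s₁ hs₁ => ?_).mono
    (T := 100 * (N + 1) + (100 * (N + 1) + (100 * (N + 1) + 5))) (by omega) fun _ h => h
  obtain ⟨hs₁, hm₁⟩ := hs₁
  refine Reach.seq (Reach.of_pass (N := N) (n := G.mE) (fun _ => True) id xl
    (by decide) (by simp [Expr.val, hs₁.1, h.mE]) hN' (by simp [Expr.val])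
    (by simp [Expr.val, State.setReg])
    (by simp [Expr.val, State.setReg, hs₁.2 aXL (by decide), h.xl])) fun s₂ hs₂ => ?_
  obtain ⟨hs₂, ht₂⟩ := hs₂
  have hs12 := hs₁.trans hs₂
  have htmp : ∀ e < G.mE, s₂.arr aTmp e = xl e := fun e he => by
    rw [ht₂, scat_id_of_mem he trivial]
  refine Reach.seq (Reach.of_pass (N := N) (n := G.mE) (fun e => j < xl e) id (fun _ => 0)
    (by decide) (by simp [Expr.val, hs12.1, h.mE]) hN'
    (fun e he => by
      simp [Expr.val, BinOp.eval, State.setReg, htmp e he, hs12.2 aSel (by decide), hj])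
    (by simp [Expr.val, State.setReg]) (by simp [Expr.val])) fun s₃ hs₃ => ?_
  obtain ⟨hs₃, hx₃⟩ := hs₃
  have hs13 := hs12.trans hs₃
  refine Reach.assign (by simp [Expr.cost]) ⟨s₃.arr aMT, s₃.arr aXL, ?_, fun a ha => ?_,
    fun e he => ?_⟩
  · constructor
    · simp [State.setReg, hs13.1, h.nA]
    · simp [State.setReg, hs13.1, h.mE]
    · simp [State.setReg, hs13.1, h.tot]
    · simp [State.setReg, hs13.1, h.r]
    · simp [State.setReg, Expr.val, BinOp.eval, hs13.2 aSel (by decide), hj]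
    · simp [State.setReg, hs13.1, h.E]
    · simp [State.setReg, hs13.2 aEA (by decide), h.ea]
    · simp [State.setReg, hs13.2 aOff (by decide), h.off]
    · simp [State.setReg, hs13.2 aIB (by decide), h.ib]
    · simp [State.setReg, hs13.2 aIE (by decide), h.ie]
    · rfl
    · rfl
  · rw [hs₃.2 _ (by decide), hs₂.2 _ (by decide), hm₁]
    split_ifs with hc
    · rw [scat_id_of_mem ha hc]
    · rw [scat_id_of_notMem (fun h' => hc h'.2), h.mt]
  · rw [hx₃]
    split_ifs with hc
    · rw [scat_id_of_notMem (by omega), hs12.2 _ (by decide), h.xl]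
    · rw [scat_id_of_mem he (by omega)]

theorem reach_resetProg (h : Holds G mt xl m E s) (hN : G.mE ≤ N) :
    Reach resetProg s (110 * (N + 1)) fun s' => ∃ xl', Holds G mt xl' 0 (E / 2) s' ∧
      ∀ e < G.mE, xl' e = 0 := by
  refine (Reach.seq (Reach.of_pass (N := N) (n := G.mE) (fun _ => True) id (fun _ => 0)
    (by decide) (by simp [Expr.val, h.mE]) hN (by simp [Expr.val])
    (by simp [Expr.val, State.setReg]) (by simp [Expr.val])) fun s₁ hs₁ => ?_).mono
    (T := 100 * (N + 1) + (2 + 4)) (by omega) fun _ h => h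
  obtain ⟨hs₁, hx₁⟩ := hs₁
  refine Reach.seq (Reach.assign (Q := fun s' => s' = s₁.setReg rM 0) (by simp [Expr.cost])
    (by simp [Expr.val])) ?_
  rintro s₂ rfl
  refine Reach.assign (by simp [Expr.cost]) ⟨s₁.arr aXL, ?_, fun e he => ?_⟩
  · constructor
    · simp [State.setReg, hs₁.1, h.nA]
    · simp [State.setReg, hs₁.1, h.mE]
    · simp [State.setReg, hs₁.1, h.tot]
    · simp [State.setReg, hs₁.1, h.r]
    · simp [State.setReg]
    · simp [State.setReg, Expr.val, BinOp.eval, hs₁.1, h.E]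
    · simp [State.setReg, hs₁.2 aEA (by decide), h.ea]
    · simp [State.setReg, hs₁.2 aOff (by decide), h.off]
    · simp [State.setReg, hs₁.2 aIB (by decide), h.ib]
    · simp [State.setReg, hs₁.2 aIE (by decide), h.ie]
    · simp [State.setReg, hs₁.2 aMT (by decide), h.mt]
    · rfl
  · rw [hx₁, scat_id_of_mem he trivial]

theorem reach_buildProg (h : Holds G mt xl m E s) (inv : G.Inv mt xl lab m (E + 4))
    (hl : ∀ a < G.nA, s.arr aLab a = lab a)
    (hc : ∀ a < G.nA, s.arr aCnt a = (G.candAt xl (m + 1) a).card)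
    (hf : ∀ t < G.tot, s.arr aFB (G.ib t) ≠ 0 ↔ G.Forb mt xl lab (m + 1) (G.ib t))
    (hN : G.mE ≤ N) (hN' : G.tot ≤ N) :
    Reach buildProg s (1000 * (N + 1)) fun s' => ∃ xl', Holds G mt xl' (m + 1) E s' ∧
      G.Greedy mt xl lab m (4 * (E + 4) * G.r) G.mE xl' := by
  set k := 4 * (E + 4) * G.r with hk
  refine (Reach.seq (T' := 996 * (N + 1)) (Reach.assign
    (Q := fun s' => s' = s.setReg rM (m + 1)) (T := 4) (by simp [Expr.cost])
    (by simp [Expr.val, BinOp.eval, h.m])) ?_).mono (by omega) fun _ h => h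
  rintro s₁ rfl
  set s₁ := s.setReg rM (m + 1) with hs₁
  refine (Reach.of_forLoop (n := G.mE) (l := 0)
    (fun i => 240 + 200 * (G.off (i + 1) - G.off i + 1))
    (fun i s' => Same [aXL, aCnt, aFB, aFlg] s₁ s' ∧ s'.reg rI = i ∧
      G.Greedy mt xl lab m k i (s'.arr aXL) ∧
      (∀ a < G.nA, s'.arr aCnt a = (G.candAt (s'.arr aXL) (m + 1) a).card) ∧
      ∀ t < G.tot, s'.arr aFB (G.ib t) ≠ 0 ↔ G.Used mt xl lab m (s'.arr aXL) (G.ib t))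
    rfl ?_ ?_ ?_ ?_).mono ?_ ?_
  · refine ⟨⟨fun x h1 h2 => by simp [State.setReg, h1], fun a _ => rfl⟩,
      by simp [State.setReg], ?_, ?_, ?_⟩
    · simp only [hs₁, State.setReg, h.xl]
      exact inv.greedy_zero
    · simp only [hs₁, State.setReg, h.xl]
      exact hc
    · simp only [hs₁, State.setReg, h.xl]
      intro t ht
      rw [hf t ht]
      refine ⟨.inl, ?_⟩
      rintro (h' | ⟨e, he, h1, -⟩)
      · exact h'
      · have := inv.xl_le e he
        omega
  · rintro i s' - ⟨hs', -⟩
    simp [Expr.val, hs'.1, hs₁, State.setReg, h.mE]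
  · rintro i s' - ⟨-, hi, -⟩
    rw [hi, zero_add]
  · rintro i s' hi ⟨hs', hri, hgr, hcnt, hfb⟩
    have hea : s'.arr aEA = G.ea := (hs'.2 _ (by decide)).trans h.ea
    have hoff : s'.arr aOff = G.off := (hs'.2 _ (by decide)).trans h.off
    have hib : s'.arr aIB = G.ib := (hs'.2 _ (by decide)).trans h.ib
    have hlab : ∀ a < G.nA, s'.arr aLab a = lab a := by
      rw [hs'.2 _ (by decide)]; exact hl
    have hE : s'.reg rE = E :=
      (hs'.1 _ (by decide) (by decide)).trans (by simp [hs₁, State.setReg, h.E])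
    have hR : s'.reg rR = G.r :=
      (hs'.1 _ (by decide) (by decide)).trans (by simp [hs₁, State.setReg, h.r])
    have hM : s'.reg rM = m + 1 :=
      (hs'.1 _ (by decide) (by decide)).trans (by simp [hs₁, State.setReg])
    have heai := G.ea_lt i hi
    have hoffi := G.off_lt i hi
    have hlen : G.off (i + 1) = G.off i + (G.off (i + 1) - G.off i) := by omega
    set n := G.off (i + 1) - G.off i with hn
    have inext : ∀ s'' : State, Same [aXL, aCnt, aFB, aFlg] s₁ s'' → s''.reg rI = i →
        Same [aXL, aCnt, aFB, aFlg] s₁ (s''.setReg rI (s''.reg rI + 1)) ∧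
        (s''.setReg rI (s''.reg rI + 1)).reg rI = i + 1 := by
      intro s'' h1 h2
      refine ⟨⟨fun x hx hx' => ?_, h1.2⟩, by simp [State.setReg, h2]⟩
      simp [State.setReg, update_of_ne hx, h1.1 x hx hx']
    have hskip : (lab (G.ea i) = 0 ∨ k ≤ (G.candAt (s'.arr aXL) (m + 1) (G.ea i)).card ∨
        ∃ b ∈ G.Bs i, G.Used mt xl lab m (s'.arr aXL) b) → ∀ s'' : State,
        Same [aFlg] s' s'' → s''.reg rI = i →
        Same [aXL, aCnt, aFB, aFlg] s₁ (s''.setReg rI (s''.reg rI + 1)) ∧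
        (s''.setReg rI (s''.reg rI + 1)).reg rI = i + 1 ∧
        G.Greedy mt xl lab m k (i + 1) (s''.arr aXL) ∧
        (∀ a < G.nA, s''.arr aCnt a = (G.candAt (s''.arr aXL) (m + 1) a).card) ∧
        ∀ t < G.tot, s''.arr aFB (G.ib t) ≠ 0 ↔ G.Used mt xl lab m (s''.arr aXL) (G.ib t) := by
      intro hor s'' h1 h2
      obtain ⟨h3, h4⟩ := inext s'' ((hs'.trans h1).mono (by simp)) h2
      refine ⟨h3, h4, ?_⟩
      rw [h1.2 _ (by decide), h1.2 aCnt (by decide), h1.2 aFB (by decide)]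
      exact ⟨hgr.skip hor, hcnt, hfb⟩
    refine (Reach.cond (T := 15 + (3 + (100 * (n + 1) + (3 + (5 + (10 + 100 * (n + 1)))))))
      (fun hL => ?_) fun hL => ?_).mono (by simp only [Expr.cost]; omega) fun _ h => h
    · simp only [Expr.val, hri, hea, hlab _ heai] at hL
      refine (Reach.cond (T := 3 + (100 * (n + 1) + (3 + (5 + (10 + 100 * (n + 1))))))
        (fun hK => ?_) fun hK => ?_).mono (by simp only [Expr.cost]; omega) fun _ h => h
      · have hK' : (G.candAt (s'.arr aXL) (m + 1) (G.ea i)).card < k := by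
          simp only [Expr.val, BinOp.eval, hri, hea, hcnt _ heai, hE, hR] at hK
          by_contra hge
          rw [if_neg (by omega)] at hK
          exact hK rfl
        refine Reach.seq (Reach.write (Q := fun t => t = s'.setArr aFlg 0 0)
          (by simp [Expr.cost]) (by simp [Expr.val])) ?_
        rintro s₂ rfl
        have hs₂ := same_setArr s' aFlg 0 0
        refine Reach.seq (Reach.of_scatter (l := G.off i) (n := n) (N := n)
          (fun t => s'.arr aFB (G.ib t) ≠ 0) (fun _ => 0) (fun _ => 1) (by decide)
          (by simp [Expr.val, State.setArr, hoff, hri])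
          (by simp [Expr.val, BinOp.eval, State.setArr, hoff, hri, ← hlen]) le_rfl
          (by simp [Expr.val, State.setArr, State.setReg, hib])
          (by simp [Expr.val]) (by simp [Expr.val])) ?_
        intro s₃ hs₃'
        have hs₃ := hs₂.trans (same_of_update (.inr rfl) hs₃')
        have hs₃I : s₃.reg rI = i := by rw [hs₃'.1]; simp [State.setArr, hri]
        have hflag : s₃.arr aFlg 0 ≠ 0 ↔ ∃ b ∈ G.Bs i, G.Used mt xl lab m (s'.arr aXL) b := by
          rw [hs₃'.2, update_self]
          rcases scat_cases (fun t => s'.arr aFB (G.ib t) ≠ 0) (fun _ => 0) (fun _ => 1)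
            (G.off i) ((s'.setArr aFlg 0 0).arr aFlg) n 0 with ⟨h1, h2⟩ | ⟨t, ht, ht', h1, -, h2⟩
          · rw [h1]
            simp only [State.setArr, update_self, ne_eq, not_true_eq_false, false_iff]
            rintro ⟨b, hb, hu⟩
            obtain ⟨t, ht, ht', rfl⟩ := G.mem_Bs.1 hb
            exact h2 t ht (by omega)
              ((hfb t (ht'.trans_le (G.off_le i hi))).2 hu) rfl
          · rw [h2]
            simp only [ne_eq, one_ne_zero, not_false_eq_true, true_iff]
            exact ⟨_, G.mem_Bs.2 ⟨t, ht, by omega, rfl⟩,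
              (hfb t (by have := G.off_le i hi; omega)).1 h1⟩
        refine Reach.mono (T := 3 + (5 + (10 + 100 * (n + 1)))) (Reach.cond (fun hF => ?_)
          fun hF => ?_) le_rfl fun _ h => h
        · refine Reach.skip (by omega) ?_
          exact hskip (.inr (.inr (hflag.1 hF))) s₃ (hs₃.mono (by simp)) hs₃I
        · have hu : ∀ b ∈ G.Bs i, ¬ G.Used mt xl lab m (s'.arr aXL) b := fun b hb hu =>
            hflag.2 ⟨b, hb, hu⟩ hF
          obtain ⟨-, hx0⟩ := hgr.eq_zero inv.xl_le hi hu
          have hs₃x : s₃.arr aXL = s'.arr aXL := hs₃.2 _ (by decide)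
          have hs₃c : s₃.arr aCnt = s'.arr aCnt := hs₃.2 _ (by decide)
          have hs₃f : s₃.arr aFB = s'.arr aFB := hs₃.2 _ (by decide)
          have hs₃e : s₃.arr aEA = G.ea := (hs₃.2 _ (by decide)).trans hea
          have hs₃o : s₃.arr aOff = G.off := (hs₃.2 _ (by decide)).trans hoff
          have hs₃b : s₃.arr aIB = G.ib := (hs₃.2 _ (by decide)).trans hib
          have hs₃M : s₃.reg rM = m + 1 := (hs₃.1 _ (by decide) (by decide)).trans hM
          refine Reach.seq (Reach.write (Q := fun t => t = s₃.setArr aXL i (m + 1))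
            (by simp [Expr.cost]) (by simp [Expr.val, hs₃I, hs₃M])) ?_
          rintro s₄ rfl
          have hs₄ := hs₃.trans (same_setArr s₃ aXL i (m + 1))
          refine Reach.seq (Reach.write (Q := fun t => t = (s₃.setArr aXL i (m + 1)).setArr aCnt
            (G.ea i) (s'.arr aCnt (G.ea i) + 1)) (by simp [Expr.cost])
            (by simp [Expr.val, BinOp.eval, State.setArr, hs₃I, hs₃e, hs₃c])) ?_
          rintro s₅ rfl
          have hs₅ := hs₄.trans (same_setArr (s₃.setArr aXL i (m + 1)) aCnt (G.ea i)
            (s'.arr aCnt (G.ea i) + 1))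
          refine (Reach.of_scatter (l := G.off i) (n := n) (N := n)
            (fun _ => True) G.ib (fun _ => 1) (by decide)
            (by simp [Expr.val, State.setArr, hs₃o, hs₃I])
            (by simp [Expr.val, BinOp.eval, State.setArr, hs₃o, hs₃I, ← hlen]) le_rfl
            (by simp [Expr.val])
            (by simp [Expr.val, State.setArr, State.setReg, hs₃b])
            (by simp [Expr.val])).mono le_rfl ?_
          intro s₆ hs₆'
          have hs₆ := hs₅.trans (same_of_update (.inr rfl) hs₆')
          have hs₆I : s₆.reg rI = i := by rw [hs₆'.1]; simp [State.setArr, hs₃I]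
          obtain ⟨h3, h4⟩ := inext s₆ ((hs'.trans hs₆).mono (by simp)) hs₆I
          have hX : s₆.arr aXL = update (s'.arr aXL) i (m + 1) := by
            rw [hs₆'.2]; simp [State.setArr, hs₃x]
          have hC : s₆.arr aCnt = update (s'.arr aCnt) (G.ea i) (s'.arr aCnt (G.ea i) + 1) := by
            rw [hs₆'.2]; simp [State.setArr, hs₃c]
          have hF' : s₆.arr aFB = scat (fun _ => True) G.ib (fun _ => 1) (G.off i)
              (s'.arr aFB) n := by
            rw [hs₆'.2]; simp [State.setArr, hs₃f]
          refine ⟨h3, h4, ?_⟩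
          simp only [State.setReg]
          rw [hX, hC, hF']
          refine ⟨hgr.add inv.xl_le hi (by omega) hK' hu, fun a ha => ?_, fun t ht => ?_⟩
          · rw [EdgeTable.card_candAt_update hi hx0, update_apply]
            split_ifs with h5 h6 h6
            · rw [h5, hcnt _ heai]
            · exact (h6 h5.symm).elim
            · exact (h5 h6.symm).elim
            · rw [hcnt a ha, add_zero]
          · rw [EdgeTable.used_update hi hx0]
            rcases scat_cases (fun _ => True) G.ib (fun _ => 1) (G.off i) (s'.arr aFB) n (G.ib t)
              with ⟨h1, h2⟩ | ⟨t', ht1, ht2, -, h1, h2⟩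
            · rw [h1, hfb t ht]
              refine ⟨.inl, ?_⟩
              rintro (h5 | h5)
              · exact h5
              · obtain ⟨t', ht1, ht2, h6⟩ := G.mem_Bs.1 h5
                exact (h2 t' ht1 (by omega) trivial h6).elim
            · rw [h2]
              simp only [ne_eq, one_ne_zero, not_false_eq_true, true_iff]
              exact .inr (G.mem_Bs.2 ⟨t', ht1, by omega, h1⟩)
      · refine Reach.skip (by omega) (hskip (.inr (.inl ?_)) s' (Same.refl _ _) hri)
        simp only [Expr.val, BinOp.eval, hri, hea, hcnt _ heai, hE, hR] at hK
        by_contra hlt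
        rw [if_pos (by omega)] at hK
        exact one_ne_zero hK
    · simp only [Expr.val, hri, hea, hlab _ heai] at hL
      exact Reach.skip (by omega) (hskip (.inl hL) s' (Same.refl _ _) hri)
  · have hsum := G.sum_len
    simp only [Expr.cost]
    rw [Finset.sum_add_distrib, Finset.sum_add_distrib, Finset.sum_add_distrib, ← Finset.mul_sum,
      Finset.sum_add_distrib, hsum]
    simp only [Finset.sum_const, Finset.card_range, smul_eq_mul]
    omega
  · rintro s' ⟨hs', -, hgr, -⟩
    refine ⟨s'.arr aXL, ?_, hgr⟩
    constructor
    · simp [hs'.1, hs₁, State.setReg, h.nA]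
    · simp [hs'.1, hs₁, State.setReg, h.mE]
    · simp [hs'.1, hs₁, State.setReg, h.tot]
    · simp [hs'.1, hs₁, State.setReg, h.r]
    · simp [hs'.1, hs₁, State.setReg]
    · simp [hs'.1, hs₁, State.setReg, h.E]
    · simp [hs'.2 aEA (by decide), hs₁, State.setReg, h.ea]
    · simp [hs'.2 aOff (by decide), hs₁, State.setReg, h.off]
    · simp [hs'.2 aIB (by decide), hs₁, State.setReg, h.ib]
    · simp [hs'.2 aIE (by decide), hs₁, State.setReg, h.ie]
    · simp [hs'.2 aMT (by decide), hs₁, State.setReg, h.mt]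
    · rfl

end

end WordRAM

namespace EdgeTable

/-! ### The main loop -/

variable {G : EdgeTable} {mt xl lab : ℕ → ℕ} {m D : ℕ}

/-- The size of the union of the layers `0, …, i`. -/
def sizes (G : EdgeTable) (lab : ℕ → ℕ) (i : ℕ) : ℕ := (G.upTo lab i).card

theorem Inv.one_le_sizes (h : G.Inv mt xl lab m D) (hu : ∃ a < G.nA, mt a = 0) (i : ℕ) :
    1 ≤ G.sizes lab i := by
  obtain ⟨a, ha, h0⟩ := hu
  have := (h.lab_one a ha).2 h0
  refine Finset.card_pos.2 ⟨a, ?_⟩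
  simp only [upTo, Finset.mem_filter, Finset.mem_range]
  exact ⟨ha, by omega, by omega⟩

theorem sizes_le (G : EdgeTable) (lab : ℕ → ℕ) (i : ℕ) : G.sizes lab i ≤ G.nA :=
  (Finset.card_filter_le _ _).trans (Finset.card_range _).le

/-- The number of layers is bounded, since they grow. -/
theorem Inv.le_nA (h : G.Inv mt xl lab m D) (hD : 4 ≤ D) (hu : ∃ a < G.nA, mt a = 0) :
    m ≤ G.nA := by
  have key : ∀ i, i < m → i + 1 ≤ G.sizes lab i := by
    intro i
    induction i with
    | zero => exact fun _ => h.one_le_sizes hu 0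
    | succ i ih =>
        intro hi
        have h1 := ih (by omega)
        have h2 : D * G.sizes lab i ≤ 2 * G.sizes lab (i + 1) := h.growth i hi
        have h3 := Nat.mul_le_mul_right (G.sizes lab i) hD
        omega
  rcases Nat.eq_zero_or_pos m with rfl | hm
  · omega
  · have h1 := key (m - 1) (by omega)
    have h2 := G.sizes_le lab (m - 1)
    omega

theorem card_layer_zero (lab : ℕ → ℕ) : (G.layer lab 0).card = G.sizes lab 0 := by
  refine congrArg _ ?_
  ext a
  simp only [layer, upTo, Finset.mem_filter, Finset.mem_range]
  constructor <;> intro h <;> omega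

theorem card_layer_succ (lab : ℕ → ℕ) (j : ℕ) :
    (G.layer lab (j + 1)).card + G.sizes lab j = G.sizes lab (j + 1) := by
  rw [sizes, sizes, ← Finset.card_union_of_disjoint]
  · congr 1
    ext a
    simp only [layer, upTo, Finset.mem_union, Finset.mem_filter, Finset.mem_range]
    constructor <;> intro h <;> omega
  · rw [Finset.disjoint_left]
    intro a h1 h2
    simp only [layer, upTo, Finset.mem_filter, Finset.mem_range] at h1 h2
    omega

/-- A collapse decreases the size of the layers up to the collapsed one by half a percent. -/
theorem Inv.sizes_collapse_le (h : G.Inv mt xl lab m D) (hD : 4 ≤ D) {q : ℕ → ℕ} {j : ℕ}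
    (hj : j < m)
    (hsel : (G.layer lab j).card ≤ 100 * ((G.layer lab j).filter fun a => q a ≠ 0).card) :
    (G.sizes (fun a => if lab a ≤ j ∨ (lab a = j + 1 ∧ q a = 0) then lab a else 0) j : ℝ)
      ≤ 0.995 * G.sizes lab j := by
  have h1 := card_upTo_collapse (G := G) lab q j
  have h2 : G.sizes lab j ≤ 2 * (G.layer lab j).card := by
    rcases Nat.eq_zero_or_pos j with rfl | hj0
    · rw [card_layer_zero]; omega
    · obtain ⟨i, rfl⟩ : ∃ i, j = i + 1 := ⟨j - 1, by omega⟩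
      have h3 := card_layer_succ (G := G) lab i
      have h4 : D * G.sizes lab i ≤ 2 * G.sizes lab (i + 1) := h.growth i hj
      have h5 := Nat.mul_le_mul_right (G.sizes lab i) hD
      omega
  have h3 : 200 * G.sizes (fun a => if lab a ≤ j ∨ (lab a = j + 1 ∧ q a = 0) then lab a else 0) j
      ≤ 199 * G.sizes lab j := by
    simp only [sizes] at h1 h2 ⊢
    omega
  have h4 : (200 : ℝ) * G.sizes (fun a => if lab a ≤ j ∨ (lab a = j + 1 ∧ q a = 0) then lab a
      else 0) j ≤ 199 * G.sizes lab j := by exact_mod_cast h3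
  linarith

theorem Haxell.mono {D D' : ℝ} (h : G.Haxell D) (hD : D' ≤ D) : G.Haxell D' :=
  fun U T h1 h2 => (by gcongr : D' * (G.r : ℝ) ^ 2 * U.card ≤ D * G.r ^ 2 * U.card).trans
    (h U T h1 h2)

end EdgeTable

namespace WordRAM

/-- Compute everything that a round needs to know about the state. -/
def deriveProg : Program :=
  ownerProg ;; blockProg ;; labelProg ;; forbidProg ;; countProg ;; moveProg ;; selectProg ;;
    sumProg

/-- Record whether there are unmatched vertices. -/
def markProg : Program :=
  .write aUN (.const 0) (.const 0) ;;
  pass (.reg rNA) aUN (.read aMT ix =ᵉ .const 0) (.const 0) (.const 1)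

/-- One round of the procedure. -/
def roundProg : Program :=
  deriveProg ;;
  .cond (.read aSel (.const 0)) collapseProg
    (.cond (.read aAT (.const 0) *ᵉ .const 2 <ᵉ (.reg rE +ᵉ .const 4) *ᵉ .read aAP (.const 0))
      resetProg buildProg) ;;
  markProg

/-- Rounds are made as long as there are unmatched vertices. -/
def mainProg : Program := .loop (.read aUN (.const 0)) roundProg

section

variable {G : EdgeTable} {mt xl lab : ℕ → ℕ} {m D E N : ℕ} {s : State}

/-- The data computed by `deriveProg`. -/
structure Derived (G : EdgeTable) (mt xl lab : ℕ → ℕ) (m : ℕ) (q : ℕ → ℕ) (s : State) :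
    Prop where
  label : ∀ a < G.nA, s.arr aLab a = lab a
  forb : ∀ t < G.tot, s.arr aFB (G.ib t) ≠ 0 ↔ G.Forb mt xl lab (m + 1) (G.ib t)
  cnt : ∀ a < G.nA, s.arr aCnt a = (G.candAt xl (m + 1) a).card
  move_eq : s.arr aQ = q
  move : IsMove G mt xl q
  sel_zero : s.arr aSel 0 = 0 → ∀ j < m,
    100 * ((G.layer lab j).filter fun a => q a ≠ 0).card ≤ (G.layer lab j).card
  sel : ∀ j, s.arr aSel 0 = j + 1 → j < m ∧
    (G.layer lab j).card ≤ 100 * ((G.layer lab j).filter fun a => q a ≠ 0).card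
  total : s.arr aAT 0 = G.sizes lab m
  prev : s.arr aAP 0 = if m = 0 then 0 else G.sizes lab (m - 1)

theorem reach_deriveProg (h : Holds G mt xl m E s) (inv : G.Inv mt xl lab m D)
    (hA : G.nA ≤ N) (hM : G.mE ≤ N) (hT : G.tot ≤ N) (hm : m ≤ N) :
    Reach deriveProg s (2200 * (N + 1)) fun s' => Holds G mt xl m E s' ∧
      ∃ q, Derived G mt xl lab m q s' := by
  refine (Reach.seq (reach_ownerProg h inv hT) fun s₁ ⟨hs₁, o₁⟩ => ?_).mono
    (T := 200 * (N + 1) + (200 * (N + 1) + (200 * (N + 1) + (300 * (N + 1) + (200 * (N + 1) +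
      (200 * (N + 1) + (600 * (N + 1) + 300 * (N + 1)))))))) (by omega) fun _ h => h
  have h₁ := h.same hs₁ (by decide)
  refine Reach.seq (reach_blockProg h₁ o₁ hT hM) fun s₂ ⟨hs₂, b₂⟩ => ?_
  have h₂ := h₁.same hs₂ (by decide)
  have o₂ : IsOwner G mt (s₂.arr aOB) := by rwa [hs₂.2 _ (by decide)]
  refine Reach.seq (reach_labelProg h₂ inv o₂ hT hA) fun s₃ ⟨hs₃, l₃⟩ => ?_
  have h₃ := h₂.same hs₃ (by decide)
  refine Reach.seq (reach_forbidProg h₃ inv l₃ hT) fun s₄ ⟨hs₄, f₄⟩ => ?_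
  have h₄ := h₃.same hs₄ (by decide)
  refine Reach.seq (reach_countProg h₄ inv hM hA) fun s₅ ⟨hs₅, c₅⟩ => ?_
  have h₅ := h₄.same hs₅ (by decide)
  have b₅ : ∀ e < G.mE, s₅.arr aBL e = 0 ↔ G.Free mt e := by
    rwa [hs₅.2 _ (by decide), hs₄.2 _ (by decide), hs₃.2 _ (by decide)]
  refine Reach.seq (reach_moveProg h₅ b₅ hM hA) fun s₆ ⟨hs₆, q₆⟩ => ?_
  have h₆ := h₅.same hs₆ (by decide)
  have l₆ : ∀ a < G.nA, s₆.arr aLab a = lab a := by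
    rwa [hs₆.2 _ (by decide), hs₅.2 _ (by decide), hs₄.2 _ (by decide)]
  refine Reach.seq (reach_selectProg h₆ l₆ rfl hA hm) fun s₇ ⟨hs₇, z₇, e₇⟩ => ?_
  have h₇ := h₆.same hs₇ (by decide)
  have l₇ : ∀ a < G.nA, s₇.arr aLab a = lab a := by rwa [hs₇.2 _ (by decide)]
  refine (reach_sumProg h₇ inv l₇ hA).mono le_rfl fun s₈ ⟨hs₈, t₈, p₈⟩ => ?_
  refine ⟨h₇.same hs₈ (by decide), s₆.arr aQ, ?_⟩
  constructor
  · rwa [hs₈.2 _ (by decide)]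
  · rwa [hs₈.2 _ (by decide), hs₇.2 _ (by decide), hs₆.2 _ (by decide), hs₅.2 _ (by decide)]
  · rwa [hs₈.2 _ (by decide), hs₇.2 _ (by decide), hs₆.2 _ (by decide)]
  · rw [hs₈.2 _ (by decide), hs₇.2 _ (by decide)]
  · exact q₆
  · rwa [hs₈.2 _ (by decide)]
  · rwa [hs₈.2 _ (by decide)]
  · exact t₈
  · exact p₈

/-- The invariant of the main loop. The real number `v` bounds the number of rounds that are left:
a round either increases the layer potential, which is at most `R`, or decreases the number of bits
of `E`, and the potential drops by less than `R` in the second case. It is `0` when all vertices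
are matched. -/
def LoopInv (G : EdgeTable) (H : ℝ → ℝ) (δ R v : ℝ) (s : State) : Prop :=
  ∃ mt xl lab m E, Holds G mt xl m E s ∧ G.Inv mt xl lab m (E + 4) ∧ δ ≤ ((E + 4 : ℕ) : ℝ) ∧
    ((s.arr aUN 0 = 0 ∧ (∀ a < G.nA, mt a ≠ 0) ∧ v = 0) ∨
      (s.arr aUN 0 ≠ 0 ∧ (∃ a < G.nA, mt a = 0) ∧
        v = R + 1 - layerPotential H (G.sizes lab) m (E + 4) + Nat.size E * R))

theorem reach_markProg {H : ℝ → ℝ} {δ R v : ℝ} (h : Holds G mt xl m E s)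
    (inv : G.Inv mt xl lab m (E + 4)) (hδ : δ ≤ ((E + 4 : ℕ) : ℝ)) (hv : 0 ≤ v)
    (hv' : (∃ a < G.nA, mt a = 0) →
      R + 1 - layerPotential H (G.sizes lab) m (E + 4) + Nat.size E * R ≤ v) (hA : G.nA ≤ N) :
    Reach markProg s (103 * (N + 1)) fun s' => ∃ v' ≤ v, LoopInv G H δ R v' s' := by
  refine (Reach.seq (Reach.write (Q := fun s' => s' = s.setArr aUN 0 0) (T := 3)
    (by simp [Expr.cost]) (by simp [Expr.val])) ?_).mono
    (T := 3 + 100 * (N + 1)) (by omega) fun _ h => h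
  rintro s₁ rfl
  have hs₁ := same_setArr s aUN 0 0
  have h₁ := h.same hs₁ (by decide)
  refine (Reach.of_pass (N := N) (n := G.nA) (fun a => mt a = 0) (fun _ => 0) (fun _ => 1)
    (by decide) (by simp [Expr.val, h₁.nA]) hA
    (fun a ha => by simp [Expr.val, BinOp.eval, State.setReg, h₁.mt])
    (by simp [Expr.val]) (by simp [Expr.val])).mono le_rfl fun s₂ hs₂ => ?_
  obtain ⟨hs₂, hu⟩ := hs₂
  have h₂ := h₁.same hs₂ (by decide)
  rcases scat_cases (fun a => mt a = 0) (fun _ => 0) (fun _ => 1) 0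
    ((s.setArr aUN 0 0).arr aUN) G.nA 0 with ⟨h1, h2⟩ | ⟨a, -, ha, h1, -, h2⟩
  · refine ⟨0, hv, mt, xl, lab, m, E, h₂, inv, hδ, .inl ⟨?_, fun a ha h0 => ?_, rfl⟩⟩
    · rw [hu, h1]
      simp [State.setArr]
    · exact h2 a (by omega) (by omega) h0 rfl
  · have hex : ∃ a < G.nA, mt a = 0 := ⟨a, by omega, h1⟩
    exact ⟨_, hv' hex, mt, xl, lab, m, E, h₂, inv, hδ, .inr ⟨by rw [hu, h2]; omega, hex, rfl⟩⟩

/-- Every round decreases the bound on the number of the remaining rounds. -/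
theorem reach_roundProg {H : ℝ → ℝ} {d q v : ℝ} (hr : 1 ≤ G.r) (hd : 4 ≤ d) (hH : G.Haxell d)
    (hw : IsLayerWeight H G.nA (max 4 (d / 2)) q)
    (hN : G.nA ≤ N) (hN' : G.mE ≤ N) (hN'' : G.tot ≤ N)
    (hI : LoopInv G H (max 4 (d / 2)) (1 + 2 * H 1) v s) (hu : s.arr aUN 0 ≠ 0) :
    Reach roundProg s (4000 * (N + 1)) fun s' =>
      ∃ v' ≤ v - 1, LoopInv G H (max 4 (d / 2)) (1 + 2 * H 1) v' s' := by
  set R := 1 + 2 * H 1 with hR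
  obtain ⟨mt, xl, lab, m, E, h, inv, hδ, hcase⟩ := hI
  obtain ⟨hex, rfl⟩ : (∃ a < G.nA, mt a = 0) ∧
      v = R + 1 - layerPotential H (G.sizes lab) m (E + 4) + Nat.size E * R := by
    rcases hcase with ⟨h0, -⟩ | ⟨-, h1, h2⟩
    · exact (hu h0).elim
    · exact ⟨h1, h2⟩
  have hpos := inv.one_le_sizes hex
  have hle : ∀ i, (G.sizes lab i : ℝ) ≤ G.nA := fun i => by exact_mod_cast G.sizes_le lab i
  have hpot : layerPotential H (G.sizes lab) m (E + 4) ≤ R :=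
    hw.potential_le hδ hpos inv.growth
  have hR1 : 1 ≤ R := (hw.one_le_potential m (E + 4) hpos).trans hpot
  have hER : 0 ≤ (Nat.size E : ℝ) * R := by positivity
  have hmN : m ≤ N := (inv.le_nA (by omega) hex).trans hN
  refine (Reach.seq (reach_deriveProg h inv hN hN' hN'' hmN) fun s₁ ⟨h₁, q', dq⟩ => ?_).mono
    (T := 2200 * (N + 1) + (1030 * (N + 1) + 103 * (N + 1))) (by omega) fun _ h => h
  set v₁ := R + 1 - layerPotential H (G.sizes lab) m (E + 4) + Nat.size E * R - 1 with hv₁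
  refine Reach.seq (Q := fun s' => ∃ mt xl lab m E, Holds G mt xl m E s' ∧
    G.Inv mt xl lab m (E + 4) ∧ (max 4 (d / 2)) ≤ ((E + 4 : ℕ) : ℝ) ∧
    ((∃ a < G.nA, mt a = 0) →
      R + 1 - layerPotential H (G.sizes lab) m (E + 4) + Nat.size E * R ≤ v₁)) ?_ ?_
  pick_goal 2
  · rintro s₂ ⟨mt', xl', lab', m', E', h₂, inv₂, hδ₂, hv₂⟩
    exact reach_markProg h₂ inv₂ hδ₂ (by linarith) hv₂ hN
  refine (Reach.cond (T := 1026 * (N + 1)) (fun hsel => ?_) fun hsel => ?_).mono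
    (by simp only [Expr.cost]; omega) fun _ h => h
  · -- a layer with many movable vertices is collapsed
    simp only [Expr.val] at hsel
    obtain ⟨j, hj⟩ := Nat.exists_eq_succ_of_ne_zero hsel
    obtain ⟨hjm, hsel⟩ := dq.sel j hj
    refine (reach_collapseProg h₁ dq.label dq.move_eq hj hN hN').mono (by omega) ?_
    rintro s₂ ⟨mt', xl', h₂, hmt, hxl⟩
    have inv₂ := (inv.collapse hjm q' dq.move.1).congr hmt hxl (fun _ _ => rfl)
    refine ⟨mt', xl', _, j, E, h₂, inv₂, hδ, fun hex' => ?_⟩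
    have hc := hw.potential_collapse
      (a' := G.sizes fun a => if lab a ≤ j ∨ (lab a = j + 1 ∧ q' a = 0) then lab a else 0)
      hδ hpos hle inv.growth hjm
      (fun i hi => congrArg Finset.card (EdgeTable.upTo_collapse_of_lt hi))
      (inv₂.one_le_sizes hex' j) (inv.sizes_collapse_le (by omega) hjm hsel)
    linarith
  · simp only [Expr.val] at hsel
    have hgrow : ∀ D : ℕ, E + 4 ≤ D → (D : ℝ) ≤ d → ∀ i, i + 1 = m →
        (E + 4) * G.sizes lab i ≤ 2 * G.sizes lab m := by
      rintro D hD hDd i rfl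
      refine inv.growth_last (by omega) (hH.mono ?_) hr
        (fun j => (G.layer lab j).filter fun a => q' a ≠ 0) (fun j _ a ha => ?_)
        fun j hj => dq.sel_zero hsel j (by omega)
      · exact (Nat.cast_le.2 hD).trans hDd
      · obtain ⟨ha, hla, e, he, hxe, rfl, hfe⟩ := ha
        simp only [EdgeTable.layer, Finset.mem_filter, Finset.mem_range]
        exact ⟨⟨ha, hla⟩, dq.move.2 e he hxe hfe⟩
    refine (Reach.cond (T := 1010 * (N + 1)) (fun ht => ?_) fun ht => ?_).mono
      (by simp only [Expr.cost]; omega) fun _ h => h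
    · -- the last layer has not grown, so the guess exceeds `d`, and it may be halved
      have ht' : G.sizes lab m * 2 < (E + 4) * if m = 0 then 0 else G.sizes lab (m - 1) := by
        simp only [Expr.val, BinOp.eval, dq.total, dq.prev, h₁.E] at ht
        by_contra hge
        rw [if_neg hge] at ht
        exact ht rfl
      have hm : m ≠ 0 := fun hm => by simp [hm] at ht'
      rw [if_neg hm] at ht'
      have hEd : d < ((E + 4 : ℕ) : ℝ) := by
        by_contra hle
        have := hgrow (E + 4) le_rfl (not_lt.1 hle) (m - 1) (by omega)
        omega
      have hE1 : 1 ≤ E := by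
        by_contra h0
        obtain rfl : E = 0 := by omega
        push_cast at hEd
        linarith
      refine (reach_resetProg h₁ hN').mono (by omega) ?_
      rintro s₂ ⟨xl', h₂, hxl⟩
      have inv₂ := (inv.reset (E / 2 + 4)).congr (mt' := mt) (xl' := xl') (fun _ _ => rfl) hxl
        (fun _ _ => rfl)
      refine ⟨mt, xl', _, 0, E / 2, h₂, inv₂, ?_, fun hex' => ?_⟩
      · have h1 : E + 7 ≤ 2 * (E / 2 + 4) := by omega
        have h2 : ((E + 4 : ℕ) : ℝ) + 3 ≤ 2 * ((E / 2 + 4 : ℕ) : ℝ) := by exact_mod_cast h1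
        refine max_le ?_ (by linarith)
        exact_mod_cast (show 4 ≤ E / 2 + 4 by omega)
      · have h1 : Nat.size (E / 2) + 1 ≤ Nat.size E := by
          have : Nat.size (E / 2) ≤ Nat.size E - 1 := by
            rw [Nat.size_le]
            have h2 := Nat.lt_size_self E
            have h3 : 0 < Nat.size E := Nat.size_pos.2 hE1
            have h4 : 2 ^ Nat.size E = 2 * 2 ^ (Nat.size E - 1) := by
              rw [← pow_succ', Nat.sub_add_cancel h3]
            omega
          have h3 : 0 < Nat.size E := Nat.size_pos.2 hE1
          omega
        have h2 : ((Nat.size (E / 2) : ℝ) + 1) * R ≤ Nat.size E * R := by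
          refine mul_le_mul_of_nonneg_right ?_ (by linarith)
          exact_mod_cast h1
        have h3 := hw.one_le_potential 0 (E / 2 + 4) (inv₂.one_le_sizes hex')
        linarith
    · -- a new layer is built
      have hgr : ∀ i, i + 1 = m → (E + 4) * G.sizes lab i ≤ 2 * G.sizes lab m := by
        rintro i rfl
        simp only [Expr.val, BinOp.eval, dq.total, dq.prev, h₁.E] at ht
        by_contra hlt
        rw [if_pos] at ht
        · exact one_ne_zero ht
        · simp only [Nat.add_one_ne_zero, if_false, Nat.add_sub_cancel]
          omega
      refine (reach_buildProg h₁ inv dq.label dq.cnt dq.forb hN' hN'').mono (by omega) ?_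
      rintro s₂ ⟨xl', h₂, hg⟩
      obtain ⟨lab', inv₂, hup⟩ := hg.inv inv hgr
      refine ⟨mt, xl', lab', m + 1, E, h₂, inv₂, hδ, fun _ => ?_⟩
      have hb := hw.potential_build (a' := G.sizes lab') hpos hle hgr
        (fun i hi => congrArg Finset.card (hup i hi))
      linarith

/-- The main loop finds a perfect matching. -/
theorem reach_mainProg {H : ℝ → ℝ} {d q v : ℝ} (hr : 1 ≤ G.r) (hd : 4 ≤ d) (hH : G.Haxell d)
    (hw : IsLayerWeight H G.nA (max 4 (d / 2)) q)
    (hN : G.nA ≤ N) (hN' : G.mE ≤ N) (hN'' : G.tot ≤ N)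
    (hI : LoopInv G H (max 4 (d / 2)) (1 + 2 * H 1) v s) (n : ℕ) (hn : v ≤ n) :
    Reach mainProg s (4010 * (n + 2) * (N + 1)) fun s' =>
      ∃ mt xl lab m E, Holds G mt xl m E s' ∧ G.Inv mt xl lab m (E + 4) ∧
        ∀ a < G.nA, mt a ≠ 0 := by
  refine (Reach.of_loop (T := 4000 * (N + 1)) (fun v s hI => ?_)
    (fun v s hI he => reach_roundProg hr hd hH hw hN hN' hN'' hI (by simpa [Expr.val] using he))
    n v s hI hn).mono ?_ ?_
  · obtain ⟨mt, xl, lab, m, E, -, inv, hδ, hcase⟩ := hI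
    rcases hcase with ⟨-, -, rfl⟩ | ⟨-, hex, rfl⟩
    · exact le_rfl
    · have hpot := hw.potential_le hδ (inv.one_le_sizes hex) inv.growth
      have hR1 := (hw.one_le_potential m (E + 4) (inv.one_le_sizes hex)).trans hpot
      have : 0 ≤ (Nat.size E : ℝ) * (1 + 2 * H 1) := by positivity
      linarith
  · have h := Nat.mul_le_mul_left (n + 1) (show 2 + 1 + 4000 * (N + 1) ≤ 4010 * (N + 1) by omega)
    have h' : 4010 * (n + 2) * (N + 1) = (n + 1) * (4010 * (N + 1)) + 4010 * (N + 1) := by ring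
    rw [h']
    exact Nat.add_le_add h (show 2 + 1 ≤ 4010 * (N + 1) by omega)
  · rintro s' ⟨⟨v', mt, xl, lab, m, E, h, inv, -, hcase⟩, he⟩
    refine ⟨mt, xl, lab, m, E, h, inv, ?_⟩
    rcases hcase with ⟨-, h1, -⟩ | ⟨h1, -⟩
    · exact h1
    · exact (h1 (by simpa [Expr.val] using he)).elim

end

end WordRAM

namespace WordRAM

/-! ### Input and output -/

-- The number of vertices in the second class of the edge that is being read.
notation "rL" => (8 : ℕ)

/-- The number of incidences of the first `i` edges, if edge `j` has `len j` of them. -/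
def start (len : ℕ → ℕ) (i : ℕ) : ℕ := ∑ j ∈ Finset.range i, len j

theorem start_succ (len : ℕ → ℕ) (i : ℕ) : start len (i + 1) = start len i + len i :=
  Finset.sum_range_succ _ _

theorem start_mono (len : ℕ → ℕ) {i j : ℕ} (h : i ≤ j) : start len i ≤ start len j :=
  Finset.sum_le_sum_of_subset (Finset.range_mono h)

theorem exists_start_le {len : ℕ → ℕ} {n t : ℕ} (h : t < start len n) :
    ∃ j < n, start len j ≤ t ∧ t < start len j + len j := by
  induction n with
  | zero => simp [start] at h
  | succ n ih =>
      rw [start_succ] at h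
      rcases Nat.lt_or_ge t (start len n) with h' | h'
      · obtain ⟨j, hj, h1⟩ := ih h'
        exact ⟨j, by omega, h1⟩
      · exact ⟨n, by omega, h', h⟩

/-- The input array `g` encodes the edges `e < mE`, where the edge `e` has the vertex `ea e < nA`
in the first class, and the `len e` vertices `b e t` in the second one. -/
structure IsInput (g : ℕ → ℕ) (nA mE r : ℕ) (ea len : ℕ → ℕ) (b : ℕ → ℕ → ℕ) : Prop where
  nA_eq : g 0 = nA
  mE_eq : g 2 = mE
  ea_eq : ∀ e < mE, g (3 + 2 * e + start len e) = ea e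
  len_eq : ∀ e < mE, g (4 + 2 * e + start len e) = len e
  b_eq : ∀ e < mE, ∀ t < len e, g (5 + 2 * e + start len e + t) = b e t
  ea_lt : ∀ e < mE, ea e < nA
  len_pos : ∀ e < mE, 1 ≤ len e
  len_le : ∀ e < mE, len e ≤ r

/-- Read the edge with the index in the loop register. -/
def readEdgeProg : Program :=
  .assign rL (.read aIn (.const 4 +ᵉ .const 2 *ᵉ ix +ᵉ .read aOff ix)) ;;
  .write aEA ix (.read aIn (.const 3 +ᵉ .const 2 *ᵉ ix +ᵉ .read aOff ix)) ;;
  .cond (.reg rR <ᵉ .reg rL) (.assign rR (.reg rL)) .skip ;;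
  scatter rT (.const 0) (.reg rL) aIB (.const 1) (.read aOff ix +ᵉ .reg rT)
    (.read aIn (.const 5 +ᵉ .const 2 *ᵉ ix +ᵉ .read aOff ix +ᵉ .reg rT)) ;;
  scatter rT (.const 0) (.reg rL) aIE (.const 1) (.read aOff ix +ᵉ .reg rT) ix ;;
  .write aOff (ix +ᵉ .const 1) (.read aOff ix) ;;
  scatter rT (.const 0) (.reg rL) aOff (.const 1) (ix +ᵉ .const 1)
    (.read aOff (ix +ᵉ .const 1) +ᵉ .const 1)

/-- Set up the edge table, and start with the guess `E` that is the number of incidences, which is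
at least `d` if there are vertices to be matched. The bound `rR` on the size of edges starts with
`1`, so that it is positive even if there are no edges. -/
def readProg : Program :=
  .assign rNA (.read aIn (.const 0)) ;;
  .assign rME (.read aIn (.const 2)) ;;
  .assign rR (.const 1) ;;
  forLoop rI (.const 0) (.reg rME) readEdgeProg ;;
  .assign rTot (.read aOff (.reg rME)) ;;
  .assign rE (.reg rTot)

/-- The state after `i` edges have been read. -/
structure HasRead (g : ℕ → ℕ) (nA mE r : ℕ) (ea len : ℕ → ℕ) (b : ℕ → ℕ → ℕ) (i : ℕ)
    (s : State) : Prop where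
  inp : s.arr aIn = g
  nA : s.reg rNA = nA
  mE : s.reg rME = mE
  m : s.reg rM = 0
  r_pos : 1 ≤ s.reg rR
  r_le : s.reg rR ≤ r
  mt : s.arr aMT = fun _ => 0
  xl : s.arr aXL = fun _ => 0
  len_le : ∀ e < i, len e ≤ s.reg rR
  off : ∀ e ≤ i, s.arr aOff e = start len e
  ea : ∀ e < i, s.arr aEA e = ea e
  ib : ∀ e < i, ∀ t < len e, s.arr aIB (start len e + t) = b e t
  ie : ∀ e < i, ∀ t < len e, s.arr aIE (start len e + t) = e

variable {g ea len : ℕ → ℕ} {b : ℕ → ℕ → ℕ} {nA mE r i : ℕ} {s : State}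

theorem reach_readEdgeProg (hin : IsInput g nA mE r ea len b) (hi : i < mE)
    (h : HasRead g nA mE r ea len b i s) (hri : s.reg rI = i) :
    Reach readEdgeProg s (60 + 300 * (len i + 1)) fun s' =>
      HasRead g nA mE r ea len b (i + 1) s' ∧ s'.reg rI = i := by
  have hoff := h.off i le_rfl
  refine (Reach.seq (Reach.assign (T := 10) (Q := fun t => t = s.setReg rL (len i)) (by decide)
    (by simp [Expr.val, BinOp.eval, hri, hoff, h.inp, hin.len_eq i hi])) ?_).mono
    (T := 10 + (11 + (6 + (100 * (len i + 1) + (100 * (len i + 1) + (6 + 100 * (len i + 1)))))))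
    (by omega) fun _ h => h
  rintro s₁ rfl
  refine Reach.seq (Reach.write (Q := fun t => t = (s.setReg rL (len i)).setArr aEA i (ea i))
    (by decide)
    (by simp [Expr.val, BinOp.eval, State.setReg, hri, hoff, h.inp, hin.ea_eq i hi])) ?_
  rintro s₂ rfl
  refine Reach.seq (Q := fun t => t = ((s.setReg rL (len i)).setArr aEA i (ea i)).setReg rR
    (max (s.reg rR) (len i))) (Reach.cond (T := 2) (fun hc => ?_) fun hc => ?_) ?_
  · refine Reach.assign (by decide) ?_
    simp only [Expr.val, BinOp.eval, State.setReg, State.setArr] at hc ⊢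
    simp at hc ⊢
    rw [max_eq_right hc.le]
  · refine Reach.skip (by decide) ?_
    simp only [Expr.val, BinOp.eval, State.setReg, State.setArr] at hc ⊢
    simpa using hc
  rintro s₃ rfl
  set s₃ := ((s.setReg rL (len i)).setArr aEA i (ea i)).setReg rR (max (s.reg rR) (len i)) with hs₃
  have r₃ : s₃.reg rL = len i := by simp [hs₃, State.setReg, State.setArr]
  have i₃ : s₃.reg rI = i := by simp [hs₃, State.setReg, State.setArr, hri]
  have a₃ : ∀ a, a ≠ aEA → s₃.arr a = s.arr a := fun a ha => by
    simp [hs₃, State.setReg, State.setArr, ha]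
  refine Reach.seq (Reach.of_scatter (l := 0) (n := len i) (N := len i) (fun _ => True)
    (fun t => start len i + t) (b i) (by decide) rfl (by simp [Expr.val, r₃]) le_rfl
    (by simp [Expr.val])
    (by simp [Expr.val, BinOp.eval, State.setReg, i₃, a₃, hoff])
    (fun t _ ht _ => by
      simp [Expr.val, BinOp.eval, State.setReg, i₃, a₃, hoff, h.inp,
        hin.b_eq i hi t (by omega)])) ?_
  rintro s₄ hs₄
  have r₄ : ∀ x, x ≠ rT → s₄.reg x = s₃.reg x := fun x hx => by rw [hs₄.1, update_of_ne hx]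
  have a₄ : ∀ a, a ≠ aIB → s₄.arr a = s₃.arr a := fun a ha => by rw [hs₄.2, update_of_ne ha]
  refine Reach.seq (Reach.of_scatter (l := 0) (n := len i) (N := len i) (fun _ => True)
    (fun t => start len i + t) (fun _ => i) (by decide) rfl (by simp [Expr.val, r₃, r₄]) le_rfl
    (by simp [Expr.val])
    (by simp [Expr.val, BinOp.eval, State.setReg, i₃, a₃, r₄, a₄, hoff])
    (by simp [Expr.val, State.setReg, i₃, r₄])) ?_
  rintro s₅ hs₅
  have r₅ : ∀ x, x ≠ rT → s₅.reg x = s₃.reg x := fun x hx => by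
    rw [hs₅.1, update_of_ne hx, r₄ x hx]
  have a₅ : ∀ a, a ≠ aIE → s₅.arr a = s₄.arr a := fun a ha => by rw [hs₅.2, update_of_ne ha]
  refine Reach.seq (Reach.write (Q := fun t => t = s₅.setArr aOff (i + 1) (start len i))
    (by decide)
    (by simp [Expr.val, BinOp.eval, i₃, r₅, a₅, a₄, a₃, hoff])) ?_
  rintro s₆ rfl
  refine (Reach.of_count (l := 0) (n := len i) (N := len i) (fun _ => True)
    (fun _ => i + 1) (by decide) rfl (by simp [Expr.val, State.setArr, r₅, r₃]) le_rfl
    (by simp [Expr.val])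
    (by simp [Expr.val, BinOp.eval, State.setReg, State.setArr, r₅, i₃])).mono le_rfl ?_
  rintro s₇ hs₇
  have r₇ : ∀ x, x ≠ rT → s₇.reg x = s₃.reg x := fun x hx => by
    rw [hs₇.1, update_of_ne hx]; exact r₅ x hx
  have a₇ : ∀ a, a ≠ aOff → s₇.arr a = s₅.arr a := fun a ha => by
    rw [hs₇.2, update_of_ne ha]; simp [State.setArr, ha]
  have q₃ : ∀ x, x ≠ rL → x ≠ rR → s₃.reg x = s.reg x := fun x h1 h2 => by
    simp [hs₃, State.setReg, State.setArr, h1, h2]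
  have R₇ : s₇.reg rR = max (s.reg rR) (len i) := by
    rw [r₇ _ (by decide)]; simp [hs₃, State.setReg]
  have new : ∀ (V : ℕ → ℕ) (f : ℕ → ℕ), ∀ t < len i,
      scat (fun _ => True) (fun t => start len i + t) V 0 f (len i) (start len i + t) = V t := by
    intro V f t ht
    rcases scat_cases (fun _ => True) (fun t => start len i + t) V 0 f (len i)
      (start len i + t) with ⟨-, h'⟩ | ⟨u, -, -, -, h1, h2⟩
    · exact (h' t (by omega) (by omega) trivial rfl).elim
    · obtain rfl : u = t := by omega
      exact h2
  have old : ∀ (V : ℕ → ℕ) (f : ℕ → ℕ), ∀ t < start len i,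
      scat (fun _ => True) (fun t => start len i + t) V 0 f (len i) t = f t := by
    intro V f t ht
    rcases scat_cases (fun _ => True) (fun t => start len i + t) V 0 f (len i) t with
      ⟨h', -⟩ | ⟨u, -, -, -, h1, h2⟩
    · exact h'
    · omega
  have below : ∀ e < i, ∀ t < len e, start len e + t < start len i := fun e he t ht => by
    have := start_mono len (show e + 1 ≤ i from he)
    rw [start_succ] at this
    omega
  have ib₇ : s₇.arr aIB = scat (fun _ => True) (fun t => start len i + t) (b i) 0 (s.arr aIB)
      (len i) := by
    rw [a₇ _ (by decide), a₅ _ (by decide), hs₄.2, update_self, a₃ _ (by decide)]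
  have ie₇ : s₇.arr aIE = scat (fun _ => True) (fun t => start len i + t) (fun _ => i) 0
      (s.arr aIE) (len i) := by
    rw [a₇ _ (by decide), hs₅.2, update_self, a₄ _ (by decide), a₃ _ (by decide)]
  refine ⟨?_, by rw [r₇ _ (by decide), i₃]⟩
  constructor
  · rw [a₇ _ (by decide), a₅ _ (by decide), a₄ _ (by decide), a₃ _ (by decide), h.inp]
  · rw [r₇ _ (by decide), q₃ _ (by decide) (by decide), h.nA]
  · rw [r₇ _ (by decide), q₃ _ (by decide) (by decide), h.mE]
  · rw [r₇ _ (by decide), q₃ _ (by decide) (by decide), h.m]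
  · rw [R₇]; exact h.r_pos.trans (le_max_left _ _)
  · rw [R₇]; exact max_le h.r_le (hin.len_le i hi)
  · rw [a₇ _ (by decide), a₅ _ (by decide), a₄ _ (by decide), a₃ _ (by decide), h.mt]
  · rw [a₇ _ (by decide), a₅ _ (by decide), a₄ _ (by decide), a₃ _ (by decide), h.xl]
  · intro e he
    rw [R₇]
    rcases Nat.lt_succ_iff_lt_or_eq.1 he with he | rfl
    · exact (h.len_le e he).trans (le_max_left _ _)
    · exact le_max_right _ _
  · intro e he
    rw [hs₇.2, update_self]
    simp only [State.setArr, update_self]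
    rcases Nat.lt_or_ge i e with he' | he'
    · obtain rfl : e = i + 1 := by omega
      simp [start_succ]
    · rw [update_of_ne (by omega), a₅ _ (by decide), a₄ _ (by decide), a₃ _ (by decide),
        h.off e he']
      simp [show i + 1 ≠ e by omega]
  · intro e he
    rw [a₇ _ (by decide), a₅ _ (by decide), a₄ _ (by decide)]
    rcases Nat.lt_succ_iff_lt_or_eq.1 he with he | rfl
    · simp [hs₃, State.setReg, State.setArr, update_of_ne he.ne, h.ea e he]
    · simp [hs₃, State.setReg, State.setArr]
  · intro e he t ht
    rw [ib₇]
    rcases Nat.lt_succ_iff_lt_or_eq.1 he with he | rfl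
    · rw [old _ _ _ (below e he t ht), h.ib e he t ht]
    · exact new _ _ t ht
  · intro e he t ht
    rw [ie₇]
    rcases Nat.lt_succ_iff_lt_or_eq.1 he with he | rfl
    · rw [old _ _ _ (below e he t ht), h.ie e he t ht]
    · exact new _ _ t ht

/-- The edge table that is held by the arrays after all edges have been read. -/
theorem HasRead.exists_edgeTable (hin : IsInput g nA mE r ea len b)
    (h : HasRead g nA mE r ea len b mE s) (htot : s.reg rTot = start len mE) :
    ∃ G : EdgeTable, Holds G (fun _ => 0) (fun _ => 0) 0 (s.reg rE) s ∧ G.nA = nA ∧ G.mE = mE ∧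
      G.tot = start len mE ∧ 1 ≤ G.r ∧ G.r ≤ r ∧ (∀ e < mE, G.ea e = ea e) ∧
      ∀ e < mE, G.Bs e = (Finset.range (len e)).image (b e) := by
  have key : ∀ e < mE, ∀ t, start len e ≤ t → t < start len (e + 1) → s.arr aIE t = e := by
    intro e he t h1 h2
    rw [start_succ] at h2
    have := h.ie e he (t - start len e) (by omega)
    rwa [Nat.add_sub_cancel' h1] at this
  have find : ∀ t < start len mE, s.arr aIE t < mE ∧ s.arr aOff (s.arr aIE t) ≤ t ∧
      t < s.arr aOff (s.arr aIE t + 1) := by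
    intro t ht
    obtain ⟨j, hj, h1, h2⟩ := exists_start_le ht
    rw [← start_succ] at h2
    rw [key j hj t h1 h2, h.off j hj.le, h.off (j + 1) hj]
    exact ⟨hj, h1, h2⟩
  refine ⟨{ nA := nA, mE := mE, tot := start len mE, r := s.reg rR
            ea := s.arr aEA, off := s.arr aOff, ib := s.arr aIB, ie := s.arr aIE
            ea_lt := fun e he => by rw [h.ea e he]; exact hin.ea_lt e he
            off_zero := by rw [h.off 0 (by omega)]; rfl
            off_mE := h.off mE le_rfl
            off_lt := fun e he => by
              rw [h.off e he.le, h.off (e + 1) he, start_succ]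
              have := hin.len_pos e he
              omega
            off_le := fun e he => by rw [h.off (e + 1) he]; exact start_mono len he
            off_sub := fun e he => by
              rw [h.off e he.le, h.off (e + 1) he, start_succ]
              have := h.len_le e he
              omega
            ie_lt := fun t ht => (find t ht).1
            ie_spec := fun t ht => (find t ht).2
            ie_eq := fun e he t h1 h2 => by
              rw [h.off e he.le] at h1
              rw [h.off (e + 1) he] at h2
              exact key e he t h1 h2 }, ?_, rfl, rfl, rfl, h.r_pos, h.r_le, h.ea, ?_⟩
  · exact ⟨h.nA, h.mE, htot, rfl, h.m, rfl, rfl, rfl, rfl, rfl, h.mt, h.xl⟩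
  · intro e he
    ext x
    simp only [EdgeTable.mem_Bs, Finset.mem_image, Finset.mem_range]
    rw [h.off e he.le, h.off (e + 1) he, start_succ]
    constructor
    · rintro ⟨t, h1, h2, rfl⟩
      refine ⟨t - start len e, by omega, ?_⟩
      rw [← h.ib e he _ (by omega), Nat.add_sub_cancel' h1]
    · rintro ⟨t, ht, rfl⟩
      exact ⟨start len e + t, by omega, by omega, h.ib e he t ht⟩

theorem reach_readProg (hin : IsInput g nA mE r ea len b) (hr : 1 ≤ r) (h0 : s.arr aIn = g)
    (hreg : s.reg = fun _ => 0) (harr : ∀ a, a ≠ aIn → s.arr a = fun _ => 0) :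
    Reach readProg s (400 * (mE + start len mE + 1)) fun s' =>
      ∃ G : EdgeTable, Holds G (fun _ => 0) (fun _ => 0) 0 (start len mE) s' ∧
      G.nA = nA ∧ G.mE = mE ∧ G.tot = start len mE ∧ 1 ≤ G.r ∧ G.r ≤ r ∧
      (∀ e < mE, G.ea e = ea e) ∧ ∀ e < mE, G.Bs e = (Finset.range (len e)).image (b e) := by
  have hsum : ∑ e ∈ Finset.range mE, (60 + 300 * (len e + 1) + 1 + 7)
      = 368 * mE + 300 * start len mE := by
    have : ∀ e, 60 + 300 * (len e + 1) + 1 + 7 = 368 + 300 * len e := fun e => by ring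
    simp only [this, Finset.sum_add_distrib, ← Finset.mul_sum]
    simp [start, mul_comm]
  refine (Reach.seq (Reach.assign (T := 3) (Q := fun t => t = s.setReg rNA nA) (by decide)
    (by simp [Expr.val, h0, hin.nA_eq])) ?_).mono
    (T := 3 + (3 + (2 + ((1 + 1 + (368 * mE + 300 * start len mE) + (1 + 3)) + (3 + 2)))))
    (by omega) fun _ h => h
  rintro s₁ rfl
  refine Reach.seq (Reach.assign (Q := fun t => t = (s.setReg rNA nA).setReg rME mE) (by decide)
    (by simp [Expr.val, State.setReg, h0, hin.mE_eq])) ?_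
  rintro s₂ rfl
  refine Reach.seq (Reach.assign (Q := fun t => t = ((s.setReg rNA nA).setReg rME mE).setReg rR 1)
    (by decide) (by simp [Expr.val])) ?_
  rintro s₃ rfl
  refine Reach.seq (Q := HasRead g nA mE r ea len b mE) ?_ ?_
  · rw [← hsum]
    refine (Reach.of_forLoop (l := 0) (n := mE) (fun e => 60 + 300 * (len e + 1))
      (fun i s => HasRead g nA mE r ea len b i s ∧ s.reg rI = i) rfl ?_ ?_ ?_ ?_).mono le_rfl
      fun _ h => h.1
    · refine ⟨?_, by simp [State.setReg]⟩
      constructor <;> simp [State.setReg, h0, hreg, harr, hr, start]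
    · intro i s' _ hs'
      simp [Expr.val, hs'.1.mE]
    · intro i s' _ hs'
      simp [hs'.2]
    · intro i s' hi hs'
      refine (reach_readEdgeProg hin hi hs'.1 hs'.2).mono le_rfl fun s'' hs'' => ⟨?_, ?_⟩
      · obtain ⟨h', -⟩ := hs''
        exact ⟨h'.inp, by simpa [State.setReg] using h'.nA, by simpa [State.setReg] using h'.mE,
          by simpa [State.setReg] using h'.m, by simpa [State.setReg] using h'.r_pos,
          by simpa [State.setReg] using h'.r_le, h'.mt, h'.xl,
          by simpa [State.setReg] using h'.len_le, h'.off, h'.ea, h'.ib, h'.ie⟩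
      · simp [State.setReg, hs''.2]
  · intro s₄ h
    refine Reach.seq (Reach.assign (Q := fun t => t = s₄.setReg rTot (start len mE)) (by decide)
      (by simp [Expr.val, h.mE, h.off mE le_rfl])) ?_
    rintro s₅ rfl
    refine Reach.assign (by decide) ?_
    have h' : HasRead g nA mE r ea len b mE
        ((s₄.setReg rTot (start len mE)).setReg rE (start len mE)) :=
      ⟨h.inp, by simpa [State.setReg] using h.nA, by simpa [State.setReg] using h.mE,
        by simpa [State.setReg] using h.m, by simpa [State.setReg] using h.r_pos,
        by simpa [State.setReg] using h.r_le, h.mt, h.xl,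
        by simpa [State.setReg] using h.len_le, h.off, h.ea, h.ib, h.ie⟩
    obtain ⟨G, hG, hG'⟩ := h'.exists_edgeTable hin (by simp [State.setReg])
    exact ⟨G, by simpa [Expr.val, State.setReg] using hG, hG'⟩

/-- Write the matching to the output array. -/
def outProg : Program :=
  .write aOut (.const 0) (.reg rNA) ;;
  pass (.reg rNA) aOut (.const 1) (ix +ᵉ .const 1) (.read aMT ix -ᵉ .const 1)

theorem reach_outProg {G : EdgeTable} {mt xl : ℕ → ℕ} {m E N : ℕ} (h : Holds G mt xl m E s)
    (hN : G.nA ≤ N) :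
    Reach outProg s (103 * (N + 1)) fun s' => s'.arr aOut 0 = G.nA ∧
      ∀ a < G.nA, s'.arr aOut (a + 1) = mt a - 1 := by
  refine (Reach.seq (Reach.write (Q := fun s' => s' = s.setArr aOut 0 G.nA) (T := 3)
    (by simp [Expr.cost]) (by simp [Expr.val, h.nA])) ?_).mono
    (T := 3 + 100 * (N + 1)) (by omega) fun _ h => h
  rintro s₁ rfl
  refine (Reach.of_pass (N := N) (n := G.nA) (fun _ => True) (fun i => i + 1) (fun a => mt a - 1)
    (by decide) (by simp [Expr.val, State.setArr, h.nA]) hN (by simp [Expr.val])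
    (by simp [Expr.val, BinOp.eval, State.setReg])
    (by simp [Expr.val, BinOp.eval, State.setReg, State.setArr, h.mt])).mono le_rfl
    fun s₂ hs₂ => ?_
  rw [hs₂.2]
  constructor
  · rcases scat_cases (fun _ => True) (fun i => i + 1) (fun a => mt a - 1) 0
      ((s.setArr aOut 0 G.nA).arr aOut) G.nA 0 with ⟨h1, -⟩ | ⟨a, -, -, -, h1, -⟩
    · rw [h1]; simp [State.setArr]
    · omega
  · intro a ha
    rcases scat_cases (fun _ => True) (fun i => i + 1) (fun a => mt a - 1) 0
      ((s.setArr aOut 0 G.nA).arr aOut) G.nA (a + 1) with ⟨-, h1⟩ | ⟨a', -, -, -, h1, h2⟩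
    · exact (h1 a (by omega) (by omega) trivial rfl).elim
    · obtain rfl : a' = a := by omega
      exact h2

/-- The whole algorithm. -/
def matchingProg : Program := readProg ;; markProg ;; mainProg ;; outProg

theorem matchingProg_tame : matchingProg.tame = true := by decide

end WordRAM

namespace WordRAM

/-! ### Correctness and running time -/

/-- The output array lists one edge at each vertex of the first class, and these edges are pairwise
disjoint, for edges given as in `IsInput`. -/
def HasMatching (nA mE : ℕ) (ea len : ℕ → ℕ) (b : ℕ → ℕ → ℕ) (s : State) : Prop :=
  s.arr aOut 0 = nA ∧
  (∀ a < nA, s.arr aOut (a + 1) < mE ∧ ea (s.arr aOut (a + 1)) = a) ∧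
  ∀ a < nA, ∀ a' < nA, a ≠ a' → ∀ t < len (s.arr aOut (a + 1)), ∀ t' < len (s.arr aOut (a' + 1)),
    b (s.arr aOut (a + 1)) t ≠ b (s.arr aOut (a' + 1)) t'

/-- The strong Haxell condition with factor `d * r ^ 2`, for edges given as in `IsInput`. -/
def InputHaxell (nA mE r : ℕ) (ea len : ℕ → ℕ) (b : ℕ → ℕ → ℕ) (d : ℝ) : Prop :=
  ∀ U T : Finset ℕ, (∀ a ∈ U, a < nA) → (∀ e < mE, ea e ∈ U → ∃ t < len e, b e t ∈ T) →
    d * r ^ 2 * U.card ≤ T.card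

variable {g ea len : ℕ → ℕ} {b : ℕ → ℕ → ℕ} {nA mE r : ℕ} {s : State} {d : ℝ}

/-- The number `n` bounds the number of rounds, by the bounds on the potential and on the number of
bits of `E`. -/
theorem reach_matchingProg {H : ℝ → ℝ} {q : ℝ} {n N : ℕ} (hin : IsInput g nA mE r ea len b)
    (hr : 1 ≤ r) (h0 : s.arr aIn = g) (hreg : s.reg = fun _ => 0)
    (harr : ∀ a, a ≠ aIn → s.arr a = fun _ => 0) (hd : 4 ≤ d) (hdt : d ≤ start len mE + 4)
    (hH : InputHaxell nA mE r ea len b d) (hw : IsLayerWeight H nA (max 4 (d / 2)) q)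
    (hn : nA ≠ 0 → (Nat.size (start len mE) + 1) * (1 + 2 * H 1) ≤ n)
    (hN : nA + mE + start len mE ≤ N) :
    Reach matchingProg s (5000 * ((n + 2) * (N + 1))) (HasMatching nA mE ea len b) := by
  have hcost : 400 * (mE + start len mE + 1) + (103 * (N + 1) + (4010 * (n + 2) * (N + 1) +
      103 * (N + 1))) ≤ 5000 * ((n + 2) * (N + 1)) := by
    have h1 : 4010 * (n + 2) * (N + 1) = 4010 * ((n + 2) * (N + 1)) := by ring
    have h2 : 2 * (N + 1) ≤ (n + 2) * (N + 1) := Nat.mul_le_mul_right _ (by omega)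
    rw [h1]
    omega
  refine (Reach.seq (reach_readProg hin hr h0 hreg harr) fun s₁ hs₁ => ?_).mono hcost fun _ h => h
  obtain ⟨G, hG, hA, hM, ht, hr1, hr2, hea, hBs⟩ := hs₁
  have hGH : G.Haxell d := by
    intro U T hU hT
    have h1 := hH U T (by rwa [← hA]) fun e he heU => by
      obtain ⟨x, hx, hxe⟩ := hT e (by omega) (by rwa [hea e he])
      rw [hBs e he] at hxe
      obtain ⟨t, ht, rfl⟩ := Finset.mem_image.1 hxe
      exact ⟨t, Finset.mem_range.1 ht, hx⟩
    refine le_trans ?_ h1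
    gcongr
  have inv := EdgeTable.inv_init G (start len mE + 4)
  have hδ : max 4 (d / 2) ≤ ((start len mE + 4 : ℕ) : ℝ) := by
    push_cast
    exact max_le (by linarith [(Nat.cast_nonneg (start len mE) : (0 : ℝ) ≤ _)]) (by linarith)
  refine Reach.seq (reach_markProg (N := N) (H := H) (δ := max 4 (d / 2)) (R := 1 + 2 * H 1)
    (v := n) hG inv hδ (Nat.cast_nonneg _) (fun hex => ?_) (by omega)) fun s₂ hs₂ => ?_
  · have h1 : nA ≠ 0 := by obtain ⟨a, ha, -⟩ := hex; omega
    have h2 := hw.one_le_potential 0 (start len mE + 4) (inv.one_le_sizes hex)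
    linarith [hn h1]
  obtain ⟨v, hv, hI⟩ := hs₂
  refine Reach.seq (reach_mainProg hr1 hd hGH (hA ▸ hw) (by omega) (by omega) (by omega) hI n hv)
    fun s₃ hs₃ => ?_
  obtain ⟨mt, xl, lab, m, E, h₃, inv₃, hall⟩ := hs₃
  refine (reach_outProg h₃ (by omega : G.nA ≤ N)).mono le_rfl fun s₄ hs₄ => ?_
  obtain ⟨ho, hs₄⟩ := hs₄
  have hmt : ∀ a < nA, mt a = s₄.arr aOut (a + 1) + 1 := fun a ha => by
    have := hall a (by omega)
    rw [hs₄ a (by omega)]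
    omega
  have hlt : ∀ a < nA, s₄.arr aOut (a + 1) < mE := fun a ha => by
    rw [← hM]; exact inv₃.mt_lt a (by omega) _ (hmt a ha)
  refine ⟨by rw [ho, hA], fun a ha => ⟨hlt a ha, ?_⟩, fun a ha a' ha' hne t ht t' ht' heq => ?_⟩
  · rw [← hea _ (hlt a ha)]
    exact inv₃.mt_ea a (by omega) _ (hmt a ha)
  · have := inv₃.mt_disj a (by omega) a' (by omega) hne _ _ (hmt a ha) (hmt a' ha')
    rw [hBs _ (hlt a ha), hBs _ (hlt a' ha'), Finset.disjoint_left] at this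
    exact this (Finset.mem_image.2 ⟨t, Finset.mem_range.2 ht, rfl⟩)
      (Finset.mem_image.2 ⟨t', Finset.mem_range.2 ht', heq.symm⟩)

/-- Every vertex of the first class lies in an edge, hence the number of edges is at least the
number of vertices. -/
theorem InputHaxell.le_mE (hH : InputHaxell nA mE r ea len b d) (hr : 1 ≤ r) (hd : 4 ≤ d) :
    nA ≤ mE := by
  have hsub : Finset.range nA ⊆ (Finset.range mE).image ea := by
    intro a ha
    by_contra hne
    have h1 := hH {a} ∅ (by simpa using ha) fun e he hea => by
      refine (hne (Finset.mem_image.2 ⟨e, Finset.mem_range.2 he, ?_⟩)).elim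
      simpa using hea
    have hr' : (0 : ℝ) < r := by exact_mod_cast hr
    have : 0 < d * (r : ℝ) ^ 2 := by positivity
    simp at h1
    linarith
  have h1 := (Finset.card_le_card hsub).trans Finset.card_image_le
  simpa using h1

/-- The set of all vertices of the second class meets all edges. -/
theorem InputHaxell.le_start (hH : InputHaxell nA mE r ea len b d) (hr : 1 ≤ r) (hd : 4 ≤ d)
    (hlen : ∀ e < mE, 1 ≤ len e) (hA : nA ≠ 0) : d ≤ start len mE := by
  have h1 := hH {0} ((Finset.range mE).biUnion fun e => (Finset.range (len e)).image (b e))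
    (by simp; omega) fun e he _ => ⟨0, hlen e he, Finset.mem_biUnion.2
      ⟨e, Finset.mem_range.2 he, Finset.mem_image.2 ⟨0, Finset.mem_range.2 (hlen e he), rfl⟩⟩⟩
  have h2 : ((Finset.range mE).biUnion fun e => (Finset.range (len e)).image (b e)).card
      ≤ start len mE :=
    Finset.card_biUnion_le.trans (Finset.sum_le_sum fun e _ =>
      Finset.card_image_le.trans (Finset.card_range _).le)
  have h3 : (1 : ℝ) ≤ (r : ℝ) ^ 2 := one_le_pow₀ (by exact_mod_cast hr)
  have h4 : (((Finset.range mE).biUnion fun e => (Finset.range (len e)).image (b e)).card : ℝ)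
      ≤ start len mE := by exact_mod_cast h2
  simp only [Finset.card_singleton, Nat.cast_one, mul_one] at h1
  have h5 : d * 1 ≤ d * (r : ℝ) ^ 2 := by gcongr
  linarith

/-- Polylogarithmic factors are absorbed by the exponent, since `d ≤ P`. -/
theorem sq_logb_le_rpow {d P : ℝ} (hd : 4 ≤ d) (hP : d ≤ P) :
    Real.logb 2 P ^ 2 ≤ P ^ (4 / √(Real.logb 2 d)) := by
  set l := Real.logb 2 P with hl
  have hld : Real.logb 2 d ≤ l := Real.logb_le_logb_of_le (by norm_num) (by linarith) hP
  have h2 : 2 ≤ Real.logb 2 d := by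
    rw [Real.le_logb_iff_rpow_le (by norm_num) (by linarith)]
    norm_num; exact hd
  have hx : 1 ≤ √l := Real.one_le_sqrt.2 (by linarith)
  have hy : √(Real.logb 2 d) ≤ √l := Real.sqrt_le_sqrt hld
  have hy0 : 0 < √(Real.logb 2 d) := Real.sqrt_pos.2 (by linarith)
  have hll : √l * √l = l := Real.mul_self_sqrt (by linarith)
  have h1 : √l ≤ (2 : ℝ) ^ √l := by
    have := one_add_mul_self_le_rpow_one_add (show (-1 : ℝ) ≤ 1 by norm_num) hx
    norm_num at this
    linarith
  have hPe : P = (2 : ℝ) ^ l := (Real.rpow_logb (by norm_num) (by norm_num) (by linarith)).symm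
  calc l ^ 2 = (√l * √l) ^ 2 := by rw [hll]
    _ = √l ^ (4 : ℕ) := by ring
    _ ≤ ((2 : ℝ) ^ √l) ^ (4 : ℕ) := by gcongr
    _ = (2 : ℝ) ^ (√l * 4) := by rw [← Real.rpow_natCast, ← Real.rpow_mul (by norm_num)]; norm_num
    _ ≤ (2 : ℝ) ^ (l * (4 / √(Real.logb 2 d))) := by
        refine Real.rpow_le_rpow_of_exponent_le (by norm_num) ?_
        rw [mul_div_assoc', le_div_iff₀ hy0]
        nlinarith
    _ = P ^ (4 / √(Real.logb 2 d)) := by rw [hPe, ← Real.rpow_mul (by norm_num)]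

theorem size_le_logb {k : ℕ} (hk : 1 ≤ k) : (Nat.size k : ℝ) ≤ Real.logb 2 k + 1 := by
  have h3 : 0 < Nat.size k := Nat.size_pos.2 hk
  have h1 : 2 ^ (Nat.size k - 1) ≤ k := Nat.lt_size.1 (by omega)
  have h2 : ((Nat.size k - 1 : ℕ) : ℝ) ≤ Real.logb 2 k := by
    rw [Real.le_logb_iff_rpow_le (by norm_num) (by exact_mod_cast hk), Real.rpow_natCast]
    exact_mod_cast h1
  rw [Nat.cast_sub (by omega)] at h2
  push_cast at h2
  linarith

/-- The running time of the algorithm, with unbounded words. -/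
theorem exists_reach_matchingProg (hin : IsInput g nA mE r ea len b)
    (hr : 1 ≤ r) (h0 : s.arr aIn = g) (hreg : s.reg = fun _ => 0)
    (harr : ∀ a, a ≠ aIn → s.arr a = fun _ => 0) (hd : 4 ≤ d)
    (hH : InputHaxell nA mE r ea len b d) :
    ∃ T : ℕ, Reach matchingProg s T (HasMatching nA mE ea len b) ∧
      (T : ℝ) ≤ 1000000 * ((max (mE + start len mE) 1 : ℕ) : ℝ) ^
        (1 + 84 / √(Real.logb 2 d)) := by
  rcases Nat.eq_zero_or_pos nA with rfl | hA
  -- without vertices to be matched there are no edges and no rounds; then `d` may exceed the number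
  -- of incidences, so it is replaced by `4`
  · obtain rfl : mE = 0 := by
      by_contra hne
      have := hin.ea_lt 0 (by omega)
      omega
    obtain ⟨H, q, hw, -⟩ := exists_isLayerWeight (n := 1) (d := 4) le_rfl le_rfl
    have hH4 : InputHaxell 0 0 r ea len b 4 := fun U T h1 h2 => by
      refine le_trans ?_ (hH U T h1 h2)
      gcongr
    refine ⟨_, reach_matchingProg (n := 0) (N := 0) hin hr h0 hreg harr le_rfl
      (by simp [start]) hH4 (hw.mono (by norm_num)) (fun h => (h rfl).elim) (by simp [start]), ?_⟩
    simp [start]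
    norm_num
  · set P : ℝ := ((max (mE + start len mE) 1 : ℕ) : ℝ) with hP
    have hle := hH.le_mE hr hd
    have hds := hH.le_start hr hd hin.len_pos (by omega)
    have hst : (start len mE : ℝ) ≤ P := by rw [hP]; exact_mod_cast (by omega)
    have hdP : d ≤ P := hds.trans hst
    have hA1 : (1 : ℝ) ≤ nA := by exact_mod_cast hA
    have hAP : (nA : ℝ) ≤ P := by rw [hP]; exact_mod_cast (by omega)
    obtain ⟨H, q, hw, hH1⟩ := exists_isLayerWeight hA1 hd
    set y := √(Real.logb 2 d) with hy
    have hl2 : 2 ≤ Real.logb 2 d := by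
      rw [Real.le_logb_iff_rpow_le (by norm_num) (by linarith)]
      norm_num; exact hd
    have hy1 : 1 ≤ y := Real.one_le_sqrt.2 (by linarith)
    set l := Real.logb 2 P with hl
    have hld : Real.logb 2 d ≤ l := Real.logb_le_logb_of_le (by norm_num) (by linarith) hdP
    have hyl : y ≤ l := by
      have : y * y = Real.logb 2 d := Real.mul_self_sqrt (by linarith)
      nlinarith
    have hsize : (Nat.size (start len mE) : ℝ) ≤ l + 1 := by
      have h1 : (1 : ℝ) ≤ start len mE := by linarith
      refine (size_le_logb (by exact_mod_cast h1)).trans ?_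
      have := Real.logb_le_logb_of_le (b := 2) (by norm_num) (by linarith) hst
      linarith
    have hZ : (1 : ℝ) ≤ P ^ (80 / y) := Real.one_le_rpow (by linarith) (by positivity)
    set Z := P ^ (80 / y) with hZdef
    have hR : 1 + 2 * H 1 ≤ 21 * (y * Z) := by
      have h1 : (nA : ℝ) ^ (80 / y) ≤ Z := by
        rw [hZdef]; gcongr
      have h2 : y * (nA : ℝ) ^ (80 / y) ≤ y * Z := by gcongr
      have h3 : 1 ≤ y * Z := one_le_mul_of_one_le_of_one_le hy1 hZ
      rw [hH1]
      linarith
    have hR0 : 0 ≤ 1 + 2 * H 1 := by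
      have := hw.nonneg 1 one_pos
      linarith
    have hv : ((Nat.size (start len mE) : ℝ) + 1) * (1 + 2 * H 1) ≤ 42 * (l ^ 2 * Z) := by
      calc ((Nat.size (start len mE) : ℝ) + 1) * (1 + 2 * H 1)
          ≤ (2 * l) * (21 * (y * Z)) := by
            refine mul_le_mul ?_ hR hR0 (by linarith)
            linarith
        _ ≤ (2 * l) * (21 * (l * Z)) := by
            have : 0 ≤ 2 * l := by linarith
            gcongr
        _ = 42 * (l ^ 2 * Z) := by ring
    refine ⟨_, reach_matchingProg (N := nA + mE + start len mE) hin hr h0 hreg harr hd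
      (by linarith) hH hw (fun _ => Nat.le_ceil _) le_rfl, ?_⟩
    have hc := Nat.ceil_lt_add_one (show 0 ≤ ((Nat.size (start len mE) : ℝ) + 1) * (1 + 2 * H 1)
      by positivity)
    have hl1 : 1 ≤ l ^ 2 := one_le_pow₀ (by linarith)
    have hlZ : 1 ≤ l ^ 2 * Z := one_le_mul_of_one_le_of_one_le hl1 hZ
    have hNP : ((nA + mE + start len mE : ℕ) : ℝ) + 1 ≤ 3 * P := by
      rw [hP]; exact_mod_cast (by omega)
    have hPP : l ^ 2 * Z ≤ P ^ (84 / y) := by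
      have h1 := sq_logb_le_rpow hd hdP
      calc l ^ 2 * Z ≤ P ^ (4 / y) * Z := by gcongr
        _ = P ^ (84 / y) := by
          rw [hZdef, ← Real.rpow_add (by linarith)]
          congr 1
          ring
    push_cast at hNP ⊢
    rw [Real.rpow_add (by linarith), Real.rpow_one]
    calc 5000 * (((⌈((Nat.size (start len mE) : ℝ) + 1) * (1 + 2 * H 1)⌉₊ : ℝ) + 2) *
          ((nA : ℝ) + mE + start len mE + 1))
        ≤ 5000 * ((45 * (l ^ 2 * Z)) * (3 * P)) := by
          refine mul_le_mul_of_nonneg_left ?_ (by norm_num)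
          refine mul_le_mul ?_ hNP (by positivity) (by positivity)
          linarith
      _ ≤ 5000 * ((45 * P ^ (84 / y)) * (3 * P)) := by gcongr
      _ ≤ 1000000 * (P * P ^ (84 / y)) := by
          have : 0 ≤ P * P ^ (84 / y) := by positivity
          linarith

end WordRAM

namespace EdgeList

/-! ### Edge lists -/

variable {nA nB : ℕ}

/-- The vertex of the edge `e` in the first class, as a number. -/
def vertA (L : EdgeList nA nB) (e : ℕ) : ℕ := L[e]?.elim 0 fun x => (x.1 : ℕ)

/-- The number of vertices of the edge `e` in the second class. -/
def size (L : EdgeList nA nB) (e : ℕ) : ℕ := L[e]?.elim 0 fun x => x.2.length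

/-- The vertices of the edge `e` in the second class, as numbers. -/
def vertB (L : EdgeList nA nB) (e t : ℕ) : ℕ :=
  L[e]?.elim 0 fun x => x.2[t]?.elim 0 fun b => (b : ℕ)

theorem vertA_eq (L : EdgeList nA nB) {e : ℕ} (he : e < L.length) : L.vertA e = (L[e].1 : ℕ) := by
  simp [vertA, he]

theorem size_eq (L : EdgeList nA nB) {e : ℕ} (he : e < L.length) : L.size e = L[e].2.length := by
  simp [size, he]

theorem vertB_eq (L : EdgeList nA nB) {e t : ℕ} (he : e < L.length) (ht : t < L[e].2.length) :
    L.vertB e t = (L[e].2[t] : ℕ) := by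
  simp [vertB, he, ht]

/-- The part of the encoding that belongs to one edge. -/
def word (x : Fin nA × List (Fin nB)) : List ℕ :=
  (x.1 : ℕ) :: x.2.length :: x.2.map Fin.val

theorem encode_eq (L : EdgeList nA nB) :
    encode L = nA :: nB :: L.length :: L.flatMap word := by
  have : ∀ l : List (Fin nB), l.map Fin.val = l >>= fun b => pure (b : ℕ) := fun l =>
    List.map_eq_flatMap
  simp only [encode, List.map_id', ← this]
  rfl

/-- The position of an entry of the edge `e` in the encoding: each earlier edge takes two entries
more than its number of vertices in the second class. -/
theorem getD_flatMap_word (L : EdgeList nA nB) {e k : ℕ} (he : e < L.length)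
    (hk : k < 2 + L.size e) :
    (L.flatMap word).getD (2 * e + WordRAM.start L.size e + k) 0 = (word L[e]).getD k 0 := by
  induction L generalizing e with
  | nil => simp at he
  | cons x L ih =>
      have hw : (word x).length = 2 + x.2.length := by simp [word]; omega
      rw [List.flatMap_cons]
      cases e with
      | zero =>
          have hk' : k < (word x).length := by rw [hw]; simpa [size] using hk
          rw [List.getD_append _ _ _ _ (by simpa [WordRAM.start] using hk')]
          simp [WordRAM.start]
      | succ e =>
          have h1 : WordRAM.start (size (x :: L)) (e + 1) =
              WordRAM.start (size L) e + x.2.length := by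
            simp only [WordRAM.start, Finset.sum_range_succ']
            simp [size]
          have h2 : 2 * (e + 1) + WordRAM.start (size (x :: L)) (e + 1) + k - (word x).length
              = 2 * e + WordRAM.start (size L) e + k := by
            rw [h1, hw]; omega
          rw [List.getD_append_right _ _ _ _ (by rw [h1, hw]; omega), h2,
            ih (by simpa using he) (by simpa [size] using hk)]
          simp

variable {H : BipartiteHypergraph (Fin nA) (Fin nB)} {L : EdgeList nA nB}

theorem Presents.mem (h : L.Presents H) {x : Fin nA × List (Fin nB)} (hx : x ∈ L) :
    toEdge x ∈ H.E := by
  rw [← h.2.1]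
  exact List.mem_toFinset.2 (List.mem_map_of_mem hx)

theorem card_toRight_toEdge {x : Fin nA × List (Fin nB)} (hx : x.2.Nodup) :
    (toEdge x).toRight.card = x.2.length := by
  rw [toEdge, Finset.toRight_disjSum, List.toFinset_card_of_nodup hx]

theorem Presents.isInput (h : L.Presents H) {r : ℕ} (hr : H.IsBounded r) :
    WordRAM.IsInput ((WordRAM.initState L.encode).arr 0) nA L.length r L.vertA L.size L.vertB := by
  have henc : ∀ i, (WordRAM.initState L.encode).arr 0 i = (encode L).getD i 0 := fun i => by
    simp [WordRAM.initState]
  have hpos : ∀ e (he : e < L.length), ∀ k < 2 + L.size e, ∀ i,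
      i = 2 * e + WordRAM.start L.size e + k + 3 →
      (WordRAM.initState L.encode).arr 0 i = (word L[e]).getD k 0 := by
    rintro e he k hk i rfl
    rw [henc, ← getD_flatMap_word L he hk, encode_eq]
    rfl
  have hcard : ∀ e (he : e < L.length), (toEdge L[e]).toRight.card = L.size e := fun e he => by
    rw [card_toRight_toEdge (h.2.2 _ (List.getElem_mem he)), L.size_eq he]
  constructor
  · rw [henc, encode_eq]; rfl
  · rw [henc, encode_eq]; rfl
  · intro e he
    rw [hpos e he 0 (by omega) _ (by omega), L.vertA_eq he]
    rfl
  · intro e he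
    rw [hpos e he 1 (by omega) _ (by omega), L.size_eq he]
    rfl
  · intro e he t ht
    rw [hpos e he (t + 2) (by omega) _ (by omega)]
    rw [L.size_eq he] at ht
    rw [L.vertB_eq he ht]
    simp [word, ht]
  · intro e he
    rw [L.vertA_eq he]
    exact L[e].1.2
  · intro e he
    rw [← hcard e he]
    exact H.card_B _ (h.mem (List.getElem_mem he))
  · intro e he
    rw [← hcard e he]
    exact hr _ (h.mem (List.getElem_mem he))

theorem Presents.inputHaxell (h : L.Presents H) {r : ℕ} {d φ : ℝ} (hd : d * (r : ℝ) ^ 2 ≤ φ)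
    (hd0 : 0 ≤ d) (hH : H.StrongHaxell φ) :
    WordRAM.InputHaxell nA L.length r L.vertA L.size L.vertB d := by
  intro U T hU hT
  set S : Finset (Fin nA) := Finset.univ.filter fun a => (a : ℕ) ∈ U with hS
  set T' : Finset (Fin nB) := Finset.univ.filter fun b => (b : ℕ) ∈ T with hT'
  have hSU : U.card ≤ S.card := by
    refine (Finset.card_le_card fun a ha => ?_).trans
      (Finset.card_image_le (f := fun a : Fin nA => (a : ℕ)))
    exact Finset.mem_image.2 ⟨⟨a, hU a ha⟩, by simpa [hS] using ha, rfl⟩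
  have hTT : T'.card ≤ T.card :=
    Finset.card_le_card_of_injOn (fun b => (b : ℕ)) (fun b hb => by simpa [hT'] using hb)
      fun a _ b _ hab => Fin.ext hab
  have hit : BipartiteHypergraph.IsHittingSet (H.edgesAt S) T' := by
    rintro f ⟨hf, a, ha, haf⟩
    rw [← h.2.1, List.mem_toFinset, List.mem_map] at hf
    obtain ⟨x, hx, rfl⟩ := hf
    obtain ⟨e, he, rfl⟩ := List.getElem_of_mem hx
    have hxa : a = L[e].1 := by simpa [toEdge] using haf
    obtain ⟨t, ht, hb⟩ := hT e he (by
      rw [L.vertA_eq he, ← hxa]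
      simpa [hS] using ha)
    rw [L.size_eq he] at ht
    rw [L.vertB_eq he ht] at hb
    exact ⟨L[e].2[t], by simpa [hT'] using hb, by simp [toEdge]⟩
  have htau : BipartiteHypergraph.tau (H.edgesAt S) ≤ T'.card := Nat.sInf_le ⟨T', hit, rfl⟩
  have hφ : 0 ≤ φ := le_trans (by positivity) hd
  calc d * r ^ 2 * U.card ≤ φ * S.card := by gcongr
    _ ≤ BipartiteHypergraph.tau (H.edgesAt S) := hH S
    _ ≤ T.card := by exact_mod_cast htau.trans hTT

theorem Presents.volume_eq (h : L.Presents H) :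
    H.volume = L.length + WordRAM.start L.size L.length := by
  have h1 : H.volume = (L.map fun x => x.2.length + 1).sum := by
    rw [BipartiteHypergraph.volume, ← h.2.1, List.sum_toFinset _ h.1, List.map_map]
    refine congrArg _ (List.map_congr_left fun x hx => ?_)
    simp [toEdge, Finset.card_disjSum, List.toFinset_card_of_nodup (h.2.2 x hx), add_comm]
  have h2 : WordRAM.start L.size L.length = (L.map fun x => x.2.length).sum := by
    rw [WordRAM.start, ← Fin.sum_univ_eq_sum_range, ← List.sum_ofFn]
    refine congrArg _ (List.ext_getElem (by simp) fun i h1 h2 => ?_)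
    simp only [List.length_ofFn] at h1
    simp [size]
  rw [h1, h2, List.sum_map_add]
  simp [add_comm]

theorem Presents.exists_matching (h : L.Presents H) {s : WordRAM.State}
    (hs : WordRAM.HasMatching nA L.length L.vertA L.size L.vertB s) :
    ∃ M, L.Outputs s M ∧ H.IsPerfectMatching M := by
  obtain ⟨h0, h1, h2⟩ := hs
  set f : Fin nA → Fin L.length := fun a => ⟨s.arr 1 (a + 1), (h1 a a.2).1⟩ with hf
  have hfa : ∀ a, (L.get (f a)).1 = a := fun a => by
    refine Fin.ext ?_
    rw [← (h1 a a.2).2, L.vertA_eq (h1 a a.2).1]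
    rfl
  refine ⟨_, ⟨(List.finRange nA).map f, ?_, ?_, ?_, rfl⟩, ?_, ?_, ?_⟩
  · refine List.Nodup.map (fun a a' h => ?_) (List.nodup_finRange nA)
    rw [← hfa a, h, hfa a']
  · simpa using h0
  · intro j
    simp [hf]
  · intro e he
    simp only [List.map_map, List.mem_toFinset, List.mem_map] at he
    obtain ⟨a, -, rfl⟩ := he
    exact h.mem (List.get_mem _ _)
  · intro e he e' he' hne
    simp only [List.map_map, List.mem_toFinset, List.mem_map] at he he'
    obtain ⟨a, -, rfl⟩ := he
    obtain ⟨a', -, rfl⟩ := he'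
    have hne' : a ≠ a' := fun h => hne (h ▸ rfl)
    rw [Finset.disjoint_left]
    rintro (x | x) hx hx'
    · simp only [Function.comp, toEdge, Finset.inl_mem_disjSum, Finset.mem_singleton] at hx hx'
      exact hne' ((hfa a).symm.trans (hx.symm.trans (hx'.trans (hfa a'))))
    · simp only [Function.comp, toEdge, Finset.inr_mem_disjSum, List.mem_toFinset] at hx hx'
      obtain ⟨t, ht, rfl⟩ := List.getElem_of_mem hx
      obtain ⟨t', ht', heq⟩ := List.getElem_of_mem hx'
      refine h2 a a.2 a' a'.2 (fun h => hne' (Fin.ext h)) t ?_ t' ?_ ?_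
      · rw [L.size_eq (h1 a a.2).1]; exact ht
      · rw [L.size_eq (h1 a' a'.2).1]; exact ht'
      · rw [L.vertB_eq (h1 a a.2).1 ht, L.vertB_eq (h1 a' a'.2).1 ht']
        exact congrArg Fin.val heq.symm
  · intro a
    refine ⟨toEdge (L.get (f a)), ?_, ?_⟩
    · simp only [List.map_map, List.mem_toFinset, List.mem_map]
      exact ⟨a, List.mem_finRange a, rfl⟩
    · simp only [toEdge, Finset.inl_mem_disjSum, Finset.mem_singleton]
      exact (hfa a).symm

theorem Presents.bounded_initState (h : L.Presents H) :
    (WordRAM.initState L.encode).Bounded (H.numVertices + H.volume) := by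
  have hn : H.numVertices = nA + nB := by simp [BipartiteHypergraph.numVertices]
  refine ⟨fun _ => Nat.zero_le _, fun a i => ?_⟩
  simp only [WordRAM.initState]
  split
  · rw [List.getD_eq_getElem?_getD]
    rcases lt_or_ge i (encode L).length with hi | hi
    · rw [List.getElem?_eq_getElem hi, Option.getD_some]
      have hmem := List.getElem_mem hi
      generalize (encode L)[i] = v at hmem
      simp only [encode_eq, word, List.mem_cons, List.mem_flatMap, List.mem_map] at hmem
      have hv := h.volume_eq
      rcases hmem with rfl | rfl | rfl | ⟨x, hx, rfl | rfl | ⟨b, -, rfl⟩⟩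
      · omega
      · omega
      · omega
      · omega
      · obtain ⟨e, he, rfl⟩ := List.getElem_of_mem hx
        have := WordRAM.start_mono L.size (show e + 1 ≤ L.length from he)
        rw [WordRAM.start_succ, L.size_eq he] at this
        omega
      · have := b.2
        omega
    · rw [List.getElem?_eq_none hi]
      simp
  · exact Nat.zero_le _

end EdgeList

set_option exponentiation.threshold 4000 in
/-- The word length suffices: all numbers in a run of at most `T` steps have at most `w` bits. -/
theorem pow_lt_two_pow {N T p w : ℕ} {x : ℝ} (hN : 2 ≤ N) (hp : p ≤ N) (hp1 : 1 ≤ p) (hx : x ≤ 85)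
    (hT : (T : ℝ) ≤ 1000000 * (p : ℝ) ^ x) (hw : N ^ 3301 ≤ 2 ^ w) :
    (N + 100 + T) ^ 30 < 2 ^ w := by
  have hp1' : (1 : ℝ) ≤ p := by exact_mod_cast hp1
  have h1 : T ≤ 1000000 * N ^ 85 := by
    have h2 : (p : ℝ) ^ x ≤ (N : ℝ) ^ (85 : ℕ) := by
      calc (p : ℝ) ^ x ≤ (p : ℝ) ^ (85 : ℝ) := Real.rpow_le_rpow_of_exponent_le hp1' hx
        _ = (p : ℝ) ^ (85 : ℕ) := by rw [← Real.rpow_natCast]; norm_num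
        _ ≤ (N : ℝ) ^ (85 : ℕ) := by gcongr
    have : (T : ℝ) ≤ 1000000 * (N : ℝ) ^ (85 : ℕ) := by linarith
    exact_mod_cast this
  have h20 : 2000000 ≤ N ^ 25 := (by norm_num : 2000000 ≤ 2 ^ 25).trans (Nat.pow_le_pow_left hN 25)
  have h3 : N + 100 + T ≤ N ^ 110 := by
    have h4 : N ≤ N ^ 85 := Nat.le_self_pow (by norm_num) N
    have h5 : 1 ≤ N ^ 85 := Nat.one_le_pow _ _ (by omega)
    calc N + 100 + T ≤ 2000000 * N ^ 85 := by omega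
      _ ≤ N ^ 25 * N ^ 85 := Nat.mul_le_mul_right _ h20
      _ = N ^ 110 := by rw [← pow_add]
  calc (N + 100 + T) ^ 30 ≤ (N ^ 110) ^ 30 := Nat.pow_le_pow_left h3 30
    _ = N ^ (110 * 30) := (pow_mul N 110 30).symm
    _ < N ^ 3301 := Nat.pow_lt_pow_right (by omega) (by decide)
    _ ≤ 2 ^ w := hw

theorem theorem1p4 :
    ∃ (P : WordRAM.Program) (κ : ℕ) (C c : ℝ), 0 < κ ∧ 0 < C ∧ 0 < c ∧
      ∀ (d : ℕ → ℝ) (nA nB r : ℕ) (φ : ℝ) (H : BipartiteHypergraph (Fin nA) (Fin nB)),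
        1 ≤ r → H.IsBounded r →
        4 ≤ d H.numVertices → d H.numVertices * (r : ℝ) ^ 2 ≤ φ → H.StrongHaxell φ →
        ∀ L : EdgeList nA nB, L.Presents H →
        ∀ w : ℕ, (H.numVertices + H.volume + 2) ^ κ ≤ 2 ^ w →
          ∃ (t : ℕ) (s : WordRAM.State) (M : Finset (Finset (Fin nA ⊕ Fin nB))),
            WordRAM.Exec w P (WordRAM.initState L.encode) t s ∧
            L.Outputs s M ∧ H.IsPerfectMatching M ∧
            (t : ℝ) ≤ C * ((max H.volume 1 : ℕ) : ℝ) ^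
              (1 + 1 / (c * √(Real.logb 2 (d H.numVertices)))) := by
  refine ⟨WordRAM.matchingProg, 3301, 1000000, 1 / 84, by norm_num, by norm_num, by norm_num, ?_⟩
  intro d nA nB r φ H hr hb hd hφ hH L hL w hw
  obtain ⟨T, ⟨t, s, hrun, htT, hs⟩, hT⟩ := WordRAM.exists_reach_matchingProg (hL.isInput hb) hr rfl
    rfl (fun a ha => by funext i; simp [WordRAM.initState, ha]) hd
    (hL.inputHaxell hφ (by linarith) hH)
  rw [← hL.volume_eq] at hT
  have hy : 1 ≤ √(Real.logb 2 (d H.numVertices)) := by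
    refine Real.one_le_sqrt.2 ?_
    rw [Real.le_logb_iff_rpow_le (by norm_num) (by linarith)]
    norm_num
    linarith
  have hexp : 1 + 84 / √(Real.logb 2 (d H.numVertices)) ≤ 85 := by
    have := div_le_self (show (0 : ℝ) ≤ 84 by norm_num) hy
    linarith
  have hbd := pow_lt_two_pow (N := H.numVertices + H.volume + 2) (by omega) (by omega)
    (le_max_right _ _) hexp hT hw
  obtain ⟨hexec, -⟩ := hrun.exec hbd (H.numVertices + H.volume + 2 + 100)
    WordRAM.matchingProg_tame (hL.bounded_initState.mono (by omega)) (by omega) (by omega)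
  obtain ⟨M, hM, hM'⟩ := hL.exists_matching hs
  refine ⟨t, s, M, hexec, hM, hM', ?_⟩
  have : 1 / (1 / 84 * √(Real.logb 2 (d H.numVertices)))
      = 84 / √(Real.logb 2 (d H.numVertices)) := by
    field_simp
  rw [this]
  exact (by exact_mod_cast htT : (t : ℝ) ≤ T).trans hT
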